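/- Let $N\ge 1$. Let $S^{N-1}_{\mathbb R,+}$ be the free real sphere, $C(S^{N-1}_{\mathbb R,+})=C^*(x_1,\dots,x_N\mid x_i=x_i^*,\ \sum_i x_i^2=1)$, and consider its following subspaces, given by relations between the coordinates: - $S^{N-1}_{\mathbb R}$, the usual sphere, and $S^{N-1,d-1}_{\mathbb R}=\{x\in S^{N-1}_{\mathbb R}: x_{i_0}\cdots x_{i_d}=0\ \text{for all distinct } i_0,\dots,i_d\}$; - $S^{N-1}_{\mathbb R,*}$: $x_ix_jx_k=x_kx_jx_i$ for all $i,j,k$; - $\bar S^{N-1}_{\mathbb R}$: $x_ix_j=-x_jx_i$ for $i\ne j$; - $\bar S^{N-1}_{\mathbb R,*}$: $x_ix_jx_k=-x_kx_jx_i$ for $i,j,k$ distinct, and $x_ix_jx_k=x_kx_jx_i$ otherwise; - $S^{N-1,1}_{\mathbb R,*}\subset S^{N-1}_{\mathbb R,*}$ and $\bar S^{N-1,1}_{\mathbb R}\subset \bar S^{N-1}_{\mathbb R}$: in addition, $x_ix_jx_k=0$ for $i,j,k$ distinct. Let $O_N^+$ be the free orthogonal quantum group, whose algebra is the universal $C^*$-algebra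 generated by self-adjoint $u_{ij}$, $1\le i,j\le N$, such that $u=(u_{ij})$ is orthogonal, $uu^t=u^tu=1$. A closed quantum subgroup $G\subset O_N^+$ acts affinely on $X\subset S^{N-1}_{\mathbb R,+}$ if there is a morphism of unital $C^*$-algebras $\Phi:C(X)\to C(G)\otimes C(X)$ with $\Phi(x_i)=\sum_j u_{ij}\otimes x_j$; the quantum isometry group $G^+(X)$ is the universal (largest) closed quantum subgroup of $O_N^+$ acting affinely on $X$. Let $O_N$ be the orthogonal group, let $H_N\subset O_N$ be the hyperoctahedral group (the signed permutation matrices), and define closed quantum subgroups of $O_N^+$ by the following relations, where $a,b,c$ denote arbitrary entries of $u$: - $O_N^*$: $abc=cba$; - $\bar O_N$: $ab=-ba$ if $a\ne b$ are on the same row or column of $u$, and $ab=ba$ otherwise; - $\bar O_N^*$: with $r,s$ being the numbers of rows and columns of $u$ spanned by $a,b,c$, $abc=-cba$ if exactly one of $r,s$ equals $3$, and $abc=cba$ otherwise; - $H_N^+$: $ab=0$ if $a\ne b$ are on the same row or column of $u$; - $H_N^{[\infty]}$: $abc=0$ if $a\ne c$ are on the same row or column of $u$. **Theorem.** For $N\ge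 3$, the quantum isometry groups of the $9$ main spheres are $$G^+(S^{N-1}_{\mathbb R})=O_N,\quad G^+(S^{N-1}_{\mathbb R,*})=O_N^*,\quad G^+(S^{N-1}_{\mathbb R,+})=O_N^+,$$ $$G^+(S^{N-1,1}_{\mathbb R})=H_N,\quad G^+(S^{N-1,1}_{\mathbb R,*})=H_N^{[\infty]},\quad G^+(\bar S^{N-1}_{\mathbb R,*})=\bar O_N^*,$$ $$G^+(S^{N-1,0}_{\mathbb R})=H_N^+,\quad G^+(\bar S^{N-1,1}_{\mathbb R})=H_N,\quad G^+(\bar S^{N-1}_{\mathbb R})=\bar O_N.$$ Moreover, the six equalities not involving $S^{N-1,1}_{\mathbb R},S^{N-1,1}_{\mathbb R,*},\bar S^{N-1,1}_{\mathbb R}$ hold for all $N\ge 1$. -/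

import Mathlib

open scoped TensorProduct InnerProductSpace

noncomputable section

/-! ## C*-seminorms and the associated C*-completions -/

section Completion

variable {R : Type*} [Ring R] [StarRing R] [Algebra ℂ R]

/-- A C*-seminorm on a complex unital *-algebra. -/
structure CStarSeminorm (R : Type*) [Ring R] [StarRing R] [Algebra ℂ R] extends
    Seminorm ℂ R where
  mul_le (a b : R) : toFun (a * b) ≤ toFun a * toFun b
  star_mul_self (a : R) : toFun (star a * a) = toFun a ^ 2

namespace CStarSeminorm

instance : CoeFun (CStarSeminorm R) fun _ => R → ℝ := ⟨fun p => p.toFun⟩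

/-- The *-algebra `R`, seminormed by the C*-seminorm `p`. -/
def Carrier (_ : CStarSeminorm R) : Type _ := R

variable (p : CStarSeminorm R)

instance : Ring p.Carrier := inferInstanceAs (Ring R)

instance : SeminormedRing p.Carrier where
  toRing := inferInstance
  norm a := p a
  toPseudoMetricSpace := p.toSeminorm.toAddGroupSeminorm.toSeminormedAddCommGroup.toPseudoMetricSpace
  dist_eq a b := p.toSeminorm.toAddGroupSeminorm.toSeminormedAddCommGroup.dist_eq a b
  norm_mul_le a b := p.mul_le a b

instance : StarRing p.Carrier := inferInstanceAs (StarRing R)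

instance : Algebra ℂ p.Carrier := inferInstanceAs (Algebra ℂ R)

instance : NormedAlgebra ℂ p.Carrier where
  toAlgebra := inferInstance
  norm_smul_le c a := (p.smul' c a).le

theorem norm_star_mul_self' (a : p.Carrier) : ‖star a * a‖ = ‖a‖ ^ 2 := p.star_mul_self a

theorem norm_star_le (a : p.Carrier) : ‖star a‖ ≤ ‖a‖ := by
  by_contra h
  push Not at h
  have h1 := norm_star_mul_self' p (star a)
  rw [star_star] at h1
  have h2 := norm_mul_le a (star a)
  have h3 := norm_nonneg a
  nlinarith

instance : NormedStarGroup p.Carrier where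
  norm_star_le a := norm_star_le p a

/-- The separated completion of `R` with respect to the C*-seminorm `p`, a unital C*-algebra. -/
def Completion : Type _ := UniformSpace.Completion p.Carrier

instance : NormedRing p.Completion :=
  inferInstanceAs (NormedRing (UniformSpace.Completion p.Carrier))

instance : CompleteSpace p.Completion :=
  inferInstanceAs (CompleteSpace (UniformSpace.Completion p.Carrier))

instance : Algebra ℂ p.Completion :=
  inferInstanceAs (Algebra ℂ (UniformSpace.Completion p.Carrier))

/-- The canonical map from `R` to its completion. -/
def of (a : R) : p.Completion := UniformSpace.Completion.coe' (α := p.Carrier) a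

theorem norm_of (a : R) : ‖p.of a‖ = p a :=
  UniformSpace.Completion.norm_coe (E := p.Carrier) a

theorem isometry_star : Isometry (star : p.Carrier → p.Carrier) := star_isometry

/-- The involution of the completion is the continuous extension of the involution of `R`. -/
instance : Star p.Completion := ⟨UniformSpace.Completion.map (star : p.Carrier → p.Carrier)⟩

theorem star_of (a : R) : star (p.of a) = p.of (star a) :=
  UniformSpace.Completion.map_coe (isometry_star p).uniformContinuous a

theorem continuous_star_completion : Continuous (star : p.Completion → p.Completion) :=
  UniformSpace.Completion.continuous_map

theorem of_add (a b : R) : p.of (a + b) = p.of a + p.of b :=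
  UniformSpace.Completion.coe_add (α := p.Carrier) a b

theorem of_mul (a b : R) : p.of (a * b) = p.of a * p.of b :=
  UniformSpace.Completion.coe_mul (α := p.Carrier) a b

theorem of_smul (c : ℂ) (a : R) : p.of (c • a) = c • p.of a :=
  UniformSpace.Completion.coe_smul (X := p.Carrier) c a

theorem dense_of : DenseRange p.of := UniformSpace.Completion.denseRange_coe (α := p.Carrier)

instance : StarRing p.Completion where
  star_involutive x := by
    refine p.dense_of.induction_on x (isClosed_eq ?_ continuous_id) fun a => ?_
    · exact p.continuous_star_completion.comp p.continuous_star_completion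
    · rw [star_of, star_of, star_star]
  star_mul x y := by
    refine p.dense_of.induction_on₂ (p := fun x y => star (x * y) = star y * star x) ?_ ?_ x y
    · have := p.continuous_star_completion
      exact isClosed_eq (by fun_prop) (by fun_prop)
    · intro a b
      rw [← of_mul, star_of, star_of, star_of, star_mul, of_mul]
  star_add x y := by
    refine p.dense_of.induction_on₂ (p := fun x y => star (x + y) = star x + star y) ?_ ?_ x y
    · have := p.continuous_star_completion
      exact isClosed_eq (by fun_prop) (by fun_prop)
    · intro a b
      rw [← of_add, star_of, star_of, star_of, star_add, of_add]

instance [StarModule ℂ R] : CStarAlgebra p.Completion where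
  norm_smul_le c x := norm_smul_le (β := UniformSpace.Completion p.Carrier) c x
  norm_mul_self_le x := by
    refine p.dense_of.induction_on x ?_ fun a => ?_
    · have := p.continuous_star_completion
      exact isClosed_le (by fun_prop) (by fun_prop)
    · rw [star_of, ← of_mul, norm_of, norm_of, p.star_mul_self, sq]
  star_smul c x := by
    refine p.dense_of.induction_on x ?_ fun a => ?_
    · have := p.continuous_star_completion
      have h : ∀ c : ℂ, Continuous fun x : p.Completion => c • x := fun c =>
        continuous_const_smul (T := UniformSpace.Completion p.Carrier) c
      exact isClosed_eq (this.comp (h c)) ((h _).comp this)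
    · rw [← of_smul, star_of, star_of, star_smul, of_smul]

/-- The pointwise supremum of a pointwise bounded set of C*-seminorms. -/
def sup (S : Set (CStarSeminorm R)) (hS : ∀ a, ∃ C, ∀ p ∈ S, p a ≤ C) : CStarSeminorm R where
  toFun a := ⨆ p : S, p.1 a
  map_zero' := by
    have : ∀ p : S, p.1 (0 : R) = 0 := fun p => map_zero p.1.toSeminorm
    simp [this]
  add_le' a b := by
    have bd : ∀ a, BddAbove (Set.range fun p : S => p.1 a) := fun a => by
      obtain ⟨C, hC⟩ := hS a
      exact ⟨C, by rintro _ ⟨p, rfl⟩; exact hC p.1 p.2⟩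
    have nn : ∀ a, 0 ≤ ⨆ p : S, p.1 a := fun a =>
      Real.iSup_nonneg fun p => apply_nonneg p.1.toSeminorm a
    refine Real.iSup_le (fun p => ?_) (add_nonneg (nn a) (nn b))
    exact (p.1.add_le' a b).trans (add_le_add (le_ciSup (bd a) p) (le_ciSup (bd b) p))
  neg' a := by
    have : ∀ p : S, p.1 (-a) = p.1 a := fun p => p.1.neg' a
    simp only [this]
  smul' c a := by
    have : ∀ p : S, p.1 (c • a) = ‖c‖ * p.1 a := fun p => p.1.smul' c a
    simp only [this]
    exact (Real.mul_iSup_of_nonneg (norm_nonneg c) _).symm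
  mul_le a b := by
    have bd : ∀ a, BddAbove (Set.range fun p : S => p.1 a) := fun a => by
      obtain ⟨C, hC⟩ := hS a
      exact ⟨C, by rintro _ ⟨p, rfl⟩; exact hC p.1 p.2⟩
    have nn : ∀ a, 0 ≤ ⨆ p : S, p.1 a := fun a =>
      Real.iSup_nonneg fun p => apply_nonneg p.1.toSeminorm a
    refine Real.iSup_le (fun p => ?_) (mul_nonneg (nn a) (nn b))
    exact (p.1.mul_le a b).trans (mul_le_mul (le_ciSup (bd a) p) (le_ciSup (bd b) p)
      (apply_nonneg p.1.toSeminorm b) (nn a))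
  star_mul_self a := by
    have bd : ∀ a, BddAbove (Set.range fun p : S => p.1 a) := fun a => by
      obtain ⟨C, hC⟩ := hS a
      exact ⟨C, by rintro _ ⟨p, rfl⟩; exact hC p.1 p.2⟩
    have nn : ∀ a, 0 ≤ ⨆ p : S, p.1 a := fun a =>
      Real.iSup_nonneg fun p => apply_nonneg p.1.toSeminorm a
    apply le_antisymm
    · refine Real.iSup_le (fun p => ?_) (sq_nonneg _)
      rw [show p.1 (star a * a) = p.1 a ^ 2 from p.1.star_mul_self a]
      exact pow_le_pow_left₀ (apply_nonneg p.1.toSeminorm a) (le_ciSup (bd a) p) 2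
    · have h : ⨆ p : S, p.1 a ≤ Real.sqrt (⨆ p : S, p.1 (star a * a)) := by
        refine Real.iSup_le (fun p => ?_) (Real.sqrt_nonneg _)
        apply Real.le_sqrt_of_sq_le
        rw [← show p.1 (star a * a) = p.1 a ^ 2 from p.1.star_mul_self a]
        exact le_ciSup (bd (star a * a)) p
      calc (⨆ p : S, p.1 a) ^ 2 ≤ Real.sqrt (⨆ p : S, p.1 (star a * a)) ^ 2 :=
            pow_le_pow_left₀ (nn a) h 2
        _ = _ := Real.sq_sqrt (nn _)

end CStarSeminorm

end Completion

/-! ## Noncommutative polynomials in self-adjoint variables, and universal C*-algebras -/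

/-- The *-algebra of noncommutative polynomials with complex coefficients in the self-adjoint
variables indexed by `ι`. -/
abbrev NCPoly (ι : Type) : Type := MonoidAlgebra ℂ (FreeMonoid ι)

namespace NCPoly

variable {ι : Type}

/-- The involution: conjugate the coefficients and reverse the monomials. -/
instance : Star (NCPoly ι) :=
  ⟨MonoidAlgebra.liftNC
    ((MonoidAlgebra.singleOneRingHom.comp (starRingEnd ℂ) : ℂ →+* NCPoly ι) : ℂ →+ NCPoly ι)
    fun m => MonoidAlgebra.of ℂ (FreeMonoid ι) (star m)⟩

theorem star_single (m : FreeMonoid ι) (c : ℂ) :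
    star (MonoidAlgebra.single m c : NCPoly ι) = MonoidAlgebra.single (star m) (star c) := by
  change MonoidAlgebra.liftNC _ _ _ = _
  rw [MonoidAlgebra.liftNC_single]
  simp [MonoidAlgebra.single_mul_single, MonoidAlgebra.singleOneRingHom]

theorem star_zero' : star (0 : NCPoly ι) = 0 := map_zero (MonoidAlgebra.liftNC _ _)

theorem star_add' (a b : NCPoly ι) : star (a + b) = star a + star b :=
  map_add (MonoidAlgebra.liftNC _ _) a b

instance : StarRing (NCPoly ι) where
  star_add := star_add'
  star_involutive a := by
    induction a using MonoidAlgebra.induction_linear with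
    | zero => rw [star_zero', star_zero']
    | add a b ha hb => rw [star_add', star_add', ha, hb]
    | single m c => rw [star_single, star_single, star_star, star_star]
  star_mul a b := by
    induction a using MonoidAlgebra.induction_linear with
    | zero => rw [zero_mul, star_zero', mul_zero]
    | add a a' ha ha' => rw [add_mul, star_add', star_add', mul_add, ha, ha']
    | single m c =>
      induction b using MonoidAlgebra.induction_linear with
      | zero => rw [mul_zero, star_zero', zero_mul]
      | add b b' hb hb' => rw [mul_add, star_add', star_add', add_mul, hb, hb']
      | single n d =>
        rw [MonoidAlgebra.single_mul_single, star_single, star_single, star_single,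
          MonoidAlgebra.single_mul_single, star_mul, star_mul]

instance : StarModule ℂ (NCPoly ι) where
  star_smul c a := by
    induction a using MonoidAlgebra.induction_linear with
    | zero => rw [smul_zero, star_zero', smul_zero]
    | add a b ha hb => rw [smul_add, star_add', star_add', smul_add, ha, hb]
    | single m d =>
      rw [MonoidAlgebra.smul_single, star_single, star_single, MonoidAlgebra.smul_single,
        smul_eq_mul, smul_eq_mul, star_mul']

/-- The variable with index `i`. -/
def X (i : ι) : NCPoly ι := MonoidAlgebra.of ℂ (FreeMonoid ι) (FreeMonoid.of i)

theorem star_X (i : ι) : star (X i) = X i := by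
  simp [X, star_single]

/-- The C*-seminorms on the noncommutative polynomials which vanish on a set `P` of relations.
The condition that the variables have norm at most `1` only serves to guarantee that the supremum
of these seminorms is finite: it is automatic as soon as the relations express some sum of squares
involving `x_i` as the unit, which is the case for all the relations considered below. -/
def admissible (P : Set (NCPoly ι)) : Set (CStarSeminorm (NCPoly ι)) :=
  {p | (∀ i, p (X i) ≤ 1) ∧ ∀ f ∈ P, p f = 0}

theorem admissible_bounded (P : Set (NCPoly ι)) (a : NCPoly ι) :
    ∃ C, ∀ p ∈ admissible P, p a ≤ C := by
  induction a using MonoidAlgebra.induction_on with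
  | of m =>
    refine ⟨1, fun p hp => ?_⟩
    induction m using FreeMonoid.inductionOn' with
    | one =>
      have h := p.star_mul_self 1
      rw [star_one, mul_one] at h
      rw [map_one]
      change p.toFun 1 ≤ 1
      nlinarith [sq_nonneg (p.toFun 1 - 1)]
    | of_mul i m hm =>
      rw [map_mul]
      exact (p.mul_le _ _).trans (mul_le_one₀ (hp.1 i) (apply_nonneg p.toSeminorm _) hm)
  | add a b ha hb =>
    obtain ⟨C, hC⟩ := ha
    obtain ⟨D, hD⟩ := hb
    exact ⟨C + D, fun p hp => (p.add_le' a b).trans (add_le_add (hC p hp) (hD p hp))⟩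
  | smul c a ha =>
    obtain ⟨C, hC⟩ := ha
    exact ⟨‖c‖ * C, fun p hp => (p.smul' c a).le.trans
      (mul_le_mul_of_nonneg_left (hC p hp) (norm_nonneg c))⟩

/-- The universal C*-seminorm for the relations `P`. -/
def universalSeminorm (P : Set (NCPoly ι)) : CStarSeminorm (NCPoly ι) :=
  CStarSeminorm.sup (admissible P) (admissible_bounded P)

end NCPoly

/-! ## The spatial tensor product of C*-algebras -/

section Spatial

/-- The algebraic tensor product of two Hilbert spaces, as a pre-Hilbert space. -/
def PreHilbertTensor (H K : Type) [NormedAddCommGroup H] [InnerProductSpace ℂ H]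
    [NormedAddCommGroup K] [InnerProductSpace ℂ K] : Type := H ⊗[ℂ] K

variable {A B H K : Type} [CStarAlgebra A] [CStarAlgebra B]
  [NormedAddCommGroup H] [InnerProductSpace ℂ H] [NormedAddCommGroup K] [InnerProductSpace ℂ K]

instance : NormedAddCommGroup (PreHilbertTensor H K) :=
  inferInstanceAs (NormedAddCommGroup (H ⊗[ℂ] K))

instance : InnerProductSpace ℂ (PreHilbertTensor H K) :=
  inferInstanceAs (InnerProductSpace ℂ (H ⊗[ℂ] K))

/-- The bounded operator `h ⊗ k ↦ S h ⊗ T k`. -/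
def tensorOp (S : H →L[ℂ] H) (T : K →L[ℂ] K) : PreHilbertTensor H K →L[ℂ] PreHilbertTensor H K :=
  (TensorProduct.mapL S T : (H ⊗[ℂ] K) →L[ℂ] (H ⊗[ℂ] K))

theorem tensorOp_add_left (S S' : H →L[ℂ] H) (T : K →L[ℂ] K) :
    tensorOp (S + S') T = tensorOp S T + tensorOp S' T := TensorProduct.mapL_add_left S S' T

theorem tensorOp_add_right (S : H →L[ℂ] H) (T T' : K →L[ℂ] K) :
    tensorOp S (T + T') = tensorOp S T + tensorOp S T' := TensorProduct.mapL_add_right S T T'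

theorem tensorOp_smul_left (c : ℂ) (S : H →L[ℂ] H) (T : K →L[ℂ] K) :
    tensorOp (c • S) T = c • tensorOp S T := TensorProduct.mapL_smul_left c S T

theorem tensorOp_smul_right (c : ℂ) (S : H →L[ℂ] H) (T : K →L[ℂ] K) :
    tensorOp S (c • T) = c • tensorOp S T := TensorProduct.mapL_smul_right c S T

theorem tensorOp_mul (S S' : H →L[ℂ] H) (T T' : K →L[ℂ] K) :
    tensorOp (S * S') (T * T') = tensorOp S T * tensorOp S' T' := TensorProduct.mapL_mul S S' T T'

theorem tensorOp_one : tensorOp (1 : H →L[ℂ] H) (1 : K →L[ℂ] K) = 1 := TensorProduct.mapL_id_id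

theorem norm_tensorOp_le (S : H →L[ℂ] H) (T : K →L[ℂ] K) : ‖tensorOp S T‖ ≤ ‖S‖ * ‖T‖ :=
  TensorProduct.norm_mapL_le S T

theorem inner_mapL [CompleteSpace H] [CompleteSpace K] (S : H →L[ℂ] H) (T : K →L[ℂ] K)
    (x y : H ⊗[ℂ] K) : inner ℂ (TensorProduct.mapL S T x) y =
      inner ℂ x (TensorProduct.mapL (star S) (star T) y) := by
  induction x with
  | zero => simp
  | add x x' hx hx' => rw [map_add, inner_add_left, inner_add_left, hx, hx']
  | tmul h k =>
    induction y with
    | zero => simp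
    | add y y' hy hy' => rw [map_add, inner_add_right, inner_add_right, hy, hy']
    | tmul h' k' =>
      rw [TensorProduct.mapL_tmul, TensorProduct.mapL_tmul, TensorProduct.inner_tmul,
        TensorProduct.inner_tmul, ContinuousLinearMap.star_eq_adjoint,
        ContinuousLinearMap.star_eq_adjoint, ContinuousLinearMap.adjoint_inner_right,
        ContinuousLinearMap.adjoint_inner_right]

theorem inner_tensorOp [CompleteSpace H] [CompleteSpace K] (S : H →L[ℂ] H) (T : K →L[ℂ] K)
    (x y : PreHilbertTensor H K) :
    inner ℂ (tensorOp S T x) y = inner ℂ x (tensorOp (star S) (star T) y) :=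
  inner_mapL S T x y

variable [CompleteSpace H] [CompleteSpace K]

/-- The representation `π ⊗ ρ` of the algebraic tensor product `A ⊗ B` by bounded operators on the
pre-Hilbert space `H ⊗ K`, sending `a ⊗ b` to `π a ⊗ ρ b`. -/
def tensorRep (π : A →⋆ₐ[ℂ] (H →L[ℂ] H)) (ρ : B →⋆ₐ[ℂ] (K →L[ℂ] K)) :
    (A ⊗[ℂ] B) →ₐ[ℂ] (PreHilbertTensor H K →L[ℂ] PreHilbertTensor H K) :=
  Algebra.TensorProduct.algHomOfLinearMapTensorProduct
    (TensorProduct.lift (LinearMap.mk₂ ℂ (fun a b => tensorOp (π a) (ρ b))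
      (fun a a' b => by rw [map_add, tensorOp_add_left])
      (fun c a b => by rw [map_smul, tensorOp_smul_left])
      (fun a b b' => by rw [map_add, tensorOp_add_right])
      (fun c a b => by rw [map_smul, tensorOp_smul_right])))
    (fun a a' b b' => by simp [tensorOp_mul])
    (by
      simp only [TensorProduct.lift.tmul, LinearMap.mk₂_apply, map_one]
      exact tensorOp_one)

theorem tensorRep_tmul (π : A →⋆ₐ[ℂ] (H →L[ℂ] H)) (ρ : B →⋆ₐ[ℂ] (K →L[ℂ] K)) (a : A) (b : B) :
    tensorRep π ρ (a ⊗ₜ b) = tensorOp (π a) (ρ b) := rfl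

theorem inner_tensorRep (π : A →⋆ₐ[ℂ] (H →L[ℂ] H)) (ρ : B →⋆ₐ[ℂ] (K →L[ℂ] K)) (t : A ⊗[ℂ] B)
    (x y : PreHilbertTensor H K) :
    inner ℂ (tensorRep π ρ t x) y = inner ℂ x (tensorRep π ρ (star t) y) := by
  induction t with
  | zero => simp
  | add s t hs ht =>
    rw [star_add, map_add, map_add, add_apply, add_apply,
      inner_add_left, inner_add_right, hs, ht]
  | tmul a b =>
    rw [TensorProduct.star_tmul, tensorRep_tmul, tensorRep_tmul, map_star, map_star,
      inner_tensorOp]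

theorem norm_tensorRep_sq_le (π : A →⋆ₐ[ℂ] (H →L[ℂ] H)) (ρ : B →⋆ₐ[ℂ] (K →L[ℂ] K))
    (t : A ⊗[ℂ] B) : ‖tensorRep π ρ t‖ ^ 2 ≤ ‖tensorRep π ρ (star t * t)‖ := by
  have h : ‖tensorRep π ρ t‖ ≤ Real.sqrt ‖tensorRep π ρ (star t * t)‖ := by
    refine ContinuousLinearMap.opNorm_le_bound _ (Real.sqrt_nonneg _) fun x => ?_
    rw [← Real.sqrt_sq (norm_nonneg x), ← Real.sqrt_mul' _ (sq_nonneg _)]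
    apply Real.le_sqrt_of_sq_le
    have h1 : ‖tensorRep π ρ t x‖ ^ 2 = RCLike.re (inner ℂ x (tensorRep π ρ (star t * t) x)) := by
      rw [map_mul]
      change _ = RCLike.re (inner ℂ x (tensorRep π ρ (star t) (tensorRep π ρ t x)))
      rw [← inner_tensorRep, inner_self_eq_norm_sq]
    rw [h1]
    calc RCLike.re (inner ℂ x (tensorRep π ρ (star t * t) x))
        ≤ ‖x‖ * ‖tensorRep π ρ (star t * t) x‖ := re_inner_le_norm _ _
      _ ≤ ‖x‖ * (‖tensorRep π ρ (star t * t)‖ * ‖x‖) := by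
          gcongr
          exact ContinuousLinearMap.le_opNorm _ _
      _ = _ := by ring
  calc ‖tensorRep π ρ t‖ ^ 2 ≤ Real.sqrt ‖tensorRep π ρ (star t * t)‖ ^ 2 :=
        pow_le_pow_left₀ (norm_nonneg _) h 2
    _ = _ := Real.sq_sqrt (norm_nonneg _)

theorem norm_tensorRep_star_le (π : A →⋆ₐ[ℂ] (H →L[ℂ] H)) (ρ : B →⋆ₐ[ℂ] (K →L[ℂ] K))
    (t : A ⊗[ℂ] B) : ‖tensorRep π ρ (star t)‖ ≤ ‖tensorRep π ρ t‖ := by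
  have h := norm_tensorRep_sq_le π ρ (star t)
  rw [star_star, map_mul] at h
  have h1 := norm_mul_le (tensorRep π ρ t) (tensorRep π ρ (star t))
  by_contra h2
  push Not at h2
  nlinarith [norm_nonneg (tensorRep π ρ t)]

/-- The C*-seminorm `t ↦ ‖(π ⊗ ρ)(t)‖` on the algebraic tensor product. -/
def repSeminorm (π : A →⋆ₐ[ℂ] (H →L[ℂ] H)) (ρ : B →⋆ₐ[ℂ] (K →L[ℂ] K)) :
    CStarSeminorm (A ⊗[ℂ] B) where
  toFun t := ‖tensorRep π ρ t‖
  map_zero' := by rw [map_zero, norm_zero]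
  add_le' s t := by rw [map_add]; exact norm_add_le _ _
  neg' t := by rw [map_neg, norm_neg]
  smul' c t := by rw [map_smul, norm_smul]
  mul_le s t := by rw [map_mul]; exact norm_mul_le _ _
  star_mul_self t := by
    apply le_antisymm _ (norm_tensorRep_sq_le π ρ t)
    rw [map_mul, sq]
    exact (norm_mul_le _ _).trans
      (mul_le_mul_of_nonneg_right (norm_tensorRep_star_le π ρ t) (norm_nonneg _))

/-- The C*-seminorms `t ↦ ‖(π ⊗ ρ)(t)‖`, for `π` and `ρ` representations of `A` and of `B` by
bounded operators on Hilbert spaces. -/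
def spatialSeminorms (A B : Type) [CStarAlgebra A] [CStarAlgebra B] :
    Set (CStarSeminorm (A ⊗[ℂ] B)) :=
  {p | ∃ (H : Type) (_ : NormedAddCommGroup H) (_ : InnerProductSpace ℂ H) (_ : CompleteSpace H)
    (K : Type) (_ : NormedAddCommGroup K) (_ : InnerProductSpace ℂ K) (_ : CompleteSpace K)
    (π : A →⋆ₐ[ℂ] (H →L[ℂ] H)) (ρ : B →⋆ₐ[ℂ] (K →L[ℂ] K)), p = repSeminorm π ρ}

theorem spatialSeminorms_bounded (t : A ⊗[ℂ] B) : ∃ C, ∀ p ∈ spatialSeminorms A B, p t ≤ C := by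
  induction t with
  | zero => exact ⟨0, fun p _ => (map_zero p.toSeminorm).le⟩
  | add s t hs ht =>
    obtain ⟨C, hC⟩ := hs
    obtain ⟨D, hD⟩ := ht
    exact ⟨C + D, fun p hp => (p.add_le' s t).trans (add_le_add (hC p hp) (hD p hp))⟩
  | tmul a b =>
    refine ⟨‖a‖ * ‖b‖, ?_⟩
    rintro _ ⟨H, _, _, _, K, _, _, _, π, ρ, rfl⟩
    change ‖tensorRep π ρ (a ⊗ₜ b)‖ ≤ _
    rw [tensorRep_tmul]
    refine (norm_tensorOp_le _ _).trans ?_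
    gcongr
    · exact NonUnitalStarAlgHom.norm_apply_le π a
    · exact NonUnitalStarAlgHom.norm_apply_le ρ b

variable (A B) in
/-- The spatial (minimal) tensor product of two unital C*-algebras: the completion of the algebraic
tensor product with respect to the norm `‖t‖ = sup ‖(π ⊗ ρ)(t)‖`. -/
def SpatialTensor : Type :=
  (CStarSeminorm.sup (spatialSeminorms A B) spatialSeminorms_bounded).Completion

instance : CStarAlgebra (SpatialTensor A B) :=
  inferInstanceAs (CStarAlgebra (CStarSeminorm.Completion _))

/-- The elementary tensor `a ⊗ b` in the spatial tensor product. -/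
def SpatialTensor.tmul (a : A) (b : B) : SpatialTensor A B :=
  (CStarSeminorm.sup (spatialSeminorms A B) spatialSeminorms_bounded).of (a ⊗ₜ[ℂ] b)

end Spatial

/-! ## Noncommutative compact spaces with coordinates -/

/-- A compact noncommutative space with coordinates indexed by `ι`, given by the unital C*-algebra
of continuous functions on it and by the coordinate functions. -/
structure NCSpace (ι : Type) where
  /-- The algebra of continuous functions. -/
  Alg : Type
  [cstar : CStarAlgebra Alg]
  /-- The coordinate functions. -/
  coord : ι → Alg

attribute [instance] NCSpace.cstar

namespace NCSpace

variable {ι : Type}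

/-- The abstract spectrum of the universal C*-algebra generated by self-adjoint variables `x_i`
subject to the relations `f(x) = 0`, with `f ∈ P`. -/
def universal (P : Set (NCPoly ι)) : NCSpace ι where
  Alg := (NCPoly.universalSeminorm P).Completion
  coord i := (NCPoly.universalSeminorm P).of (NCPoly.X i)

/-- A classical compact space, with its algebra of continuous complex functions, and with the
given real coordinate functions. -/
def classical (Y : Type) [TopologicalSpace Y] [CompactSpace Y] (x : ι → C(Y, ℝ)) : NCSpace ι where
  Alg := C(Y, ℂ)
  coord i := ⟨fun y => (x i y : ℂ), by fun_prop⟩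

/-- The *-algebra of polynomial functions: the *-subalgebra generated by the coordinates. -/
def poly (X : NCSpace ι) : StarSubalgebra ℂ X.Alg := StarAlgebra.adjoin ℂ (Set.range X.coord)

/-- The coordinates, as elements of the *-algebra of polynomial functions. -/
def polyCoord (X : NCSpace ι) (i : ι) : X.poly :=
  ⟨X.coord i, StarAlgebra.subset_adjoin ℂ _ (Set.mem_range_self i)⟩

end NCSpace

/-! ## Closed quantum subgroups of the free orthogonal group, and affine actions -/

section QuantumGroups

variable {N : ℕ}

/-- `G`, with coordinates `u i j`, is a closed quantum subgroup of the free orthogonal quantum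
group: in the sense of Woronowicz, `C(G)` is generated by the entries of an orthogonal matrix of
self-adjoint elements, there is a comultiplication on `C(G)`, and there are a counit and an antipode
on the dense *-algebra of polynomial functions, given by the usual formulae on the generators. -/
structure IsQuantumSubgroup (G : NCSpace (Fin N × Fin N)) : Prop where
  selfAdjoint (i j : Fin N) : star (G.coord (i, j)) = G.coord (i, j)
  mul_transpose (i j : Fin N) :
    ∑ k, G.coord (i, k) * G.coord (j, k) = if i = j then 1 else 0
  transpose_mul (i j : Fin N) :
    ∑ k, G.coord (k, i) * G.coord (k, j) = if i = j then 1 else 0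
  dense : G.poly.topologicalClosure = ⊤
  comul : ∃ Δ : G.Alg →⋆ₐ[ℂ] SpatialTensor G.Alg G.Alg,
    ∀ i j, Δ (G.coord (i, j)) = ∑ k, SpatialTensor.tmul (G.coord (i, k)) (G.coord (k, j))
  counit : ∃ ε : G.poly →⋆ₐ[ℂ] ℂ, ∀ i j, ε (G.polyCoord (i, j)) = if i = j then 1 else 0
  antipode : ∃ S : G.poly →⋆ₐ[ℂ] G.Algᵐᵒᵖ,
    ∀ i j, S (G.polyCoord (i, j)) = MulOpposite.op (G.coord (j, i))

/-- `H` is contained in `G`, both being closed quantum subgroups of the free orthogonal quantum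
group: the standard coordinates of `G` restrict to those of `H`. -/
def QuantumSubgroupLE (H G : NCSpace (Fin N × Fin N)) : Prop :=
  ∃ r : G.Alg →⋆ₐ[ℂ] H.Alg, ∀ i j, r (G.coord (i, j)) = H.coord (i, j)

/-- `G` acts affinely on `X`: there is a morphism `C(X) → C(G) ⊗ C(X)` given by
`x_i ↦ ∑_j u_ij ⊗ x_j`. -/
def ActsAffinely (G : NCSpace (Fin N × Fin N)) (X : NCSpace (Fin N)) : Prop :=
  ∃ Φ : X.Alg →⋆ₐ[ℂ] SpatialTensor G.Alg X.Alg,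
    ∀ i, Φ (X.coord i) = ∑ j, SpatialTensor.tmul (G.coord (i, j)) (X.coord j)

/-- `G` is the quantum isometry group of `X`: the universal object in the category of closed quantum
subgroups of the free orthogonal quantum group acting affinely on `X`. -/
structure IsQuantumIsometryGroup (X : NCSpace (Fin N)) (G : NCSpace (Fin N × Fin N)) : Prop where
  isQuantumSubgroup : IsQuantumSubgroup G
  actsAffinely : ActsAffinely G X
  universal (H : NCSpace (Fin N × Fin N)) :
    IsQuantumSubgroup H → ActsAffinely H X → QuantumSubgroupLE H G

end QuantumGroups

/-! ## The spheres -/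

section Spheres

open NCPoly

variable (N : ℕ)

/-- The noncommutative sphere with coordinates subject to `∑ x_i² = 1` and to the relations `P`. -/
def ncSphere (P : Set (NCPoly (Fin N))) : NCSpace (Fin N) :=
  NCSpace.universal ({(∑ i, X i * X i) - 1} ∪ P)

/-- `x_i x_j = - x_j x_i` for `i ≠ j`. -/
def anticommutation : Set (NCPoly (Fin N)) :=
  {f | ∃ i j, i ≠ j ∧ f = X i * X j + X j * X i}

/-- `x_i x_j x_k = x_k x_j x_i` for any `i, j, k`. -/
def halfCommutation : Set (NCPoly (Fin N)) :=
  {f | ∃ i j k, f = X i * X j * X k - X k * X j * X i}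

/-- `x_i x_j x_k = - x_k x_j x_i` for `i, j, k` distinct, `x_i x_j x_k = x_k x_j x_i` otherwise. -/
def twistedHalfCommutation : Set (NCPoly (Fin N)) :=
  {f | ∃ i j k, (i ≠ j ∧ i ≠ k ∧ j ≠ k) ∧ f = X i * X j * X k + X k * X j * X i} ∪
  {f | ∃ i j k, ¬ (i ≠ j ∧ i ≠ k ∧ j ≠ k) ∧ f = X i * X j * X k - X k * X j * X i}

/-- `x_{i_0} ... x_{i_d} = 0` for `i_0, ..., i_d` distinct. -/
def polygonal (d : ℕ) : Set (NCPoly (Fin N)) :=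
  {f | ∃ i : Fin (d + 1) → Fin N, Function.Injective i ∧ f = (List.ofFn fun k => X (i k)).prod}

/-- The free sphere. -/
def freeSphere : NCSpace (Fin N) := ncSphere N ∅

/-- The half-liberated sphere. -/
def halfSphere : NCSpace (Fin N) := ncSphere N (halfCommutation N)

/-- The twisted sphere. -/
def twistedSphere : NCSpace (Fin N) := ncSphere N (anticommutation N)

/-- The twisted half-liberated sphere. -/
def twistedHalfSphere : NCSpace (Fin N) := ncSphere N (twistedHalfCommutation N)

/-- The polygonal version, of parameter `d`, of the half-liberated sphere. -/
def polygonalHalfSphere (d : ℕ) : NCSpace (Fin N) :=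
  ncSphere N (halfCommutation N ∪ polygonal N d)

/-- The polygonal version, of parameter `d`, of the twisted sphere. -/
def polygonalTwistedSphere (d : ℕ) : NCSpace (Fin N) :=
  ncSphere N (anticommutation N ∪ polygonal N d)

/-- The classical real sphere. -/
def realSphere : NCSpace (Fin N) :=
  NCSpace.classical (Metric.sphere (0 : EuclideanSpace ℝ (Fin N)) 1)
    fun i => ⟨fun x => x.1 i, by fun_prop⟩

/-- The points of the classical real sphere with `x_{i_0} ... x_{i_d} = 0` for `i_0, ..., i_d`
distinct. -/
def polygonalSet (d : ℕ) : Set (EuclideanSpace ℝ (Fin N)) :=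
  {x | x ∈ Metric.sphere (0 : EuclideanSpace ℝ (Fin N)) 1 ∧
    ∀ i : Fin (d + 1) → Fin N, Function.Injective i → ∏ k, x (i k) = 0}

instance (d : ℕ) : CompactSpace (polygonalSet N d) := by
  rw [← isCompact_iff_compactSpace]
  refine (isCompact_sphere (0 : EuclideanSpace ℝ (Fin N)) 1).inter_right
    (t := {x | ∀ i : Fin (d + 1) → Fin N, Function.Injective i → ∏ k, x (i k) = 0}) ?_
  simp only [Set.ofPred_forall]
  exact isClosed_iInter fun i => isClosed_iInter fun _ => isClosed_eq (by fun_prop) (by fun_prop)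

/-- The classical real polygonal sphere, of parameter `d`. -/
def polygonalSphere (d : ℕ) : NCSpace (Fin N) :=
  NCSpace.classical (polygonalSet N d) fun i => ⟨fun x => x.1 i, by fun_prop⟩

end Spheres

/-! ## The quantum groups -/

section Groups

open NCPoly

variable (N : ℕ)

/-- The relations stating that the matrix `(u_ij)` is orthogonal. -/
def orthogonality : Set (NCPoly (Fin N × Fin N)) :=
  {f | ∃ i j, f = (∑ k, X (i, k) * X (j, k)) - (if i = j then 1 else 0)} ∪
  {f | ∃ i j, f = (∑ k, X (k, i) * X (k, j)) - (if i = j then 1 else 0)}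

/-- The quantum subgroup of the free orthogonal group defined by the relations `P`. -/
def quantumSubgroup (P : Set (NCPoly (Fin N × Fin N))) : NCSpace (Fin N × Fin N) :=
  NCSpace.universal (orthogonality N ∪ P)

variable {N} in
/-- Two entries of an `N × N` matrix are on the same row or on the same column. -/
def SameLine (a b : Fin N × Fin N) : Prop := a.1 = b.1 ∨ a.2 = b.2

variable {N} in
/-- The number of rows spanned by three entries of an `N × N` matrix. -/
def rowSpan (a b c : Fin N × Fin N) : ℕ := ({a.1, b.1, c.1} : Finset (Fin N)).card

variable {N} in
/-- The number of columns spanned by three entries of an `N × N` matrix. -/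
def colSpan (a b c : Fin N × Fin N) : ℕ := ({a.2, b.2, c.2} : Finset (Fin N)).card

/-- The free orthogonal quantum group `O_N^+`. -/
def freeOrthogonal : NCSpace (Fin N × Fin N) := quantumSubgroup N ∅

/-- The half-liberated orthogonal quantum group `O_N^*`: `abc = cba` for all the entries. -/
def halfOrthogonal : NCSpace (Fin N × Fin N) :=
  quantumSubgroup N {f | ∃ a b c, f = X a * X b * X c - X c * X b * X a}

/-- The twisted orthogonal quantum group: `ab = -ba` for `a ≠ b` on the same row or column, and
`ab = ba` otherwise. -/
def twistedOrthogonal : NCSpace (Fin N × Fin N) :=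
  quantumSubgroup N
    ({f | ∃ a b, (a ≠ b ∧ SameLine a b) ∧ f = X a * X b + X b * X a} ∪
     {f | ∃ a b, ¬ (a ≠ b ∧ SameLine a b) ∧ f = X a * X b - X b * X a})

/-- The twisted half-liberated orthogonal quantum group: if `a, b, c` span `r` rows and `s` columns,
then `abc = -cba` for `r ≤ 2, s = 3` or `r = 3, s ≤ 2`, and `abc = cba` for `r ≤ 2, s ≤ 2` or
`r = s = 3`. -/
def twistedHalfOrthogonal : NCSpace (Fin N × Fin N) :=
  quantumSubgroup N
    ({f | ∃ a b c, (rowSpan a b c ≤ 2 ∧ colSpan a b c = 3 ∨ rowSpan a b c = 3 ∧ colSpan a b c ≤ 2) ∧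
        f = X a * X b * X c + X c * X b * X a} ∪
     {f | ∃ a b c, (rowSpan a b c ≤ 2 ∧ colSpan a b c ≤ 2 ∨ rowSpan a b c = 3 ∧ colSpan a b c = 3) ∧
        f = X a * X b * X c - X c * X b * X a})

/-- The free hyperoctahedral quantum group `H_N^+`: `ab = 0` for `a ≠ b` on the same row or
column, that is, the orthogonal matrix `u` is cubic. -/
def freeHyperoctahedral : NCSpace (Fin N × Fin N) :=
  quantumSubgroup N {f | ∃ a b, a ≠ b ∧ SameLine a b ∧ f = X a * X b}

/-- The quantum group `H_N^{[∞]}`: `abc = 0` for `a ≠ c` on the same row or column. -/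
def infHyperoctahedral : NCSpace (Fin N × Fin N) :=
  quantumSubgroup N {f | ∃ a b c, a ≠ c ∧ SameLine a c ∧ f = X a * X b * X c}

/-- A closed subset of the compact group of orthogonal matrices is compact. -/
theorem compactSpace_of_orthogonal (S : Set (Matrix (Fin N) (Fin N) ℝ)) (hS : IsClosed S)
    (h : ∀ U ∈ S, U ∈ Matrix.orthogonalGroup (Fin N) ℝ) : CompactSpace S := by
  rw [← isCompact_iff_compactSpace]
  have hc : IsCompact (Set.pi Set.univ fun _ : Fin N => Set.pi Set.univ fun _ : Fin N =>
      Set.Icc (-1 : ℝ) 1) :=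
    isCompact_univ_pi fun _ => isCompact_univ_pi fun _ => isCompact_Icc
  refine hc.of_isClosed_subset hS fun U hU => ?_
  simp only [Set.mem_pi, Set.mem_univ, true_imp_iff, Set.mem_Icc, ← abs_le]
  intro i j
  exact entry_norm_bound_of_unitary (h U hU) i j

instance : CompactSpace (Matrix.orthogonalGroup (Fin N) ℝ) := by
  refine compactSpace_of_orthogonal N {U | U ∈ Matrix.orthogonalGroup (Fin N) ℝ} ?_ fun U hU => hU
  simp only [Matrix.mem_orthogonalGroup_iff]
  exact isClosed_eq (by fun_prop) continuous_const

/-- The orthogonal group `O_N`. -/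
def orthogonal : NCSpace (Fin N × Fin N) :=
  NCSpace.classical (Matrix.orthogonalGroup (Fin N) ℝ)
    fun a => ⟨fun U => U.1 a.1 a.2, continuous_subtype_val.matrix_elem a.1 a.2⟩

/-- The signed permutation matrices: the monomial matrices with nonzero entries `±1`. -/
def signedPermutationMatrices : Set (Matrix (Fin N) (Fin N) ℝ) :=
  {U | ∃ (σ : Equiv.Perm (Fin N)) (e : Fin N → ℤˣ),
    U = Matrix.of fun i j => if i = σ j then ((e j : ℤ) : ℝ) else 0}

instance : Finite (signedPermutationMatrices N) := by
  refine Set.Finite.subset (Set.finite_range fun p : Equiv.Perm (Fin N) × (Fin N → ℤˣ) =>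
    (Matrix.of fun i j => if i = p.1 j then ((p.2 j : ℤ) : ℝ) else 0 :
      Matrix (Fin N) (Fin N) ℝ)) ?_
  rintro U ⟨σ, e, rfl⟩
  exact ⟨(σ, e), rfl⟩

/-- The hyperoctahedral group `H_N`, of the isometries of the hypercube. -/
def hyperoctahedral : NCSpace (Fin N × Fin N) :=
  NCSpace.classical (signedPermutationMatrices N)
    fun a => ⟨fun U => U.1 a.1 a.2, continuous_subtype_val.matrix_elem a.1 a.2⟩

end Groups

end

/-! Every sphere and every group is used through a universal property: its algebra is universal
among the self-adjoint families in C*-algebras that satisfy a given predicate (`IsUniversalFor`).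
For the spaces given by generators and relations this comes from the universal seminorm; for the
classical ones it is Gelfand duality (`isPresented_classical`). A symmetric sign matrix `η`, equal
to 1 everywhere or to -1 off the diagonal, treats the untwisted and twisted cases together.

One half of each equality is algebra. If `u` and `w` satisfy the relations of the group and commute
with each other, their matrix product satisfies them too. So do the identity matrix and the
transpose of `u` in the opposite algebra, which gives comultiplication, counit and antipode. If
moreover `x` satisfies the relations of the sphere and commutes with `u`, then `ux` satisfies them,
which gives the action. The signs of the summation indices occur twice and cancel (`sum_twist_two`,
`sum_twist_three`).

The other half takes any quantum group `H` acting on the sphere and derives the relations of the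
candidate group for its coordinates `u`. A relation between the `x_i`, pushed through the action, is
a vanishing sum in a spatial tensor product. Applying matrix coefficients of a representation of the
sphere to the right factor leaves a relation in `C(H)` (`SpatialTensor.sum_matrix_smul_eq_zero`,
through GNS representations). The representations are explicit: `x_p = t_p g_p`, with `t` real of
norm one and `g_p` equal to 1 or a Pauli matrix, for commutation relations; antidiagonal blocks `z_p
g_p`, `conj z_p g_p` for half-commutation relations, so that the middle factor of a cubic monomial
carries a conjugate. Polarization in `t` or `z` extracts the coefficients and gives relations
symmetrized in the columns (`quadratic_relation`, `cubic_relation`, `half_relation`). The antipode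
turns these into relations symmetrized in the rows, and the sum of the two is the desired relation
(`eq_smul_of_antipode_pair`).

For the polygonal spheres with vanishing triple products, the parameters must be supported on two
coordinates. The resulting relations, together with a third row (hence `3 ≤ N`), force entries on
the same line to have product zero (`EntrySignCommute.mul_eq_zero`, `mul_eq_zero_of_half`). In a
cubic matrix the commutation signs only matter for distinct rows and distinct columns, where the
twisting signs cancel. This is why `H_N` occurs for both the classical and the twisted polygonal
sphere. -/

noncomputable section

/-! ## Evaluation of noncommutative polynomials -/

namespace NCPoly

section Algebra

variable {ι : Type} {D : Type} [Ring D] [Algebra ℂ D]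

/-- Evaluation of noncommutative polynomials. -/
def eval (d : ι → D) : NCPoly ι →ₐ[ℂ] D :=
  MonoidAlgebra.lift ℂ D (FreeMonoid ι) (FreeMonoid.lift d)

@[simp]
theorem eval_X (d : ι → D) (i : ι) : eval d (X i) = d i := by
  simp [eval, X]

theorem algHom_ext {f g : NCPoly ι →ₐ[ℂ] D} (h : ∀ i, f (X i) = g (X i)) : f = g := by
  ext m
  induction m using FreeMonoid.inductionOn' with
  | one => exact (map_one f).trans (map_one g).symm
  | of_mul i m hm =>
    have hs : ∀ k : NCPoly ι →ₐ[ℂ] D, k (MonoidAlgebra.of ℂ (FreeMonoid ι) (FreeMonoid.of i * m)) =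
        k (X i) * k (MonoidAlgebra.of ℂ (FreeMonoid ι) m) := fun k => by
      rw [map_mul, map_mul]; rfl
    exact (hs f).trans ((congrArg₂ _ (h i) hm).trans (hs g).symm)

end Algebra

variable {ι : Type} {D E : Type} [Ring D] [StarRing D] [Algebra ℂ D]
  [Ring E] [StarRing E] [Algebra ℂ E]

theorem map_eval (f : D →⋆ₐ[ℂ] E) (d : ι → D) (p : NCPoly ι) :
    f (eval d p) = eval (fun i => f (d i)) p := by
  have h : f.toAlgHom.comp (eval d) = eval (fun i => f (d i)) := algHom_ext fun i => by simp
  exact DFunLike.congr_fun h p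

theorem eval_star [StarModule ℂ D] (d : ι → D) (hd : ∀ i, star (d i) = d i) (p : NCPoly ι) :
    eval d (star p) = star (eval d p) := by
  induction p using MonoidAlgebra.induction_on with
  | of m =>
    induction m using FreeMonoid.inductionOn' with
    | one => rw [map_one, star_one, map_one, star_one]
    | of_mul i m hm =>
      rw [map_mul, star_mul, map_mul, map_mul, star_mul, hm]
      congr 1
      change eval d (star (X i)) = star (eval d (X i))
      rw [star_X, eval_X, hd]
  | add a b ha hb => rw [star_add, map_add, map_add, star_add, ha, hb]
  | smul c a ha => rw [star_smul, map_smul, map_smul, star_smul, ha]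

/-- Evaluation at a family of self-adjoint elements. -/
def evalStar [StarModule ℂ D] (d : ι → D) (hd : ∀ i, star (d i) = d i) : NCPoly ι →⋆ₐ[ℂ] D where
  toAlgHom := eval d
  map_star' := eval_star d hd

theorem eval_mem [StarModule ℂ D] (S : StarSubalgebra ℂ D) {d : ι → D} (hd : ∀ i, d i ∈ S)
    (p : NCPoly ι) : eval d p ∈ S := by
  induction p using MonoidAlgebra.induction_on with
  | of m =>
    induction m using FreeMonoid.inductionOn' with
    | one => rw [map_one, map_one]; exact one_mem _
    | of_mul i m hm =>
      rw [map_mul, map_mul]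
      refine mul_mem ?_ hm
      change eval d (X i) ∈ S
      rw [eval_X]
      exact hd i
  | add a b ha hb => rw [map_add]; exact add_mem ha hb
  | smul c a ha => rw [map_smul]; exact SMulMemClass.smul_mem c ha

end NCPoly

/-! ### Morphisms out of completions, and suprema of C*-seminorms. -/

namespace CStarSeminorm

variable {R : Type*} [Ring R] [StarRing R] [Algebra ℂ R] (p : CStarSeminorm R)

theorem of_one : p.of 1 = 1 := UniformSpace.Completion.coe_one (α := p.Carrier)

/-- The canonical map to the completion, as a morphism of *-algebras. -/
def ofHom : R →⋆ₐ[ℂ] p.Completion where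
  toFun := p.of
  map_one' := p.of_one
  map_mul' := p.of_mul
  map_zero' := UniformSpace.Completion.coe_zero (α := p.Carrier)
  map_add' := p.of_add
  commutes' c := by
    rw [Algebra.algebraMap_eq_smul_one, of_smul, of_one, Algebra.algebraMap_eq_smul_one]
  map_star' a := (p.star_of a).symm

theorem of_eq_zero {a : R} : p.of a = 0 ↔ p a = 0 := by
  rw [← norm_eq_zero, norm_of]

/-- The extension to the completion of a morphism bounded by the seminorm. -/
theorem exists_lift {D : Type*} [CStarAlgebra D] (f : R →⋆ₐ[ℂ] D) (hf : ∀ a, ‖f a‖ ≤ p a) :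
    ∃ g : p.Completion →⋆ₐ[ℂ] D, ∀ a, g (p.of a) = f a := by
  let f' : p.Carrier →+* D := (f : R →+* D)
  have hc : Continuous f' := by
    refine AddMonoidHomClass.continuous_of_bound f' 1 fun a => ?_
    rw [one_mul]
    exact hf a
  let g : p.Completion →+* D := UniformSpace.Completion.extensionHom f' hc
  have hg : ∀ a, g (p.of a) = f a := fun a => UniformSpace.Completion.extensionHom_coe f' hc a
  have hgc : Continuous (g : p.Completion → D) := UniformSpace.Completion.continuous_extension
  refine ⟨{ toFun := g
            map_one' := map_one g
            map_mul' := map_mul g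
            map_zero' := map_zero g
            map_add' := map_add g
            commutes' := fun c => ?_
            map_star' := fun x => ?_ }, hg⟩
  · rw [Algebra.algebraMap_eq_smul_one, Algebra.algebraMap_eq_smul_one, ← of_one, ← of_smul]
    rw [hg, map_smul, map_one]
  · refine p.dense_of.induction_on x (isClosed_eq ?_ ?_) fun a => ?_
    · exact Continuous.comp (g := (g : p.Completion → D)) hgc p.continuous_star_completion
    · exact continuous_star.comp hgc
    · rw [star_of, hg, hg, map_star]

/-- The seminorm induced by a morphism to a C*-algebra. -/
def comapNorm {D : Type*} [CStarAlgebra D] (f : R →⋆ₐ[ℂ] D) : CStarSeminorm R where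
  toFun a := ‖f a‖
  map_zero' := by rw [map_zero, norm_zero]
  add_le' s t := by rw [map_add]; exact norm_add_le _ _
  neg' t := by rw [map_neg, norm_neg]
  smul' c t := by rw [map_smul, norm_smul]
  mul_le s t := by rw [map_mul]; exact norm_mul_le _ _
  star_mul_self t := by rw [map_mul, map_star, CStarRing.norm_star_mul_self, sq]

theorem le_sup {S : Set (CStarSeminorm R)} (hS : ∀ a, ∃ C, ∀ p ∈ S, p a ≤ C) {p : CStarSeminorm R}
    (hp : p ∈ S) (a : R) : p a ≤ sup S hS a := by
  obtain ⟨C, hC⟩ := hS a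
  exact le_ciSup (f := fun p : S => p.1 a) ⟨C, by rintro _ ⟨p, rfl⟩; exact hC p.1 p.2⟩ ⟨p, hp⟩

theorem sup_eq_zero {S : Set (CStarSeminorm R)} (hS : ∀ a, ∃ C, ∀ p ∈ S, p a ≤ C) {a : R}
    (h : ∀ p ∈ S, p a = 0) : sup S hS a = 0 := by
  change ⨆ p : S, p.1 a = 0
  have : ∀ p : S, p.1 a = 0 := fun p => h p.1 p.2
  simp [this]

end CStarSeminorm

/-! ## Presentations of noncommutative spaces -/

/-- The coordinates of `X` are self-adjoint, generate its algebra, and this algebra is the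
universal C*-algebra for the relations `P` between them. -/
structure IsPresented {ι : Type} (X : NCSpace ι) (P : Set (NCPoly ι)) : Prop where
  star_coord (i : ι) : star (X.coord i) = X.coord i
  rel (f : NCPoly ι) : f ∈ P → NCPoly.eval X.coord f = 0
  dense : X.poly.topologicalClosure = ⊤
  lift (D : Type) [CStarAlgebra D] (d : ι → D) : (∀ i, star (d i) = d i) →
    (∀ f ∈ P, NCPoly.eval d f = 0) → ∃ g : X.Alg →⋆ₐ[ℂ] D, ∀ i, g (X.coord i) = d i

/-- The universal seminorm only ranges over seminorms bounding the variables by 1. By `hP` the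
relations already force this bound, so the norm of the evaluation at any solution is admissible and
the evaluation extends to the completion. -/
theorem isPresented_universal {ι : Type} (P : Set (NCPoly ι))
    (hP : ∀ (D : Type) [CStarAlgebra D] (d : ι → D), (∀ i, star (d i) = d i) →
      (∀ f ∈ P, NCPoly.eval d f = 0) → ∀ i, ‖d i‖ ≤ 1) :
    IsPresented (NCSpace.universal P) P := by
  set p := NCPoly.universalSeminorm P with hp
  have he : ∀ f : NCPoly ι, NCPoly.eval (NCSpace.universal P).coord f = p.ofHom f := fun f => by
    have h : NCPoly.eval (NCSpace.universal P).coord = p.ofHom.toAlgHom :=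
      NCPoly.algHom_ext fun i => by rw [NCPoly.eval_X]; rfl
    exact DFunLike.congr_fun h f
  refine ⟨fun i => ?_, fun f hf => ?_, ?_, ?_⟩
  · change star (p.of _) = p.of _
    rw [p.star_of, NCPoly.star_X]
  · rw [he]
    exact (p.of_eq_zero).2 (CStarSeminorm.sup_eq_zero _ fun q hq => hq.2 f hf)
  · have hr : ∀ a, p.of a ∈ (NCSpace.universal P).poly := fun a => by
      have h : NCPoly.eval (NCSpace.universal P).coord a ∈ (NCSpace.universal P).poly :=
        NCPoly.eval_mem _ (fun i => StarAlgebra.subset_adjoin ℂ _ (Set.mem_range_self i)) a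
      rwa [he] at h
    rw [eq_top_iff]
    rintro x -
    have hx : x ∈ closure (Set.range p.of) := p.dense_of x
    exact closure_mono (by rintro _ ⟨a, rfl⟩; exact hr a) hx
  · intro D _ d hd hPd
    have hadm : CStarSeminorm.comapNorm (NCPoly.evalStar d hd) ∈ NCPoly.admissible P := by
      constructor
      · intro i
        change ‖NCPoly.eval d (NCPoly.X i)‖ ≤ 1
        rw [NCPoly.eval_X]
        exact hP D d hd hPd i
      · intro f hf
        change ‖NCPoly.eval d f‖ = 0
        rw [hPd f hf, norm_zero]
    obtain ⟨g, hg⟩ := p.exists_lift (NCPoly.evalStar d hd) fun a =>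
      CStarSeminorm.le_sup (NCPoly.admissible_bounded P) hadm a
    refine ⟨g, fun i => ?_⟩
    change g (p.of _) = _
    rw [hg]
    exact NCPoly.eval_X d i

theorem StarAlgebra.commute_of_mem_topologicalClosure_adjoin {ι D : Type} [CStarAlgebra D]
    {d : ι → D} (hs : ∀ i, star (d i) = d i) (hc : ∀ i j, d i * d j = d j * d i) {x y : D}
    (hx : x ∈ (StarAlgebra.adjoin ℂ (Set.range d)).topologicalClosure)
    (hy : y ∈ (StarAlgebra.adjoin ℂ (Set.range d)).topologicalClosure) : x * y = y * x := by
  have h1 : ∀ a ∈ Set.range d, ∀ b ∈ Set.range d, a * b = b * a := by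
    rintro _ ⟨i, rfl⟩ _ ⟨j, rfl⟩; exact hc i j
  have h2 : ∀ a ∈ Set.range d, ∀ b ∈ Set.range d, a * star b = star b * a := by
    rintro _ ⟨i, rfl⟩ _ ⟨j, rfl⟩; rw [hs]; exact hc i j
  have hm := StarAlgebra.isMulCommutative_adjoin ℂ h1 h2
  let T := StarSubalgebra.commRingTopologicalClosure (StarAlgebra.adjoin ℂ (Set.range d))
    hm.is_comm.comm
  exact congrArg Subtype.val (T.mul_comm ⟨x, hx⟩ ⟨y, hy⟩)

/-- Stone–Weierstrass gives density. For the universal property, a solution `d` generates a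
commutative C*-algebra; each of its characters sends `d` to a real solution, that is, to a point of
`Y`, and functions on `Y` are pulled back along this map of spectra. -/
theorem isPresented_classical {ι Y : Type} [TopologicalSpace Y] [CompactSpace Y]
    (x : ι → C(Y, ℝ)) (P : Set (NCPoly ι))
    (hsep : ∀ y y', (∀ i, x i y = x i y') → y = y')
    (hcomm : ∀ i j, NCPoly.X i * NCPoly.X j - NCPoly.X j * NCPoly.X i ∈ P)
    (hpt : ∀ c : ι → ℝ, (∀ f ∈ P, NCPoly.eval (fun i => (c i : ℂ)) f = 0) ↔
      ∃ y, ∀ i, x i y = c i) :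
    IsPresented (NCSpace.classical Y x) P := by
  refine ⟨fun i => ?_, fun f hf => ?_, ?_, ?_⟩
  · exact ContinuousMap.ext fun y => Complex.conj_ofReal _
  · have key : ∀ y : Y, ContinuousMap.evalStarAlgHom ℂ ℂ y
        (NCPoly.eval (D := C(Y, ℂ)) (NCSpace.classical Y x).coord f) = 0 := fun y => by
      have h := NCPoly.map_eval (ContinuousMap.evalStarAlgHom ℂ ℂ y) (NCSpace.classical Y x).coord f
      refine h.trans ?_
      exact (hpt fun i => x i y).2 ⟨y, fun _ => rfl⟩ f hf
    exact ContinuousMap.ext key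
  · refine ContinuousMap.starSubalgebra_topologicalClosure_eq_top_of_separatesPoints
      (NCSpace.classical Y x).poly ?_
    intro y y' hy
    by_contra hne
    refine hy (hsep y y' fun i => ?_)
    by_contra hi
    refine hne ⟨_, ⟨(NCSpace.classical Y x).coord i,
      StarAlgebra.subset_adjoin ℂ _ (Set.mem_range_self i), rfl⟩, fun h => hi ?_⟩
    exact Complex.ofReal_injective h
  · intro D _ d hd hP
    have hc : ∀ i j, d i * d j = d j * d i := fun i j => by
      have := hP _ (hcomm i j)
      simpa [sub_eq_zero] using this
    let B := (StarAlgebra.adjoin ℂ (Set.range d)).topologicalClosure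
    have hB : IsClosed (B : Set D) := StarSubalgebra.isClosed_topologicalClosure _
    let i1 : CStarAlgebra B := StarSubalgebra.cstarAlgebra B (h_closed := hB)
    let i2 : CommCStarAlgebra B :=
      { i1 with
        mul_comm := fun a b => Subtype.ext
          (StarAlgebra.commute_of_mem_topologicalClosure_adjoin hd hc a.2 b.2) }
    let b : ι → B := fun i => ⟨d i, StarSubalgebra.le_topologicalClosure _
      (StarAlgebra.subset_adjoin ℂ _ (Set.mem_range_self i))⟩
    have hb : ∀ i, star (b i) = b i := fun i => Subtype.ext (hd i)
    have hPb : ∀ f ∈ P, NCPoly.eval b f = 0 := fun f hf => by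
      apply Subtype.ext
      exact (NCPoly.map_eval B.subtype b f).trans (hP f hf)
    have hreal : ∀ (φ : WeakDual.characterSpace ℂ B) i, φ (b i) = ((φ (b i)).re : ℂ) :=
      fun φ i => by
        have h := map_star φ (b i)
        rw [hb] at h
        exact (Complex.conj_eq_iff_re.1 h.symm).symm
    have hy : ∀ φ : WeakDual.characterSpace ℂ B, ∃ y, ∀ i, x i y = (φ (b i)).re := fun φ => by
      rw [← hpt]
      intro f hf
      have h := NCPoly.map_eval (φ : B →⋆ₐ[ℂ] ℂ) b f
      rw [hPb f hf, map_zero] at h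
      have h2 : (fun i => (((φ (b i)).re : ℝ) : ℂ)) = fun i => φ (b i) :=
        funext fun i => (hreal φ i).symm
      rw [h2]
      exact h.symm
    choose m hm using hy
    -- By compactness the separating coordinates induce the topology of `Y`, so continuity of `m`
    -- can be tested on them.
    have hemb : Topology.IsClosedEmbedding fun y i => x i y :=
      Continuous.isClosedEmbedding (by fun_prop) fun y y' h => hsep y y' fun i => congrFun h i
    have hmc : Continuous m := by
      rw [hemb.isInducing.continuous_iff]
      have : (fun y i => x i y) ∘ m = fun φ i => (φ (b i)).re := by
        ext φ i; exact hm φ i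
      rw [this]
      refine continuous_pi fun i => Complex.continuous_re.comp ?_
      exact (WeakDual.eval_continuous (b i)).comp continuous_subtype_val
    let m' : C(WeakDual.characterSpace ℂ B, Y) := ⟨m, hmc⟩
    -- The morphism is the composite of the pullback `C(Y) → C(spec B)`, the inverse Gelfand
    -- transform, and the inclusion of `B` in `D`.
    refine ⟨(B.subtype.comp ((gelfandStarTransform B).symm : _ →⋆ₐ[ℂ] B)).comp
      (m'.compStarAlgHom' ℂ ℂ), fun i => ?_⟩
    have h : m'.compStarAlgHom' ℂ ℂ ((NCSpace.classical Y x).coord i) =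
        gelfandStarTransform B (b i) := by
      ext φ
      change ((x i (m φ) : ℝ) : ℂ) = φ (b i)
      rw [hm, ← hreal]
    change ((gelfandStarTransform B).symm (m'.compStarAlgHom' ℂ ℂ
      ((NCSpace.classical Y x).coord i)) : D) = d i
    rw [h, StarAlgEquiv.symm_apply_apply]

/-! ## The spatial tensor product -/

namespace SpatialTensor

variable {A B : Type} [CStarAlgebra A] [CStarAlgebra B]

variable (A B) in
/-- The canonical map from the algebraic tensor product. -/
def ofHom : A ⊗[ℂ] B →⋆ₐ[ℂ] SpatialTensor A B :=
  (CStarSeminorm.sup (spatialSeminorms A B) spatialSeminorms_bounded).ofHom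

theorem tmul_eq (a : A) (b : B) : tmul a b = ofHom A B (a ⊗ₜ b) := rfl

variable (A B) in
/-- The inclusion of the left factor. -/
def inclLeft : A →⋆ₐ[ℂ] SpatialTensor A B where
  toAlgHom := (ofHom A B : A ⊗[ℂ] B →ₐ[ℂ] SpatialTensor A B).comp
    Algebra.TensorProduct.includeLeft
  map_star' a := by
    change ofHom A B (star a ⊗ₜ 1) = star (ofHom A B (a ⊗ₜ 1))
    rw [← map_star, TensorProduct.star_tmul, star_one]

variable (A B) in
/-- The inclusion of the right factor. -/
def inclRight : B →⋆ₐ[ℂ] SpatialTensor A B where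
  toAlgHom := (ofHom A B : A ⊗[ℂ] B →ₐ[ℂ] SpatialTensor A B).comp
    Algebra.TensorProduct.includeRight
  map_star' b := by
    change ofHom A B (1 ⊗ₜ star b) = star (ofHom A B (1 ⊗ₜ b))
    rw [← map_star, TensorProduct.star_tmul, star_one]

theorem inclLeft_apply (a : A) : inclLeft A B a = ofHom A B (a ⊗ₜ 1) := rfl

theorem inclRight_apply (b : B) : inclRight A B b = ofHom A B (1 ⊗ₜ b) := rfl

theorem inclLeft_mul_inclRight (a : A) (b : B) : inclLeft A B a * inclRight A B b = tmul a b := by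
  rw [inclLeft_apply, inclRight_apply, ← map_mul, Algebra.TensorProduct.tmul_mul_tmul, mul_one,
    one_mul, tmul_eq]

theorem inclRight_mul_inclLeft (a : A) (b : B) : inclRight A B b * inclLeft A B a = tmul a b := by
  rw [inclLeft_apply, inclRight_apply, ← map_mul, Algebra.TensorProduct.tmul_mul_tmul, mul_one,
    one_mul, tmul_eq]

theorem inclLeft_comm (a : A) (b : B) :
    inclLeft A B a * inclRight A B b = inclRight A B b * inclLeft A B a := by
  rw [inclLeft_mul_inclRight, inclRight_mul_inclLeft]

theorem tmul_mul_tmul (a a' : A) (b b' : B) :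
    tmul a b * tmul a' b' = tmul (a * a') (b * b') := by
  rw [tmul_eq, tmul_eq, ← map_mul, Algebra.TensorProduct.tmul_mul_tmul, tmul_eq]

end SpatialTensor

/-! ## Representations separate the points of a C*-algebra -/

section Representations

open scoped ComplexOrder CStarAlgebra

attribute [local instance] CStarAlgebra.spectralOrder CStarAlgebra.spectralOrderedRing

/-- There is a positive functional which does not vanish at a given nonzero `star a * a`. -/
theorem exists_positive_functional {A : Type} [CStarAlgebra A] {a : A} (ha : a ≠ 0) :
    ∃ f : A →ₚ[ℂ] ℂ, f (star a * a) ≠ 0 := by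
  -- Hahn–Banach: the closed cone of positive elements is separated from `-(star a * a)`, which lies
  -- outside it.
  let C : ProperCone ℝ A :=
    { carrier := {x | 0 ≤ x}
      add_mem' := fun {x y} (hx : 0 ≤ x) (hy : 0 ≤ y) => (add_nonneg hx hy : 0 ≤ x + y)
      zero_mem' := le_refl (0 : A)
      smul_mem' := fun c x (hx : 0 ≤ x) => by
        have h : 0 ≤ (c : ℝ) • x := smul_nonneg c.2 hx
        exact h
      isClosed' := CStarAlgebra.isClosed_nonneg }
  have hC : ∀ x, x ∈ C ↔ 0 ≤ x := fun x => Iff.rfl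
  have hx₀ : -(star a * a) ∉ C := by
    rw [hC]
    intro h
    have h1 : star a * a = 0 := le_antisymm (neg_nonneg.1 h) (star_mul_self_nonneg a)
    exact ha ((CStarRing.star_mul_self_eq_zero_iff a).1 h1)
  obtain ⟨f, hf, hf₀⟩ := C.hyperplane_separation_point hx₀
  -- The separating functional is only real linear. Symmetrizing makes it vanish on skew-adjoint
  -- elements, so its complex extension is real on self-adjoint ones, with value `2 * f x`.
  let f1 : Module.Dual ℝ A :=
    { toFun := fun x => f (x + star x)
      map_add' := fun x y => by rw [star_add, ← map_add]; congr 1; abel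
      map_smul' := fun c x => by
        rw [star_smul, star_trivial, ← smul_add, map_smul]; rfl }
  have hf1 : ∀ x, f1 x = f (x + star x) := fun _ => rfl
  let g : Module.Dual ℂ A := Module.Dual.extendRCLike f1
  have hg : ∀ x : A, IsSelfAdjoint x → g x = ((2 * f x : ℝ) : ℂ) := fun x hx => by
    have h1 : f1 (Complex.I • x) = 0 := by
      rw [hf1, star_smul, hx.star_eq, ← add_smul]
      simp
    have h2 : f1 x = 2 * f x := by
      rw [hf1, hx.star_eq, map_add, two_mul]
    change ((f1 x : ℝ) : ℂ) - Complex.I * ((f1 (Complex.I • x) : ℝ) : ℂ) = _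
    rw [h1, h2]
    simp
  refine ⟨PositiveLinearMap.mk₀ g fun x hx => ?_, ?_⟩
  · rw [hg x (IsSelfAdjoint.of_nonneg hx)]
    have := hf x hx
    rw [Complex.zero_le_real]
    linarith
  · change g (star a * a) ≠ 0
    rw [hg _ (IsSelfAdjoint.star_mul_self a)]
    rw [map_neg] at hf₀
    have : (2 * f (star a * a) : ℝ) ≠ 0 := by linarith
    exact_mod_cast this

/-- A nonzero element of a C*-algebra is nonzero in some representation. -/
theorem exists_rep_ne_zero {A : Type} [CStarAlgebra A] {a : A} (ha : a ≠ 0) :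
    ∃ (H : Type) (_ : NormedAddCommGroup H) (_ : InnerProductSpace ℂ H) (_ : CompleteSpace H)
      (π : A →⋆ₐ[ℂ] (H →L[ℂ] H)), π a ≠ 0 := by
  obtain ⟨f, hf⟩ := exists_positive_functional ha
  refine ⟨f.GNS, inferInstance, inferInstance, inferInstance, f.gnsStarAlgHom, fun h => hf ?_⟩
  -- Test on the cyclic vector: its image under `a` has squared norm `f (star a * a)`.
  have h1 : f.gnsStarAlgHom a (f.toPreGNS 1 : f.GNS) = 0 := by rw [h]; rfl
  have h2 : f.gnsStarAlgHom a (f.toPreGNS 1 : f.GNS) = (f.toPreGNS a : f.GNS) := by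
    refine (f.gnsNonUnitalStarAlgHom_apply_coe (a := a) (b := f.toPreGNS 1)).trans ?_
    rw [PositiveLinearMap.leftMulMapPreGNS_apply]
    simp
  rw [h2, ← norm_eq_zero, UniformSpace.Completion.norm_coe] at h1
  have h3 := f.preGNS_norm_sq (f.toPreGNS a)
  rw [h1] at h3
  simpa using h3.symm

end Representations

namespace SpatialTensor

variable {A B : Type} [CStarAlgebra A] [CStarAlgebra B]

theorem tensorRep_eq_zero {t : A ⊗[ℂ] B} (ht : ofHom A B t = 0) {H K : Type}
    [NormedAddCommGroup H] [InnerProductSpace ℂ H] [CompleteSpace H]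
    [NormedAddCommGroup K] [InnerProductSpace ℂ K] [CompleteSpace K]
    (π : A →⋆ₐ[ℂ] (H →L[ℂ] H)) (ρ : B →⋆ₐ[ℂ] (K →L[ℂ] K)) : tensorRep π ρ t = 0 := by
  have h1 : CStarSeminorm.sup (spatialSeminorms A B) spatialSeminorms_bounded t = 0 :=
    (CStarSeminorm.of_eq_zero _).1 ht
  have h2 : repSeminorm π ρ t ≤ 0 := h1 ▸ CStarSeminorm.le_sup spatialSeminorms_bounded
    ⟨H, _, _, inferInstance, K, _, _, inferInstance, π, ρ, rfl⟩ t
  exact norm_le_zero_iff.1 h2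

theorem inner_tensorRep_tmul {H K : Type}
    [NormedAddCommGroup H] [InnerProductSpace ℂ H] [CompleteSpace H]
    [NormedAddCommGroup K] [InnerProductSpace ℂ K] [CompleteSpace K]
    (π : A →⋆ₐ[ℂ] (H →L[ℂ] H)) (ρ : B →⋆ₐ[ℂ] (K →L[ℂ] K)) (a : A) (b : B) (v w : H) (ξ η : K) :
    inner ℂ (id (w ⊗ₜ[ℂ] ξ) : PreHilbertTensor H K)
      (tensorRep π ρ (a ⊗ₜ b) (id (v ⊗ₜ[ℂ] η) : PreHilbertTensor H K)) =
      inner ℂ w (π a v) * inner ℂ ξ (ρ b η) :=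
  TensorProduct.inner_tmul ℂ w (π a v) ξ (ρ b η)

/-- This slices by the vector functional of `ρ` at `ξ, η`. If the slice were nonzero, some
representation `π` would detect it; but the matrix coefficients of its image under `π` are matrix
coefficients of `π ⊗ ρ` at the given sum, which vanish by definition of the spatial norm. -/
theorem sum_inner_smul_eq_zero {κ : Type} (s : Finset κ) (a : κ → A) (b : κ → B)
    (h : ∑ k ∈ s, tmul (a k) (b k) = 0) {K : Type}
    [NormedAddCommGroup K] [InnerProductSpace ℂ K] [CompleteSpace K]
    (ρ : B →⋆ₐ[ℂ] (K →L[ℂ] K)) (ξ η : K) : ∑ k ∈ s, inner ℂ ξ (ρ (b k) η) • a k = 0 := by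
  by_contra hne
  obtain ⟨H, _, _, _, π, hπ⟩ := exists_rep_ne_zero hne
  refine hπ ?_
  have h1 : ofHom A B (∑ k ∈ s, a k ⊗ₜ b k) = 0 := by rw [map_sum]; exact h
  have h2 := tensorRep_eq_zero h1 π ρ
  ext v
  refine ext_inner_left ℂ fun w => ?_
  have h3 : inner ℂ (id (w ⊗ₜ[ℂ] ξ) : PreHilbertTensor H K)
      (tensorRep π ρ (∑ k ∈ s, a k ⊗ₜ b k) (id (v ⊗ₜ[ℂ] η) : PreHilbertTensor H K)) = 0 := by
    rw [h2]
    exact inner_zero_right _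
  rw [map_sum, sum_apply, inner_sum] at h3
  simp only [inner_tensorRep_tmul] at h3
  rw [map_sum, sum_apply, inner_sum, zero_apply, inner_zero_right, ← h3]
  refine Finset.sum_congr rfl fun k _ => ?_
  rw [map_smul, smul_apply, inner_smul_right, mul_comm]

/-- Slicing a relation in a spatial tensor product by a matrix coefficient of the right factor. -/
theorem sum_matrix_smul_eq_zero {κ : Type} (s : Finset κ) (a : κ → A) (b : κ → B)
    (h : ∑ k ∈ s, tmul (a k) (b k) = 0) {n : Type} [Fintype n] [DecidableEq n]
    (ρ : B →⋆ₐ[ℂ] Matrix n n ℂ) (p q : n) : ∑ k ∈ s, ρ (b k) p q • a k = 0 := by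
  have h1 := sum_inner_smul_eq_zero s a b h
    ((Matrix.toEuclideanCLM (n := n) (𝕜 := ℂ) : Matrix n n ℂ →⋆ₐ[ℂ]
      (EuclideanSpace ℂ n →L[ℂ] EuclideanSpace ℂ n)).comp ρ)
    (EuclideanSpace.single p 1) (EuclideanSpace.single q 1)
  rw [← h1]
  refine Finset.sum_congr rfl fun k _ => ?_
  congr 1
  rw [EuclideanSpace.inner_single_left, map_one, one_mul]
  change _ = (Matrix.toEuclideanCLM (n := n) (𝕜 := ℂ) (ρ (b k)) (EuclideanSpace.single q 1)).ofLp p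
  rw [Matrix.ofLp_toEuclideanCLM]
  simp

end SpatialTensor

/-! ## Relations between coordinates -/

section Relations

variable {N : ℕ} {D : Type} [Ring D]

/-- A symmetric matrix of signs, with diagonal entries `1`. -/
structure IsSignMatrix (η : Fin N → Fin N → ℂ) : Prop where
  sq (i j : Fin N) : η i j * η i j = 1
  symm (i j : Fin N) : η i j = η j i
  diag (i : Fin N) : η i i = 1

/-- The sign attached to three indices. -/
def tripleSign (η : Fin N → Fin N → ℂ) (i j k : Fin N) : ℂ := η i j * η j k * η i k

theorem IsSignMatrix.triple_sq {η : Fin N → Fin N → ℂ} (h : IsSignMatrix η) (i j k : Fin N) :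
    tripleSign η i j k * tripleSign η i j k = 1 := by
  unfold tripleSign
  linear_combination η j k ^ 2 * η i k ^ 2 * h.sq i j + η i k ^ 2 * h.sq j k + h.sq i k

theorem IsSignMatrix.triple_reverse {η : Fin N → Fin N → ℂ} (h : IsSignMatrix η) (i j k : Fin N) :
    tripleSign η k j i = tripleSign η i j k := by
  unfold tripleSign
  rw [h.symm k j, h.symm j i, h.symm k i]
  ring

theorem IsSignMatrix.triple_left {η : Fin N → Fin N → ℂ} (h : IsSignMatrix η) (i k : Fin N) :
    tripleSign η i i k = 1 := by
  simp [tripleSign, h.diag, h.sq]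

theorem IsSignMatrix.triple_outer {η : Fin N → Fin N → ℂ} (h : IsSignMatrix η) (i j : Fin N) :
    tripleSign η i j i = 1 := by
  simp [tripleSign, h.diag, h.sq, h.symm j i]

/-- `∑ x_i² = 1`. -/
def OnSphere (x : Fin N → D) : Prop := ∑ i, x i * x i = 1

/-- `x_i x_j = ± x_j x_i`. -/
def SignCommute [Algebra ℂ D] (η : Fin N → Fin N → ℂ) (x : Fin N → D) : Prop :=
  ∀ i j, x i * x j = η i j • (x j * x i)

/-- `x_i x_j x_k = ± x_k x_j x_i`. -/
def SignHalfCommute [Algebra ℂ D] (η : Fin N → Fin N → ℂ) (x : Fin N → D) : Prop :=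
  ∀ i j k, x i * x j * x k = tripleSign η i j k • (x k * x j * x i)

/-- `x_i x_j x_k = 0` for `i, j, k` distinct. -/
def TripleZero (x : Fin N → D) : Prop :=
  ∀ i j k, i ≠ j → i ≠ k → j ≠ k → x i * x j * x k = 0

/-- `x_i x_j = 0` for `i ≠ j`. -/
def PairZero (x : Fin N → D) : Prop := ∀ i j, i ≠ j → x i * x j = 0

/-- The matrix `u` is orthogonal. -/
def IsOrthogonal (u : Fin N × Fin N → D) : Prop :=
  (∀ i j, ∑ k, u (i, k) * u (j, k) = if i = j then 1 else 0) ∧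
  (∀ i j, ∑ k, u (k, i) * u (k, j) = if i = j then 1 else 0)

/-- `u_ia u_jb = ± u_jb u_ia`. -/
def EntrySignCommute [Algebra ℂ D] (η : Fin N → Fin N → ℂ) (u : Fin N × Fin N → D) : Prop :=
  ∀ i j a b, u (i, a) * u (j, b) = (η i j * η a b) • (u (j, b) * u (i, a))

/-- `u_ia u_jb u_kc = ± u_kc u_jb u_ia`. -/
def EntrySignHalfCommute [Algebra ℂ D] (η : Fin N → Fin N → ℂ) (u : Fin N × Fin N → D) : Prop :=
  ∀ i j k a b c, u (i, a) * u (j, b) * u (k, c) =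
    (tripleSign η i j k * tripleSign η a b c) • (u (k, c) * u (j, b) * u (i, a))

/-- `ab = 0` for `a ≠ b` on the same row or column. -/
def IsCubic (u : Fin N × Fin N → D) : Prop :=
  (∀ i j a, i ≠ j → u (i, a) * u (j, a) = 0) ∧ (∀ i a b, a ≠ b → u (i, a) * u (i, b) = 0)

/-- `abc = 0` for `a ≠ c` on the same row or column. -/
def IsInfCubic (u : Fin N × Fin N → D) : Prop :=
  (∀ i j k a b, i ≠ k → u (i, a) * u (j, b) * u (k, a) = 0) ∧
  (∀ i j a b c, a ≠ c → u (i, a) * u (j, b) * u (i, c) = 0)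

/-- The matrix product. -/
def entryMul (u w : Fin N × Fin N → D) (p : Fin N × Fin N) : D := ∑ k, u (p.1, k) * w (k, p.2)

/-- The action of a matrix on a vector. -/
def entryVec (u : Fin N × Fin N → D) (x : Fin N → D) (i : Fin N) : D := ∑ k, u (i, k) * x k

theorem sum_mul_sum_of_commute {f g y z : Fin N → D} (h : ∀ p q, y p * g q = g q * y p) :
    (∑ p, f p * y p) * (∑ q, g q * z q) = ∑ p, ∑ q, (f p * g q) * (y p * z q) := by
  rw [Finset.sum_mul_sum]
  refine Finset.sum_congr rfl fun p _ => Finset.sum_congr rfl fun q _ => ?_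
  rw [mul_assoc, ← mul_assoc (y p), h, mul_assoc, mul_assoc]

theorem sum_mul_sum_mul_sum_of_commute {f g e y z w : Fin N → D}
    (h : ∀ p q, y p * g q = g q * y p) (h' : ∀ p q, y p * e q = e q * y p)
    (h'' : ∀ p q, z p * e q = e q * z p) :
    (∑ p, f p * y p) * (∑ q, g q * z q) * (∑ r, e r * w r) =
      ∑ p, ∑ q, ∑ r, (f p * g q * e r) * (y p * z q * w r) := by
  rw [sum_mul_sum_of_commute h, Finset.sum_mul]
  refine Finset.sum_congr rfl fun p _ => ?_
  rw [Finset.sum_mul]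
  refine Finset.sum_congr rfl fun q _ => ?_
  rw [Finset.mul_sum]
  refine Finset.sum_congr rfl fun r _ => ?_
  have h1 : y p * z q * e r = e r * (y p * z q) := by
    rw [mul_assoc, h'', ← mul_assoc, h', mul_assoc]
  rw [mul_assoc, ← mul_assoc (y p * z q), h1]
  simp only [mul_assoc]

/-- Reversing both the `f, g` factors and the `y, z` factors produces `η p q` twice, hence its
square 1. Only the outer signs `c`, `c'`, independent of the summation indices, remain. -/
theorem sum_twist_two [Algebra ℂ D] {η : Fin N → Fin N → ℂ} (hη : IsSignMatrix η)
    {f g y z : Fin N → D} {c c' : ℂ}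
    (h1 : ∀ p q, y p * g q = g q * y p) (h2 : ∀ p q, z p * f q = f q * z p)
    (hf : ∀ p q, f p * g q = (c * η p q) • (g q * f p))
    (hy : ∀ p q, y p * z q = (η p q * c') • (z q * y p)) :
    (∑ p, f p * y p) * (∑ q, g q * z q) = (c * c') • ((∑ q, g q * z q) * ∑ p, f p * y p) := by
  rw [sum_mul_sum_of_commute h1, sum_mul_sum_of_commute h2, Finset.sum_comm, Finset.smul_sum]
  refine Finset.sum_congr rfl fun q _ => ?_
  rw [Finset.smul_sum]
  refine Finset.sum_congr rfl fun p _ => ?_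
  rw [hf, hy, smul_mul_smul_comm]
  congr 1
  linear_combination c * c' * hη.sq p q

/-- The cubic analogue: here the square of `tripleSign η p q r` is what cancels. -/
theorem sum_twist_three [Algebra ℂ D] {η : Fin N → Fin N → ℂ} (hη : IsSignMatrix η)
    {f g e y z w : Fin N → D} {c c' : ℂ}
    (h1 : ∀ p q, y p * g q = g q * y p) (h2 : ∀ p q, y p * e q = e q * y p)
    (h3 : ∀ p q, z p * e q = e q * z p) (h4 : ∀ p q, w p * g q = g q * w p)
    (h5 : ∀ p q, w p * f q = f q * w p) (h6 : ∀ p q, z p * f q = f q * z p)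
    (hf : ∀ p q r, f p * g q * e r = (c * tripleSign η p q r) • (e r * g q * f p))
    (hy : ∀ p q r, y p * z q * w r = (tripleSign η p q r * c') • (w r * z q * y p)) :
    (∑ p, f p * y p) * (∑ q, g q * z q) * (∑ r, e r * w r) =
      (c * c') • ((∑ r, e r * w r) * (∑ q, g q * z q) * ∑ p, f p * y p) := by
  rw [sum_mul_sum_mul_sum_of_commute h1 h2 h3, sum_mul_sum_mul_sum_of_commute h4 h5 h6,
    Finset.smul_sum]
  have hs : ∀ F : Fin N → Fin N → Fin N → D,
      ∑ p, ∑ q, ∑ r, F p q r = ∑ r, ∑ q, ∑ p, F p q r := fun F =>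
    calc ∑ p, ∑ q, ∑ r, F p q r = ∑ p, ∑ r, ∑ q, F p q r :=
          Finset.sum_congr rfl fun p _ => Finset.sum_comm
      _ = ∑ r, ∑ p, ∑ q, F p q r := Finset.sum_comm
      _ = _ := Finset.sum_congr rfl fun r _ => Finset.sum_comm
  rw [hs]
  refine Finset.sum_congr rfl fun r _ => ?_
  rw [Finset.smul_sum]
  refine Finset.sum_congr rfl fun q _ => ?_
  rw [Finset.smul_sum]
  refine Finset.sum_congr rfl fun p _ => ?_
  rw [hf, hy, smul_mul_smul_comm]
  congr 1
  linear_combination c * c' * hη.triple_sq p q r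

variable {u w : Fin N × Fin N → D} {x : Fin N → D}

/-- The commutation hypothesis, here and in the lemmas below, is the situation of a tensor product,
with the two families in different legs. The `mul` lemmas serve the comultiplication and the `vec`
lemmas the affine action. -/
theorem IsOrthogonal.mul (hu : IsOrthogonal u) (hw : IsOrthogonal w)
    (h : ∀ a b, w b * u a = u a * w b) : IsOrthogonal (entryMul u w) := by
  constructor
  · intro i j
    calc ∑ k, entryMul u w (i, k) * entryMul u w (j, k)
        = ∑ k, ∑ p, ∑ q, (u (i, p) * u (j, q)) * (w (p, k) * w (q, k)) :=
          Finset.sum_congr rfl fun k _ => sum_mul_sum_of_commute fun p q => h _ _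
      _ = ∑ p, ∑ q, (u (i, p) * u (j, q)) * ∑ k, w (p, k) * w (q, k) := by
          rw [Finset.sum_comm]
          refine Finset.sum_congr rfl fun p _ => ?_
          rw [Finset.sum_comm]
          exact Finset.sum_congr rfl fun q _ => (Finset.mul_sum _ _ _).symm
      _ = ∑ p, u (i, p) * u (j, p) := by simp [hw.1]
      _ = _ := hu.1 i j
  · intro i j
    calc ∑ k, entryMul u w (k, i) * entryMul u w (k, j)
        = ∑ k, ∑ p, ∑ q, (u (k, p) * u (k, q)) * (w (p, i) * w (q, j)) :=
          Finset.sum_congr rfl fun k _ => sum_mul_sum_of_commute fun p q => h _ _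
      _ = ∑ p, ∑ q, (∑ k, u (k, p) * u (k, q)) * (w (p, i) * w (q, j)) := by
          rw [Finset.sum_comm]
          refine Finset.sum_congr rfl fun p _ => ?_
          rw [Finset.sum_comm]
          exact Finset.sum_congr rfl fun q _ => (Finset.sum_mul _ _ _).symm
      _ = ∑ p, w (p, i) * w (p, j) := by simp [hu.2]
      _ = _ := hw.2 i j

theorem IsOrthogonal.vec (hu : IsOrthogonal u) (hx : OnSphere x)
    (h : ∀ a b, x b * u a = u a * x b) : OnSphere (entryVec u x) := by
  calc ∑ k, entryVec u x k * entryVec u x k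
      = ∑ k, ∑ p, ∑ q, (u (k, p) * u (k, q)) * (x p * x q) :=
        Finset.sum_congr rfl fun k _ => sum_mul_sum_of_commute fun p q => h _ _
    _ = ∑ p, ∑ q, (∑ k, u (k, p) * u (k, q)) * (x p * x q) := by
        rw [Finset.sum_comm]
        refine Finset.sum_congr rfl fun p _ => ?_
        rw [Finset.sum_comm]
        exact Finset.sum_congr rfl fun q _ => (Finset.sum_mul _ _ _).symm
    _ = ∑ p, x p * x p := by simp [hu.2]
    _ = _ := hx

theorem EntrySignCommute.mul [Algebra ℂ D] {η : Fin N → Fin N → ℂ} (hη : IsSignMatrix η)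
    (hu : EntrySignCommute η u) (hw : EntrySignCommute η w)
    (h : ∀ a b, w b * u a = u a * w b) : EntrySignCommute η (entryMul u w) := fun i j a b =>
  sum_twist_two hη (fun _ _ => h _ _) (fun _ _ => h _ _) (fun p q => hu i j p q)
    fun p q => hw p q a b

theorem EntrySignCommute.vec [Algebra ℂ D] {η : Fin N → Fin N → ℂ} (hη : IsSignMatrix η)
    (hu : EntrySignCommute η u) (hx : SignCommute η x)
    (h : ∀ a b, x b * u a = u a * x b) : SignCommute η (entryVec u x) := fun i j => by
  have := sum_twist_two (c' := 1) hη (fun _ _ => h _ _) (fun _ _ => h _ _) (fun p q => hu i j p q)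
    fun p q => by rw [hx p q, mul_one]
  rwa [mul_one] at this

theorem EntrySignHalfCommute.mul [Algebra ℂ D] {η : Fin N → Fin N → ℂ} (hη : IsSignMatrix η)
    (hu : EntrySignHalfCommute η u) (hw : EntrySignHalfCommute η w)
    (h : ∀ a b, w b * u a = u a * w b) :
    EntrySignHalfCommute η (entryMul u w) := fun i j k a b c =>
  sum_twist_three hη (fun _ _ => h _ _) (fun _ _ => h _ _) (fun _ _ => h _ _) (fun _ _ => h _ _)
    (fun _ _ => h _ _) (fun _ _ => h _ _) (fun p q r => hu i j k p q r) fun p q r => hw p q r a b c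

theorem EntrySignHalfCommute.vec [Algebra ℂ D] {η : Fin N → Fin N → ℂ} (hη : IsSignMatrix η)
    (hu : EntrySignHalfCommute η u) (hx : SignHalfCommute η x)
    (h : ∀ a b, x b * u a = u a * x b) : SignHalfCommute η (entryVec u x) := fun i j k => by
  have := sum_twist_three (c' := 1) hη (fun _ _ => h _ _) (fun _ _ => h _ _) (fun _ _ => h _ _)
    (fun _ _ => h _ _) (fun _ _ => h _ _) (fun _ _ => h _ _) (fun p q r => hu i j k p q r)
    fun p q r => by rw [hx p q r, mul_one]
  rwa [mul_one] at this

theorem IsCubic.mul (hu : IsCubic u) (hw : IsCubic w)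
    (h : ∀ a b, w b * u a = u a * w b) : IsCubic (entryMul u w) := by
  constructor
  · intro i j a hij
    refine (sum_mul_sum_of_commute fun p q => h _ _).trans ?_
    refine Finset.sum_eq_zero fun p _ => Finset.sum_eq_zero fun q _ => ?_
    by_cases hpq : p = q
    · subst hpq
      rw [hu.1 i j p hij, zero_mul]
    · rw [hw.1 p q a hpq, mul_zero]
  · intro i a b hab
    refine (sum_mul_sum_of_commute fun p q => h _ _).trans ?_
    refine Finset.sum_eq_zero fun p _ => Finset.sum_eq_zero fun q _ => ?_
    by_cases hpq : p = q
    · subst hpq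
      rw [hw.2 p a b hab, mul_zero]
    · rw [hu.2 i p q hpq, zero_mul]

theorem IsInfCubic.mul (hu : IsInfCubic u) (hw : IsInfCubic w)
    (h : ∀ a b, w b * u a = u a * w b) : IsInfCubic (entryMul u w) := by
  constructor
  · intro i j k a b hik
    refine (sum_mul_sum_mul_sum_of_commute (fun p q => h _ _) (fun p q => h _ _)
      fun p q => h _ _).trans ?_
    refine Finset.sum_eq_zero fun p _ => Finset.sum_eq_zero fun q _ =>
      Finset.sum_eq_zero fun r _ => ?_
    by_cases hpr : p = r
    · subst hpr
      rw [hu.1 i j k p q hik, zero_mul]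
    · rw [hw.1 p q r a b hpr, mul_zero]
  · intro i j a b c hac
    refine (sum_mul_sum_mul_sum_of_commute (fun p q => h _ _) (fun p q => h _ _)
      fun p q => h _ _).trans ?_
    refine Finset.sum_eq_zero fun p _ => Finset.sum_eq_zero fun q _ =>
      Finset.sum_eq_zero fun r _ => ?_
    by_cases hpr : p = r
    · subst hpr
      rw [hw.2 p q a b c hac, mul_zero]
    · rw [hu.2 i j p q r hpr, zero_mul]

theorem IsCubic.vec_pairZero (hu : IsCubic u) (hx : PairZero x)
    (h : ∀ a b, x b * u a = u a * x b) : PairZero (entryVec u x) := by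
  intro i j hij
  refine (sum_mul_sum_of_commute fun p q => h _ _).trans ?_
  refine Finset.sum_eq_zero fun p _ => Finset.sum_eq_zero fun q _ => ?_
  by_cases hpq : p = q
  · subst hpq
    rw [hu.1 i j p hij, zero_mul]
  · rw [hx p q hpq, mul_zero]

/-- In the triple sum, terms with two equal summation indices are killed by the matrix entries,
which lie in distinct rows, and the other terms by `TripleZero x`. -/
theorem IsCubic.vec_tripleZero (hu : IsCubic u) (hu' : ∀ i j k a b, i ≠ k →
    u (i, a) * u (j, b) * u (k, a) = 0) (hx : TripleZero x)
    (h : ∀ a b, x b * u a = u a * x b) : TripleZero (entryVec u x) := by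
  intro i j k hij hik hjk
  refine (sum_mul_sum_mul_sum_of_commute (fun p q => h _ _) (fun p q => h _ _)
    fun p q => h _ _).trans ?_
  refine Finset.sum_eq_zero fun p _ => Finset.sum_eq_zero fun q _ =>
    Finset.sum_eq_zero fun r _ => ?_
  by_cases hpq : p = q
  · subst hpq
    rw [hu.1 i j p hij, zero_mul, zero_mul]
  by_cases hqr : q = r
  · subst hqr
    rw [mul_assoc (u (i, p)), hu.1 j k q hjk, mul_zero, zero_mul]
  by_cases hpr : p = r
  · subst hpr
    rw [hu' i j k p q hik, zero_mul]
  · rw [hx p q r hpq hpr hqr, mul_zero]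

/-- For a cubic matrix, the commutation relations only involve the signs of distinct indices. -/
theorem EntrySignCommute.of_isCubic [Algebra ℂ D] {η η' : Fin N → Fin N → ℂ}
    (hη : IsSignMatrix η)
    (hoff : ∀ i j a b, i ≠ j → a ≠ b → η i j * η a b = η' i j * η' a b)
    (hu : EntrySignCommute η' u) (hc : IsCubic u) : EntrySignCommute η u := by
  intro i j a b
  by_cases hi : i = j
  · subst hi
    by_cases ha : a = b
    · subst ha
      rw [hη.diag, hη.diag, one_mul, one_smul]
    · rw [hc.2 i a b ha, hc.2 i b a (Ne.symm ha), smul_zero]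
  · by_cases ha : a = b
    · subst ha
      rw [hc.1 i j a hi, hc.1 j i a (Ne.symm hi), smul_zero]
    · rw [hu i j a b, hoff i j a b hi ha]

theorem EntrySignCommute.comm [Algebra ℂ D] (hu : EntrySignCommute (fun _ _ => 1) u)
    (a b : Fin N × Fin N) : u a * u b = u b * u a := by
  have := hu a.1 b.1 a.2 b.2
  simpa using this

theorem entrySignCommute_one [Algebra ℂ D] (hu : ∀ a b, u a * u b = u b * u a) :
    EntrySignCommute (fun _ _ => 1) u := by
  intro i j a b
  rw [hu, one_mul, one_smul]

theorem isSignMatrix_one : IsSignMatrix fun _ _ : Fin N => (1 : ℂ) :=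
  ⟨fun _ _ => one_mul _, fun _ _ => rfl, fun _ => rfl⟩

/-- The signs of the twisted relations. -/
def twistSign (i j : Fin N) : ℂ := if i = j then 1 else -1

theorem isSignMatrix_twistSign : IsSignMatrix (twistSign (N := N)) :=
  ⟨fun i j => by unfold twistSign; split_ifs <;> norm_num,
    fun i j => by unfold twistSign; simp only [eq_comm], fun i => by simp [twistSign]⟩

theorem tripleSign_one (i j k : Fin N) : tripleSign (fun _ _ => 1) i j k = 1 := by
  simp [tripleSign]

end Relations

/-! ### Cubic matrices over a C*-algebra. -/

section CStar

variable {N : ℕ} {D : Type} [CStarAlgebra D] {u : Fin N × Fin N → D} {x : Fin N → D}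

/-- By the C*-identity it suffices that `(ac)(ac)* = acca` vanishes. -/
theorem mul_eq_zero_of_mul_mul_self {a c : D} (ha : star a = a) (hc : star c = c)
    (h : a * c * c = 0) : a * c = 0 := by
  rw [← CStarRing.mul_star_self_eq_zero_iff, star_mul, ha, hc, ← mul_assoc, h, zero_mul]

theorem IsInfCubic.isCubic (hs : ∀ a, star (u a) = u a) (hu : IsInfCubic u) : IsCubic u :=
  ⟨fun i j a hij => mul_eq_zero_of_mul_mul_self (hs _) (hs _) (hu.1 i j j a a hij),
    fun i a b hab => mul_eq_zero_of_mul_mul_self (hs _) (hs _) (hu.2 i i a b b hab)⟩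

/-- Insert `∑ b, u_ib² = 1` in front of `u_kr u_ip²`: only `b = p` survives, so this element equals
`u_ip² u_kr u_ip²`. The latter is self-adjoint, and taking adjoints gives the commutation. -/
theorem IsInfCubic.sq_comm (hs : ∀ a, star (u a) = u a) (ho : IsOrthogonal u) (hu : IsInfCubic u)
    (i k p r : Fin N) :
    u (i, p) * u (i, p) * u (k, r) = u (k, r) * (u (i, p) * u (i, p)) := by
  have key : u (k, r) * (u (i, p) * u (i, p)) =
      u (i, p) * u (i, p) * u (k, r) * (u (i, p) * u (i, p)) := by
    have h1 : ∑ b, u (i, b) * u (i, b) = 1 := (ho.1 i i).trans (if_pos rfl)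
    rw [← one_mul (u (k, r) * (u (i, p) * u (i, p))), ← h1, Finset.sum_mul, Finset.sum_eq_single p]
    · simp only [mul_assoc]
    · intro b _ hb
      have := hu.2 i k b r p hb
      calc u (i, b) * u (i, b) * (u (k, r) * (u (i, p) * u (i, p)))
          = u (i, b) * (u (i, b) * u (k, r) * u (i, p)) * u (i, p) := by simp only [mul_assoc]
        _ = 0 := by rw [this, mul_zero, zero_mul]
    · simp
  have key' := congrArg star key
  simp only [star_mul, hs] at key'
  exact key'.trans ((mul_assoc _ _ _).symm.trans key.symm)

theorem IsInfCubic.vec_tripleZero (hs : ∀ a, star (u a) = u a) (hu : IsInfCubic u)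
    (hx : TripleZero x) (h : ∀ a b, x b * u a = u a * x b) : TripleZero (entryVec u x) :=
  (hu.isCubic hs).vec_tripleZero hu.1 hx h

/-- For distinct indices both sides vanish, and `i, j, i` is trivial. There remain two equal
adjacent indices, where cubicity leaves only squares of entries, which are central among the entries
by `IsInfCubic.sq_comm`. -/
theorem IsInfCubic.vec_half (hs : ∀ a, star (u a) = u a) (ho : IsOrthogonal u) (hu : IsInfCubic u)
    (hx : TripleZero x) (hx' : SignHalfCommute (fun _ _ => 1) x)
    (h : ∀ a b, x b * u a = u a * x b) : SignHalfCommute (fun _ _ => 1) (entryVec u x) := by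
  have hc := hu.isCubic hs
  have hz := hu.vec_tripleZero hs hx h
  have key : ∀ i k, entryVec u x i * entryVec u x i * entryVec u x k =
      entryVec u x k * entryVec u x i * entryVec u x i := fun i k => by
    refine sum_twist_three (c := 1) (c' := 1) isSignMatrix_one (fun _ _ => h _ _) (fun _ _ => h _ _)
      (fun _ _ => h _ _) (fun _ _ => h _ _) (fun _ _ => h _ _) (fun _ _ => h _ _) ?_ ?_ |>.trans ?_
    · intro p q r
      rw [tripleSign_one, one_mul, one_smul]
      by_cases hpq : p = q
      · subst hpq
        rw [hu.sq_comm hs ho, mul_assoc]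
      · rw [hc.2 i p q hpq, mul_assoc (u (k, r)), hc.2 i q p (Ne.symm hpq), zero_mul, mul_zero]
    · intro p q r
      rw [hx' p q r, mul_one]
    · rw [one_mul, one_smul]; rfl
  intro i j k
  rw [tripleSign_one, one_smul]
  by_cases hij : i = j
  · subst hij; exact key i k
  by_cases hik : i = k
  · subst hik; rfl
  by_cases hjk : j = k
  · subst hjk; exact (key j i).symm
  rw [hz i j k hij hik hjk, hz k j i (Ne.symm hjk) (Ne.symm hik) (Ne.symm hij)]

end CStar

/-! ## Universal noncommutative spaces for a predicate on tuples -/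

/-- `X` is universal among the families of self-adjoint elements of C*-algebras satisfying `Q`. -/
structure IsUniversalFor {ι : Type} (X : NCSpace ι)
    (Q : ∀ (D : Type) [CStarAlgebra D], (ι → D) → Prop) : Prop where
  star_coord (i : ι) : star (X.coord i) = X.coord i
  -- Stated for every morphism because an arbitrary predicate `Q` need not be preserved by
  -- morphisms. It is applied to the two inclusions in a tensor product.
  map (D : Type) [CStarAlgebra D] (f : X.Alg →⋆ₐ[ℂ] D) : Q D fun i => f (X.coord i)
  dense : X.poly.topologicalClosure = ⊤
  lift (D : Type) [CStarAlgebra D] (d : ι → D) : (∀ i, star (d i) = d i) → Q D d →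
    ∃ g : X.Alg →⋆ₐ[ℂ] D, ∀ i, g (X.coord i) = d i

theorem IsPresented.isUniversalFor {ι : Type} {X : NCSpace ι} {P : Set (NCPoly ι)}
    (h : IsPresented X P) (Q : ∀ (D : Type) [CStarAlgebra D], (ι → D) → Prop)
    (hPQ : ∀ (D : Type) [CStarAlgebra D] (d : ι → D),
      (∀ f ∈ P, NCPoly.eval d f = 0) ↔ Q D d) : IsUniversalFor X Q where
  star_coord := h.star_coord
  map D _ f := by
    rw [← hPQ]
    intro p hp
    rw [← NCPoly.map_eval, h.rel p hp, map_zero]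
  dense := h.dense
  lift D _ d hd hQ := h.lift D d hd ((hPQ D d).2 hQ)

theorem IsUniversalFor.rel {ι : Type} {X : NCSpace ι}
    {Q : ∀ (D : Type) [CStarAlgebra D], (ι → D) → Prop} (h : IsUniversalFor X Q) :
    Q X.Alg X.coord := h.map X.Alg (StarAlgHom.id ℂ X.Alg)

/-! ### Quantum group structures and affine actions obtained from universality. -/

section QuantumGroups

variable {N : ℕ} {Q : ∀ (D : Type) [CStarAlgebra D], (Fin N × Fin N → D) → Prop}
  {G : NCSpace (Fin N × Fin N)}

theorem star_entryMul {D : Type} [CStarAlgebra D] {u w : Fin N × Fin N → D}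
    (hu : ∀ a, star (u a) = u a) (hw : ∀ a, star (w a) = w a)
    (h : ∀ a b, w b * u a = u a * w b) (p : Fin N × Fin N) :
    star (entryMul u w p) = entryMul u w p := by
  unfold entryMul
  rw [star_sum]
  refine Finset.sum_congr rfl fun k _ => ?_
  rw [star_mul, hu, hw, h]

theorem star_entryVec {D : Type} [CStarAlgebra D] {u : Fin N × Fin N → D} {x : Fin N → D}
    (hu : ∀ a, star (u a) = u a) (hx : ∀ a, star (x a) = x a)
    (h : ∀ a b, x b * u a = u a * x b) (p : Fin N) :
    star (entryVec u x p) = entryVec u x p := by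
  unfold entryVec
  rw [star_sum]
  refine Finset.sum_congr rfl fun k _ => ?_
  rw [star_mul, hu, hx, h]

/-- A noncommutative space whose coordinates are universal for the orthogonality relations and for
relations compatible with the group operations is a quantum group. -/
theorem IsUniversalFor.isQuantumSubgroup
    (hG : IsUniversalFor G fun D _ u => IsOrthogonal u ∧ Q D u)
    (hmul : ∀ (D : Type) [CStarAlgebra D] (u w : Fin N × Fin N → D),
      (∀ a b, w b * u a = u a * w b) → Q D u → Q D w → Q D (entryMul u w))
    (hone : Q ℂ fun p => if p.1 = p.2 then 1 else 0)
    (hop : ∀ (D : Type) [CStarAlgebra D] (u : Fin N × Fin N → D), Q D u →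
      Q Dᵐᵒᵖ fun p => MulOpposite.op (u (p.2, p.1))) : IsQuantumSubgroup G where
  selfAdjoint i j := hG.star_coord _
  mul_transpose i j := hG.rel.1.1 i j
  transpose_mul i j := hG.rel.1.2 i j
  dense := hG.dense
  comul := by
    let u : Fin N × Fin N → SpatialTensor G.Alg G.Alg :=
      fun p => SpatialTensor.inclLeft G.Alg G.Alg (G.coord p)
    let w : Fin N × Fin N → SpatialTensor G.Alg G.Alg :=
      fun p => SpatialTensor.inclRight G.Alg G.Alg (G.coord p)
    have hu : ∀ a, star (u a) = u a := fun a => by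
      change star (SpatialTensor.inclLeft G.Alg G.Alg _) = _
      rw [← map_star, hG.star_coord]
    have hw : ∀ a, star (w a) = w a := fun a => by
      change star (SpatialTensor.inclRight G.Alg G.Alg _) = _
      rw [← map_star, hG.star_coord]
    have hc : ∀ a b, w b * u a = u a * w b := fun a b => (SpatialTensor.inclLeft_comm _ _).symm
    have h1 := hG.map _ (SpatialTensor.inclLeft G.Alg G.Alg)
    have h2 := hG.map _ (SpatialTensor.inclRight G.Alg G.Alg)
    obtain ⟨Δ, hΔ⟩ := hG.lift _ (entryMul u w) (star_entryMul hu hw hc)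
      ⟨h1.1.mul h2.1 hc, hmul _ u w hc h1.2 h2.2⟩
    refine ⟨Δ, fun i j => (hΔ (i, j)).trans ?_⟩
    exact Finset.sum_congr rfl fun k _ => SpatialTensor.inclLeft_mul_inclRight _ _
  counit := by
    obtain ⟨ε, hε⟩ := hG.lift ℂ (fun p => if p.1 = p.2 then 1 else 0)
      (fun p => by split_ifs <;> simp) ⟨by constructor <;> intro i j <;> simp [eq_comm], hone⟩
    exact ⟨ε.comp G.poly.subtype, fun i j => hε (i, j)⟩
  antipode := by
    obtain ⟨S, hS⟩ := hG.lift G.Algᵐᵒᵖ (fun p => MulOpposite.op (G.coord (p.2, p.1)))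
      (fun p => by rw [← MulOpposite.op_star, hG.star_coord]) ⟨by
        have h := hG.rel.1
        constructor <;> intro i j
        · simp only [← MulOpposite.op_mul, ← Finset.op_sum]
          rw [h.2 j i]
          simp only [eq_comm (a := j)]
          split_ifs <;> simp
        · simp only [← MulOpposite.op_mul, ← Finset.op_sum]
          rw [h.1 j i]
          simp only [eq_comm (a := j)]
          split_ifs <;> simp, hop _ _ hG.rel.2⟩
    exact ⟨S.comp G.poly.subtype, fun i j => hS (i, j)⟩

theorem IsUniversalFor.actsAffinely {X : NCSpace (Fin N)}
    {Q : ∀ (D : Type) [CStarAlgebra D], (Fin N × Fin N → D) → Prop}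
    {R : ∀ (D : Type) [CStarAlgebra D], (Fin N → D) → Prop}
    (hG : IsUniversalFor G Q) (hX : IsUniversalFor X R)
    (h : ∀ (D : Type) [CStarAlgebra D] (u : Fin N × Fin N → D) (x : Fin N → D),
      (∀ a, star (u a) = u a) → (∀ a b, x b * u a = u a * x b) → Q D u → R D x →
      R D (entryVec u x)) : ActsAffinely G X := by
  let u : Fin N × Fin N → SpatialTensor G.Alg X.Alg :=
    fun p => SpatialTensor.inclLeft G.Alg X.Alg (G.coord p)
  let x : Fin N → SpatialTensor G.Alg X.Alg :=
    fun p => SpatialTensor.inclRight G.Alg X.Alg (X.coord p)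
  have hu : ∀ a, star (u a) = u a := fun a => by
    change star (SpatialTensor.inclLeft G.Alg X.Alg _) = _
    rw [← map_star, hG.star_coord]
  have hx : ∀ a, star (x a) = x a := fun a => by
    change star (SpatialTensor.inclRight G.Alg X.Alg _) = _
    rw [← map_star, hX.star_coord]
  have hc : ∀ a b, x b * u a = u a * x b := fun a b => (SpatialTensor.inclLeft_comm _ _).symm
  obtain ⟨Φ, hΦ⟩ := hX.lift _ (entryVec u x) (star_entryVec hu hx hc)
    (h _ u x hu hc (hG.map _ _) (hX.map _ _))
  refine ⟨Φ, fun i => (hΦ i).trans ?_⟩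
  exact Finset.sum_congr rfl fun k _ => SpatialTensor.inclLeft_mul_inclRight _ _

end QuantumGroups

/-! ## The spheres and the quantum groups as universal objects -/

section NormBound

open scoped CStarAlgebra

attribute [local instance] CStarAlgebra.spectralOrder CStarAlgebra.spectralOrderedRing

/-- In the order of the C*-algebra, `d_i²` is at most the whole sum. This shows that the norm bound
built into `admissible` costs nothing here. -/
theorem norm_le_one_of_sum_mul_self_eq_one {ι D : Type} [Fintype ι] [CStarAlgebra D] {d : ι → D}
    (hd : ∀ i, star (d i) = d i) (h : ∑ i, d i * d i = 1) (i : ι) : ‖d i‖ ≤ 1 := by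
  have hn : ∀ j, 0 ≤ d j * d j := fun j => by
    have := star_mul_self_nonneg (d j)
    rwa [hd] at this
  have h1 : d i * d i ≤ 1 := by
    rw [← h]
    exact Finset.single_le_sum (f := fun j => d j * d j) (fun j _ => hn j) (Finset.mem_univ i)
  have h2 : ‖d i * d i‖ ≤ 1 := (CStarAlgebra.norm_le_one_iff_of_nonneg _ (hn i)).2 h1
  have h3 := CStarRing.norm_star_mul_self (x := d i)
  rw [hd] at h3
  nlinarith [norm_nonneg (d i)]

end NormBound

section Universal

open NCPoly

variable {N : ℕ}

theorem forall_mem_union_sphere {D : Type} [CStarAlgebra D] (P : Set (NCPoly (Fin N)))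
    (d : Fin N → D) : (∀ f ∈ ({(∑ i, X i * X i) - 1} ∪ P : Set (NCPoly (Fin N))), eval d f = 0) ↔
      OnSphere d ∧ ∀ f ∈ P, eval d f = 0 := by
  simp [OnSphere, or_imp, forall_and, sub_eq_zero]

theorem forall_mem_orthogonality {D : Type} [CStarAlgebra D]
    (P : Set (NCPoly (Fin N × Fin N))) (d : Fin N × Fin N → D) :
    (∀ f ∈ orthogonality N ∪ P, eval d f = 0) ↔ IsOrthogonal d ∧ ∀ f ∈ P, eval d f = 0 := by
  have h : ∀ i j : Fin N, eval d (if i = j then (1 : NCPoly (Fin N × Fin N)) else 0) =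
      if i = j then 1 else 0 := fun i j => by split_ifs <;> simp
  constructor
  · intro H
    refine ⟨⟨fun i j => ?_, fun i j => ?_⟩, fun f hf => H f (Or.inr hf)⟩
    · have := H _ (Or.inl (Or.inl ⟨i, j, rfl⟩))
      rw [map_sub, h, sub_eq_zero] at this
      simpa using this
    · have := H _ (Or.inl (Or.inr ⟨i, j, rfl⟩))
      rw [map_sub, h, sub_eq_zero] at this
      simpa using this
  · rintro ⟨⟨h1, h2⟩, h3⟩ f ((⟨i, j, rfl⟩ | ⟨i, j, rfl⟩) | hf)
    · rw [map_sub, h, sub_eq_zero]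
      simpa using h1 i j
    · rw [map_sub, h, sub_eq_zero]
      simpa using h2 i j
    · exact h3 f hf

theorem isUniversalFor_ncSphere (P : Set (NCPoly (Fin N)))
    (R : ∀ (D : Type) [CStarAlgebra D], (Fin N → D) → Prop)
    (hR : ∀ (D : Type) [CStarAlgebra D] (d : Fin N → D), (∀ f ∈ P, eval d f = 0) ↔ R D d) :
    IsUniversalFor (ncSphere N P) fun D _ d => OnSphere d ∧ R D d := by
  refine (isPresented_universal _ fun D _ d hd hP => ?_).isUniversalFor _ fun D _ d => ?_
  · exact norm_le_one_of_sum_mul_self_eq_one hd ((forall_mem_union_sphere P d).1 hP).1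
  · rw [forall_mem_union_sphere, hR]

theorem isUniversalFor_quantumSubgroup (P : Set (NCPoly (Fin N × Fin N)))
    (R : ∀ (D : Type) [CStarAlgebra D], (Fin N × Fin N → D) → Prop)
    (hR : ∀ (D : Type) [CStarAlgebra D] (d : Fin N × Fin N → D),
      (∀ f ∈ P, eval d f = 0) ↔ R D d) :
    IsUniversalFor (quantumSubgroup N P) fun D _ d => IsOrthogonal d ∧ R D d := by
  refine (isPresented_universal _ fun D _ d hd hP => ?_).isUniversalFor _ fun D _ d => ?_
  · rintro ⟨i, j⟩
    have h := ((forall_mem_orthogonality P d).1 hP).1.1 i i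
    rw [if_pos rfl] at h
    exact norm_le_one_of_sum_mul_self_eq_one (d := fun k => d (i, k)) (fun k => hd _) h j
  · rw [forall_mem_orthogonality, hR]

/-- The commutation relations. -/
def commutators (ι : Type) : Set (NCPoly ι) := {f | ∃ i j, f = X i * X j - X j * X i}

theorem isUniversalFor_classical {ι Y : Type} [TopologicalSpace Y] [CompactSpace Y]
    (x : ι → C(Y, ℝ)) (P : Set (NCPoly ι)) (hcomm : commutators ι ⊆ P)
    (Q : ∀ (D : Type) [CStarAlgebra D], (ι → D) → Prop)
    (hsep : ∀ y y', (∀ i, x i y = x i y') → y = y')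
    (hPQ : ∀ (D : Type) [CStarAlgebra D] (d : ι → D), (∀ f ∈ P, eval d f = 0) ↔ Q D d)
    (hpt : ∀ c : ι → ℝ, Q ℂ (fun i => (c i : ℂ)) ↔ ∃ y, ∀ i, x i y = c i) :
    IsUniversalFor (NCSpace.classical Y x) Q :=
  (isPresented_classical x P hsep (fun i j => hcomm ⟨i, j, rfl⟩)
    fun c => (hPQ ℂ _).trans (hpt c)).isUniversalFor Q hPQ

theorem forall_mem_commutators {ι D : Type} [CStarAlgebra D] (d : ι → D) :
    (∀ f ∈ commutators ι, eval d f = 0) ↔ ∀ i j, d i * d j = d j * d i := by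
  constructor
  · intro h i j
    have := h _ ⟨i, j, rfl⟩
    simpa [sub_eq_zero] using this
  · rintro h _ ⟨i, j, rfl⟩
    simp [h i j]

theorem forall_mem_polygonal_one {D : Type} [CStarAlgebra D] (d : Fin N → D) :
    (∀ f ∈ polygonal N 1, eval d f = 0) ↔ PairZero d := by
  constructor
  · intro h i j hij
    have := h _ ⟨![i, j], by
      intro a b hab
      fin_cases a <;> fin_cases b <;> simp_all [eq_comm], rfl⟩
    simpa using this
  · rintro h _ ⟨i, hi, rfl⟩
    have := h (i 0) (i 1) (hi.ne (by decide))
    simpa using this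

theorem forall_mem_polygonal_two {D : Type} [CStarAlgebra D] (d : Fin N → D) :
    (∀ f ∈ polygonal N 2, eval d f = 0) ↔ TripleZero d := by
  constructor
  · intro h i j k hij hik hjk
    have := h _ ⟨![i, j, k], by
      intro a b hab
      fin_cases a <;> fin_cases b <;> simp_all [eq_comm], rfl⟩
    simpa [mul_assoc] using this
  · rintro h _ ⟨i, hi, rfl⟩
    have := h (i 0) (i 1) (i 2) (hi.ne (by decide)) (hi.ne (by decide)) (hi.ne (by decide))
    simpa [mul_assoc] using this

theorem forall_mem_anticommutation {D : Type} [CStarAlgebra D] (d : Fin N → D) :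
    (∀ f ∈ anticommutation N, eval d f = 0) ↔ SignCommute twistSign d := by
  constructor
  · intro h i j
    by_cases hij : i = j
    · subst hij; simp [twistSign]
    · have := h _ ⟨i, j, hij, rfl⟩
      simp [twistSign, hij]
      simpa [add_eq_zero_iff_eq_neg] using this
  · rintro h _ ⟨i, j, hij, rfl⟩
    have := h i j
    simp [twistSign, hij] at this
    simp [this]

theorem forall_mem_halfCommutation {D : Type} [CStarAlgebra D] (d : Fin N → D) :
    (∀ f ∈ halfCommutation N, eval d f = 0) ↔ SignHalfCommute (fun _ _ => 1) d := by
  simp only [SignHalfCommute, tripleSign_one, one_smul]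
  constructor
  · intro h i j k
    have := h _ ⟨i, j, k, rfl⟩
    simpa [sub_eq_zero] using this
  · rintro h _ ⟨i, j, k, rfl⟩
    simp [h i j k]

theorem tripleSign_twistSign_of_ne {i j k : Fin N} (h : i ≠ j ∧ i ≠ k ∧ j ≠ k) :
    tripleSign twistSign i j k = -1 := by
  simp [tripleSign, twistSign, h.1, h.2.1, h.2.2]

/-- When two indices coincide, their own sign is 1 and their signs with the third index are equal,
so they cancel. -/
theorem tripleSign_twistSign_of_not {i j k : Fin N} (h : ¬ (i ≠ j ∧ i ≠ k ∧ j ≠ k)) :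
    tripleSign twistSign i j k = 1 := by
  by_cases hij : i = j
  · subst hij; exact isSignMatrix_twistSign.triple_left _ _
  by_cases hik : i = k
  · subst hik; exact isSignMatrix_twistSign.triple_outer _ _
  by_cases hjk : j = k
  · subst hjk
    rw [← isSignMatrix_twistSign.triple_reverse]
    exact isSignMatrix_twistSign.triple_left _ _
  · exact absurd ⟨hij, hik, hjk⟩ h

theorem forall_mem_twistedHalfCommutation {D : Type} [CStarAlgebra D] (d : Fin N → D) :
    (∀ f ∈ twistedHalfCommutation N, eval d f = 0) ↔ SignHalfCommute twistSign d := by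
  constructor
  · intro h i j k
    by_cases hd : i ≠ j ∧ i ≠ k ∧ j ≠ k
    · rw [tripleSign_twistSign_of_ne hd]
      have := h _ (Or.inl ⟨i, j, k, hd, rfl⟩)
      simpa [add_eq_zero_iff_eq_neg] using this
    · rw [tripleSign_twistSign_of_not hd]
      have := h _ (Or.inr ⟨i, j, k, hd, rfl⟩)
      simpa [sub_eq_zero] using this
  · rintro h _ (⟨i, j, k, hd, rfl⟩ | ⟨i, j, k, hd, rfl⟩)
    · have := h i j k
      rw [tripleSign_twistSign_of_ne hd] at this
      simp [this]
    · have := h i j k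
      rw [tripleSign_twistSign_of_not hd] at this
      simp [this]

theorem rowSpan_eq_three {a b c : Fin N × Fin N} :
    rowSpan a b c = 3 ↔ (a.1 ≠ b.1 ∧ a.1 ≠ c.1 ∧ b.1 ≠ c.1) := by
  unfold rowSpan
  constructor
  · intro h
    by_contra hn
    have : ({a.1, b.1, c.1} : Finset (Fin N)).card ≤ 2 := by
      by_cases h1 : a.1 = b.1
      · rw [h1]; simpa using Finset.card_le_two
      by_cases h2 : a.1 = c.1
      · rw [h2, Finset.insert_eq_of_mem (by simp)]; exact Finset.card_le_two
      by_cases h3 : b.1 = c.1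
      · rw [h3, Finset.insert_eq_of_mem (a := c.1) (by simp)]; exact Finset.card_le_two
      exact absurd ⟨h1, h2, h3⟩ hn
    omega
  · rintro ⟨h1, h2, h3⟩
    exact Finset.card_eq_three.2 ⟨_, _, _, h1, h2, h3, rfl⟩

theorem rowSpan_le_two {a b c : Fin N × Fin N} :
    rowSpan a b c ≤ 2 ↔ ¬ (a.1 ≠ b.1 ∧ a.1 ≠ c.1 ∧ b.1 ≠ c.1) := by
  rw [← rowSpan_eq_three]
  have : rowSpan a b c ≤ 3 := Finset.card_le_three
  omega

theorem colSpan_eq_rowSpan_swap (a b c : Fin N × Fin N) :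
    colSpan a b c = rowSpan a.swap b.swap c.swap := rfl

/-- The product of the row sign and the column sign is -1 exactly when one of the two triples, and
not the other, consists of distinct indices. -/
theorem forall_mem_twistedHalfOrthogonal {D : Type} [CStarAlgebra D] (d : Fin N × Fin N → D) :
    (∀ f ∈ ({f | ∃ a b c, (rowSpan a b c ≤ 2 ∧ colSpan a b c = 3 ∨
          rowSpan a b c = 3 ∧ colSpan a b c ≤ 2) ∧ f = X a * X b * X c + X c * X b * X a} ∪
        {f | ∃ a b c, (rowSpan a b c ≤ 2 ∧ colSpan a b c ≤ 2 ∨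
          rowSpan a b c = 3 ∧ colSpan a b c = 3) ∧ f = X a * X b * X c - X c * X b * X a} :
        Set (NCPoly (Fin N × Fin N))), eval d f = 0) ↔ EntrySignHalfCommute twistSign d := by
  simp only [colSpan_eq_rowSpan_swap, rowSpan_eq_three, rowSpan_le_two, Prod.fst_swap]
  constructor
  · intro h i j k a b c
    by_cases hr : i ≠ j ∧ i ≠ k ∧ j ≠ k <;> by_cases hc : a ≠ b ∧ a ≠ c ∧ b ≠ c
    · have := h _ (Or.inr ⟨(i, a), (j, b), (k, c), Or.inr ⟨hr, hc⟩, rfl⟩)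
      rw [tripleSign_twistSign_of_ne hr, tripleSign_twistSign_of_ne hc]
      simpa [sub_eq_zero] using this
    · have := h _ (Or.inl ⟨(i, a), (j, b), (k, c), Or.inr ⟨hr, hc⟩, rfl⟩)
      rw [tripleSign_twistSign_of_ne hr, tripleSign_twistSign_of_not hc]
      simpa [add_eq_zero_iff_eq_neg] using this
    · have := h _ (Or.inl ⟨(i, a), (j, b), (k, c), Or.inl ⟨hr, hc⟩, rfl⟩)
      rw [tripleSign_twistSign_of_not hr, tripleSign_twistSign_of_ne hc]
      simpa [add_eq_zero_iff_eq_neg] using this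
    · have := h _ (Or.inr ⟨(i, a), (j, b), (k, c), Or.inl ⟨hr, hc⟩, rfl⟩)
      rw [tripleSign_twistSign_of_not hr, tripleSign_twistSign_of_not hc]
      simpa [sub_eq_zero] using this
  · rintro h _ (⟨a, b, c, (⟨hr, hc⟩ | ⟨hr, hc⟩), rfl⟩ | ⟨a, b, c, (⟨hr, hc⟩ | ⟨hr, hc⟩), rfl⟩)
    · have := h a.1 b.1 c.1 a.2 b.2 c.2
      rw [tripleSign_twistSign_of_not hr, tripleSign_twistSign_of_ne hc] at this
      simp [this]
    · have := h a.1 b.1 c.1 a.2 b.2 c.2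
      rw [tripleSign_twistSign_of_ne hr, tripleSign_twistSign_of_not hc] at this
      simp [this]
    · have := h a.1 b.1 c.1 a.2 b.2 c.2
      rw [tripleSign_twistSign_of_not hr, tripleSign_twistSign_of_not hc] at this
      simp [this]
    · have := h a.1 b.1 c.1 a.2 b.2 c.2
      rw [tripleSign_twistSign_of_ne hr, tripleSign_twistSign_of_ne hc] at this
      simp [this]

theorem forall_mem_halfOrthogonal {D : Type} [CStarAlgebra D] (d : Fin N × Fin N → D) :
    (∀ f ∈ ({f | ∃ a b c, f = X a * X b * X c - X c * X b * X a} :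
        Set (NCPoly (Fin N × Fin N))), eval d f = 0) ↔
      EntrySignHalfCommute (fun _ _ => 1) d := by
  simp only [EntrySignHalfCommute, tripleSign_one, one_smul, mul_one]
  constructor
  · intro h i j k a b c
    have := h _ ⟨(i, a), (j, b), (k, c), rfl⟩
    simpa [sub_eq_zero] using this
  · rintro h _ ⟨a, b, c, rfl⟩
    have := h a.1 b.1 c.1 a.2 b.2 c.2
    simp [this]

theorem forall_mem_twistedOrthogonal {D : Type} [CStarAlgebra D] (d : Fin N × Fin N → D) :
    (∀ f ∈ ({f | ∃ a b, (a ≠ b ∧ SameLine a b) ∧ f = X a * X b + X b * X a} ∪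
        {f | ∃ a b, ¬ (a ≠ b ∧ SameLine a b) ∧ f = X a * X b - X b * X a} :
        Set (NCPoly (Fin N × Fin N))), eval d f = 0) ↔ EntrySignCommute twistSign d := by
  constructor
  · intro h i j a b
    by_cases hi : i = j <;> by_cases ha : a = b
    · subst hi ha; simp [twistSign]
    · have := h _ (Or.inl ⟨(i, a), (j, b), ⟨by simp [ha], Or.inl hi⟩, rfl⟩)
      simpa [twistSign, hi, ha, add_eq_zero_iff_eq_neg] using this
    · have := h _ (Or.inl ⟨(i, a), (j, b), ⟨by simp [hi], Or.inr ha⟩, rfl⟩)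
      simpa [twistSign, hi, ha, add_eq_zero_iff_eq_neg] using this
    · have := h _ (Or.inr ⟨(i, a), (j, b), by simp [SameLine, hi, ha], rfl⟩)
      simpa [twistSign, hi, ha, sub_eq_zero] using this
  · rintro h _ (⟨⟨i, a⟩, ⟨j, b⟩, hab, rfl⟩ | ⟨⟨i, a⟩, ⟨j, b⟩, hab, rfl⟩)
    · have := h i j a b
      by_cases hi : i = j <;> by_cases ha : a = b <;>
        simp_all [twistSign, SameLine]
    · have := h i j a b
      by_cases hi : i = j <;> by_cases ha : a = b <;>
        simp_all [twistSign, SameLine]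

/-- The relations `ab = 0` for `a ≠ b` on the same row or column. -/
def cubicRelations (N : ℕ) : Set (NCPoly (Fin N × Fin N)) :=
  {f | ∃ a b, a ≠ b ∧ SameLine a b ∧ f = X a * X b}

theorem forall_mem_cubicRelations {D : Type} [CStarAlgebra D] (d : Fin N × Fin N → D) :
    (∀ f ∈ cubicRelations N, eval d f = 0) ↔ IsCubic d := by
  constructor
  · intro h
    refine ⟨fun i j a hij => ?_, fun i a b hab => ?_⟩
    · have := h _ ⟨(i, a), (j, a), by simp [hij], Or.inr rfl, rfl⟩
      simpa using this
    · have := h _ ⟨(i, a), (i, b), by simp [hab], Or.inl rfl, rfl⟩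
      simpa using this
  · rintro h _ ⟨⟨i, a⟩, ⟨j, b⟩, hne, hl, rfl⟩
    rw [map_mul, eval_X, eval_X]
    rcases hl with hl | hl
    · simp only at hl; subst hl
      exact h.2 i a b fun e => hne (by rw [e])
    · simp only at hl; subst hl
      exact h.1 i j a fun e => hne (by rw [e])

theorem forall_mem_infHyperoctahedral {D : Type} [CStarAlgebra D] (d : Fin N × Fin N → D) :
    (∀ f ∈ ({f | ∃ a b c, a ≠ c ∧ SameLine a c ∧ f = X a * X b * X c} :
        Set (NCPoly (Fin N × Fin N))), eval d f = 0) ↔ IsInfCubic d := by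
  constructor
  · intro h
    refine ⟨fun i j k a b hij => ?_, fun i j a b c hab => ?_⟩
    · have := h _ ⟨(i, a), (j, b), (k, a), by simp [hij], Or.inr rfl, rfl⟩
      simpa using this
    · have := h _ ⟨(i, a), (j, b), (i, c), by simp [hab], Or.inl rfl, rfl⟩
      simpa using this
  · rintro h _ ⟨⟨i, a⟩, ⟨j, b⟩, ⟨k, c⟩, hne, hl, rfl⟩
    rw [map_mul, map_mul, eval_X, eval_X, eval_X]
    rcases hl with hl | hl
    · simp only at hl; subst hl
      exact h.2 i j a b c fun e => hne (by rw [e])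
    · simp only at hl; subst hl
      exact h.1 i j k a b fun e => hne (by rw [e])

theorem signCommute_one_iff {D : Type} [CStarAlgebra D] (d : Fin N → D) :
    SignCommute (fun _ _ => 1) d ↔ ∀ i j, d i * d j = d j * d i := by
  simp [SignCommute]

theorem entrySignCommute_one_iff {D : Type} [CStarAlgebra D] (d : Fin N × Fin N → D) :
    EntrySignCommute (fun _ _ => 1) d ↔ ∀ i j, d i * d j = d j * d i :=
  ⟨fun h => h.comm, entrySignCommute_one⟩

theorem onSphere_ofReal (c : Fin N → ℝ) :
    OnSphere (fun i => (c i : ℂ)) ↔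
      WithLp.toLp 2 c ∈ Metric.sphere (0 : EuclideanSpace ℝ (Fin N)) 1 := by
  rw [mem_sphere_zero_iff_norm, EuclideanSpace.norm_eq, Real.sqrt_eq_one]
  simp only [OnSphere, Real.norm_eq_abs, ← Complex.ofReal_mul, ← Complex.ofReal_sum, sq, abs_mul_abs_self]
  norm_cast

theorem isUniversalFor_realSphere : IsUniversalFor (realSphere N) fun _ _ d =>
    OnSphere d ∧ SignCommute (fun _ _ => 1) d := by
  refine isUniversalFor_classical _ ({(∑ i, X i * X i) - 1} ∪ commutators (Fin N))
    Set.subset_union_right _ ?_ ?_ ?_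
  · intro y y' h
    exact Subtype.ext (PiLp.ext h)
  · intro D _ d
    rw [forall_mem_union_sphere, forall_mem_commutators, signCommute_one_iff]
  · intro c
    rw [onSphere_ofReal]
    constructor
    · rintro ⟨h, -⟩
      exact ⟨⟨_, h⟩, fun i => rfl⟩
    · rintro ⟨y, hy⟩
      refine ⟨?_, fun i j => by simp [mul_comm]⟩
      have : WithLp.toLp 2 c = y.1 := PiLp.ext fun i => (hy i).symm
      rw [this]
      exact y.2

theorem isUniversalFor_polygonalSphere (d : ℕ)
    (R : ∀ (D : Type) [CStarAlgebra D], (Fin N → D) → Prop)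
    (hR : ∀ (D : Type) [CStarAlgebra D] (x : Fin N → D),
      (∀ f ∈ commutators (Fin N) ∪ polygonal N d, eval x f = 0) ↔ R D x) :
    IsUniversalFor (polygonalSphere N d) fun D _ x => OnSphere x ∧ R D x := by
  refine isUniversalFor_classical _
    ({(∑ i, X i * X i) - 1} ∪ (commutators (Fin N) ∪ polygonal N d))
    (Set.subset_union_left.trans Set.subset_union_right) _ ?_ ?_ ?_
  · intro y y' h
    exact Subtype.ext (PiLp.ext h)
  · intro D _ x
    rw [forall_mem_union_sphere, hR]
  · intro c
    rw [onSphere_ofReal, ← hR]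
    have h1 : (∀ f ∈ commutators (Fin N) ∪ polygonal N d, eval (fun i => (c i : ℂ)) f = 0) ↔
        ∀ i : Fin (d + 1) → Fin N, Function.Injective i → ∏ k, c (i k) = 0 := by
      have h2 : ∀ i : Fin (d + 1) → Fin N, eval (fun i => (c i : ℂ))
          (List.ofFn fun k => X (i k)).prod = ((∏ k, c (i k) : ℝ) : ℂ) := fun i => by
        rw [map_list_prod, List.map_ofFn, List.prod_ofFn, Complex.ofReal_prod]
        simp
      constructor
      · intro h i hi
        have := h _ (Or.inr ⟨i, hi, rfl⟩)
        rw [h2] at this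
        exact_mod_cast this
      · rintro h _ (⟨i, j, rfl⟩ | ⟨i, hi, rfl⟩)
        · simp [mul_comm]
        · rw [h2, h i hi, Complex.ofReal_zero]
    rw [h1]
    constructor
    · intro h
      exact ⟨⟨_, h⟩, fun i => rfl⟩
    · rintro ⟨y, hy⟩
      have : WithLp.toLp 2 c = y.1 := PiLp.ext fun i => (hy i).symm
      have h3 := y.2
      rw [← this] at h3
      exact h3

/-- Vanishing of the products of distinct coordinates already implies that they commute, so
commutation can be dropped from the presentation. This is how a noncommutative quantum group can act
on this classical space. -/
theorem isUniversalFor_polygonalSphere_one : IsUniversalFor (polygonalSphere N 1) fun _ _ x =>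
    OnSphere x ∧ PairZero x := by
  refine isUniversalFor_polygonalSphere 1 _ fun D _ x => ?_
  simp only [Set.mem_union, or_imp, forall_and]
  rw [forall_mem_commutators, forall_mem_polygonal_one]
  refine and_iff_right_of_imp fun h i j => ?_
  by_cases hij : i = j
  · rw [hij]
  · rw [h i j hij, h j i (Ne.symm hij)]

theorem isUniversalFor_polygonalSphere_two : IsUniversalFor (polygonalSphere N 2) fun _ _ x =>
    OnSphere x ∧ SignCommute (fun _ _ => 1) x ∧ TripleZero x := by
  refine isUniversalFor_polygonalSphere 2 _ fun D _ x => ?_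
  simp only [Set.mem_union, or_imp, forall_and]
  rw [forall_mem_commutators, forall_mem_polygonal_two, signCommute_one_iff]

theorem isOrthogonal_ofReal (c : Fin N × Fin N → ℝ) : IsOrthogonal (fun a => (c a : ℂ)) ↔
    (Matrix.of fun i j => c (i, j)) ∈ Matrix.orthogonalGroup (Fin N) ℝ := by
  have h0 : ∀ i j : Fin N, (if i = j then (1 : ℂ) else 0) = ((if i = j then 1 else 0 : ℝ) : ℂ) :=
    fun i j => by split_ifs <;> simp
  have h : IsOrthogonal (fun a => (c a : ℂ)) ↔
      (∀ i j, ∑ k, c (i, k) * c (j, k) = if i = j then 1 else 0) ∧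
      (∀ i j, ∑ k, c (k, i) * c (k, j) = if i = j then 1 else 0) := by
    unfold IsOrthogonal
    simp only [h0, ← Complex.ofReal_mul, ← Complex.ofReal_sum, Complex.ofReal_inj]
  rw [h, Matrix.mem_orthogonalGroup_iff]
  constructor
  · rintro ⟨h1, -⟩
    ext i j
    simpa [Matrix.mul_apply, Matrix.one_apply] using h1 i j
  · intro h1
    have h2 := mul_eq_one_comm.1 h1
    constructor <;> intro i j
    · have := congrFun (congrFun h1 i) j
      simpa [Matrix.mul_apply, Matrix.one_apply] using this
    · have := congrFun (congrFun h2 i) j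
      simpa [Matrix.mul_apply, Matrix.one_apply] using this

theorem isUniversalFor_orthogonal : IsUniversalFor (orthogonal N) fun _ _ u =>
    IsOrthogonal u ∧ EntrySignCommute (fun _ _ => 1) u := by
  refine isUniversalFor_classical _ (orthogonality N ∪ commutators (Fin N × Fin N))
    Set.subset_union_right _ ?_ ?_ ?_
  · intro y y' h
    exact Subtype.ext (Matrix.ext fun i j => h (i, j))
  · intro D _ d
    rw [forall_mem_orthogonality, forall_mem_commutators, entrySignCommute_one_iff]
  · intro c
    rw [isOrthogonal_ofReal]
    constructor
    · rintro ⟨h, -⟩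
      exact ⟨⟨_, h⟩, fun i => rfl⟩
    · rintro ⟨y, hy⟩
      refine ⟨?_, entrySignCommute_one fun i j => mul_comm _ _⟩
      have : (Matrix.of fun i j => c (i, j)) = y.1 := Matrix.ext fun i j => (hy (i, j)).symm
      rw [this]
      exact y.2

/-- For real scalars, cubicity leaves at most one nonzero entry on each line, and orthogonality
makes exactly one, of square 1. -/
theorem mem_signedPermutationMatrices_iff (c : Fin N × Fin N → ℝ) :
    (Matrix.of fun i j => c (i, j)) ∈ signedPermutationMatrices N ↔
      IsOrthogonal (fun a => (c a : ℂ)) ∧ IsCubic (fun a => (c a : ℂ)) := by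
  constructor
  · rintro ⟨σ, e, h⟩
    have hc : ∀ i j, c (i, j) = if i = σ j then ((e j : ℤ) : ℝ) else 0 := fun i j =>
      congrFun (congrFun h i) j
    have he : ∀ j, ((e j : ℤ) : ℝ) * ((e j : ℤ) : ℝ) = 1 := fun j => by
      rcases Int.units_eq_one_or (e j) with h | h <;> simp [h]
    refine ⟨(isOrthogonal_ofReal c).2 ?_, fun i j a hij => ?_, fun i a b hab => ?_⟩
    · rw [Matrix.mem_orthogonalGroup_iff']
      ext i j
      simp only [Matrix.mul_apply, Matrix.of_apply, hc, Matrix.one_apply]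
      rw [Finset.sum_eq_single (σ i)]
      · by_cases hij : i = j
        · subst hij; simp [he]
        · simp [hij]
      · intro b _ hb; simp [hb]
      · simp
    · beta_reduce
      rw [hc, hc]
      by_cases h1 : i = σ a
      · simp [show j ≠ σ a from fun h2 => hij (h1.trans h2.symm)]
      · simp [h1]
    · beta_reduce
      rw [hc, hc]
      by_cases h1 : i = σ a
      · simp [show i ≠ σ b from fun h2 => hab (σ.injective (h1.symm.trans h2))]
      · simp [h1]
  · rintro ⟨ho, h1, h2⟩
    have h1' : ∀ i j a, i ≠ j → c (i, a) * c (j, a) = 0 := fun i j a h => by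
      have := h1 i j a h
      beta_reduce at this
      exact_mod_cast this
    have h2' : ∀ i a b, a ≠ b → c (i, a) * c (i, b) = 0 := fun i j a h => by
      have := h2 i j a h
      beta_reduce at this
      exact_mod_cast this
    have hcol : ∀ j, ∑ k, c (k, j) * c (k, j) = 1 := fun j => by
      have := ho.2 j j
      rw [if_pos rfl] at this
      beta_reduce at this
      exact_mod_cast this
    have hex : ∀ j, ∃ i, c (i, j) ≠ 0 := fun j => by
      by_contra! h
      have := hcol j
      simp [h] at this
    choose s hs using hex
    have hinj : Function.Injective s := fun a b hab => by
      by_contra hne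
      have := h2' (s a) a b hne
      rw [mul_eq_zero] at this
      rcases this with h | h
      · exact hs a h
      · rw [hab] at h; exact hs b h
    have hz : ∀ i j, i ≠ s j → c (i, j) = 0 := fun i j hij => by
      have := h1' i (s j) j hij
      exact (mul_eq_zero.1 this).resolve_right (hs j)
    have hone : ∀ j, c (s j, j) = 1 ∨ c (s j, j) = -1 := fun j => by
      have := hcol j
      rw [Finset.sum_eq_single (s j) (fun b _ hb => by rw [hz b j hb, zero_mul]) (by simp)] at this
      exact mul_self_eq_one_iff.1 this
    refine ⟨Equiv.ofBijective s (Finite.injective_iff_bijective.1 hinj),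
      fun j => if c (s j, j) = 1 then 1 else -1, Matrix.ext fun i j => ?_⟩
    simp only [Matrix.of_apply, Equiv.ofBijective_apply]
    by_cases hij : i = s j
    · subst hij
      rcases hone j with h | h
      · simp [h]
      · rw [h]; norm_num
    · rw [hz i j hij, if_neg hij]

theorem isUniversalFor_hyperoctahedral : IsUniversalFor (hyperoctahedral N) fun _ _ u =>
    IsOrthogonal u ∧ EntrySignCommute (fun _ _ => 1) u ∧ IsCubic u := by
  refine isUniversalFor_classical _
    (orthogonality N ∪ (commutators (Fin N × Fin N) ∪ cubicRelations N))
    (Set.subset_union_left.trans Set.subset_union_right) _ ?_ ?_ ?_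
  · intro y y' h
    exact Subtype.ext (Matrix.ext fun i j => h (i, j))
  · intro D _ d
    rw [forall_mem_orthogonality]
    simp only [Set.mem_union, or_imp, forall_and]
    rw [forall_mem_commutators, entrySignCommute_one_iff, forall_mem_cubicRelations]
  · intro c
    constructor
    · rintro ⟨h, -, h'⟩
      exact ⟨⟨_, (mem_signedPermutationMatrices_iff c).2 ⟨h, h'⟩⟩, fun i => rfl⟩
    · rintro ⟨y, hy⟩
      have : (Matrix.of fun i j => c (i, j)) = y.1 := Matrix.ext fun i j => (hy (i, j)).symm
      have h := (mem_signedPermutationMatrices_iff c).1 (this ▸ y.2)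
      exact ⟨h.1, entrySignCommute_one fun i j => mul_comm _ _, h.2⟩

end Universal

/-! ## Polarization -/

section Polarization

variable {N : ℕ} {A : Type} [AddCommGroup A] [Module ℂ A]

/-- Normalize `t`. Only real scalars are used, so this covers expressions involving complex
conjugates, such as `z_p conj(z_q) z_r`. -/
theorem eq_zero_of_homogeneous_of_sphere {ι : Type} [Fintype ι] {𝕜 : Type} [RCLike 𝕜] (V : Set ι)
    (k : ℕ) (F : (ι → 𝕜) → A) (hF : ∀ (s : ℝ) t, F (fun i => (s : 𝕜) * t i) = ((s : ℂ) ^ k) • F t)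
    (h : ∀ t : ι → 𝕜, (∀ i ∉ V, t i = 0) → ∑ i, ‖t i‖ ^ 2 = 1 → F t = 0) (t : ι → 𝕜)
    (ht : ∀ i ∉ V, t i = 0) (hne : t ≠ 0) : F t = 0 := by
  set n := ∑ i, ‖t i‖ ^ 2 with hn
  have hpos : 0 < n := by
    obtain ⟨i, hi⟩ := Function.ne_iff.1 hne
    refine Finset.sum_pos' (fun j _ => sq_nonneg _) ⟨i, Finset.mem_univ i, ?_⟩
    have : 0 < ‖t i‖ := norm_pos_iff.2 hi
    positivity
  have hs : 0 < Real.sqrt n := Real.sqrt_pos.2 hpos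
  have h1 := h (fun i => (((Real.sqrt n)⁻¹ : ℝ) : 𝕜) * t i)
    (fun i hi => by rw [ht i hi, mul_zero]) (by
      simp only [norm_mul, mul_pow, ← Finset.mul_sum, ← hn, RCLike.norm_ofReal, sq_abs, inv_pow,
        Real.sq_sqrt hpos.le]
      exact inv_mul_cancel₀ hpos.ne')
  rw [hF] at h1
  refine (smul_eq_zero.1 h1).resolve_left (pow_ne_zero _ ?_)
  exact_mod_cast (inv_pos.2 hs).ne'

theorem quadratic_polarization (V : Set (Fin N)) (m : Fin N → Fin N → A)
    (h : ∀ t : Fin N → ℝ, (∀ i ∉ V, t i = 0) → ∑ i, ‖t i‖ ^ 2 = 1 →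
      ∑ p, ∑ q, ((t p : ℂ) * t q) • m p q = 0) {a b : Fin N} (ha : a ∈ V) (hb : b ∈ V) :
    m a b + m b a = 0 := by
  set F : (Fin N → ℝ) → A := fun t => ∑ p, ∑ q, ((t p : ℂ) * t q) • m p q with hF
  have h0 : ∀ t : Fin N → ℝ, (∀ i ∉ V, t i = 0) → F t = 0 := fun t ht => by
    by_cases hne : t = 0
    · simp [hF, hne]
    · refine eq_zero_of_homogeneous_of_sphere V 2 F (fun s t => ?_) h t ht hne
      simp only [hF, Finset.smul_sum, smul_smul]
      refine Finset.sum_congr rfl fun p _ => Finset.sum_congr rfl fun q _ => ?_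
      congr 1
      simp
      ring
  have key : ∀ x y : Fin N → ℝ, F (fun i => x i + y i) - F x - F y =
      ∑ p, ∑ q, ((x p : ℂ) * y q + (y p : ℂ) * x q) • m p q := fun x y => by
    simp only [hF, ← Finset.sum_sub_distrib, ← sub_smul]
    refine Finset.sum_congr rfl fun p _ => Finset.sum_congr rfl fun q _ => ?_
    congr 1
    push_cast
    ring
  have hx : ∀ c ∈ V, ∀ i ∉ V, (Pi.single c 1 : Fin N → ℝ) i = 0 := fun c hc i hi =>
    by
    rw [Pi.single_apply, if_neg]
    rintro rfl
    exact hi hc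
  have h1 := key (Pi.single a 1) (Pi.single b 1)
  rw [h0 _ (hx a ha), h0 _ (hx b hb), h0 _ fun i hi => by rw [hx a ha i hi, hx b hb i hi, add_zero],
    sub_zero, sub_zero] at h1
  simp only [add_smul, Finset.sum_add_distrib] at h1
  simpa [Pi.single_apply, apply_ite Complex.ofReal, ite_smul, ite_mul] using h1.symm

/-- The odd part of `F (x + y)` in `y` consists of the terms linear in `y` and of `F y`; evaluate
the former at basis vectors. The vectors used stay supported on `V`, which is needed for polygonal
spheres. -/
theorem cubic_polarization (V : Set (Fin N)) (m : Fin N → Fin N → Fin N → A)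
    (h : ∀ t : Fin N → ℝ, (∀ i ∉ V, t i = 0) → ∑ i, ‖t i‖ ^ 2 = 1 →
      ∑ p, ∑ q, ∑ r, ((t p : ℂ) * t q * t r) • m p q r = 0) {a b : Fin N} (ha : a ∈ V)
    (hb : b ∈ V) : m a a b + m a b a + m b a a = 0 := by
  set F : (Fin N → ℝ) → A := fun t => ∑ p, ∑ q, ∑ r, ((t p : ℂ) * t q * t r) • m p q r with hF
  have h0 : ∀ t : Fin N → ℝ, (∀ i ∉ V, t i = 0) → F t = 0 := fun t ht => by
    by_cases hne : t = 0
    · simp [hF, hne]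
    · refine eq_zero_of_homogeneous_of_sphere V 3 F (fun s t => ?_) h t ht hne
      simp only [hF, Finset.smul_sum, smul_smul]
      refine Finset.sum_congr rfl fun p _ => Finset.sum_congr rfl fun q _ =>
        Finset.sum_congr rfl fun r _ => ?_
      congr 1
      simp
      ring
  have key : ∀ x y : Fin N → ℝ, F (fun i => x i + y i) - F (fun i => x i - y i) -
      (2 : ℂ) • F y = (2 : ℂ) • ∑ p, ∑ q, ∑ r,
        ((x p : ℂ) * x q * y r + (x p : ℂ) * y q * x r + (y p : ℂ) * x q * x r) • m p q r :=
    fun x y => by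
      simp only [hF, Finset.smul_sum, smul_smul, ← Finset.sum_sub_distrib, ← sub_smul]
      refine Finset.sum_congr rfl fun p _ => Finset.sum_congr rfl fun q _ =>
        Finset.sum_congr rfl fun r _ => ?_
      congr 1
      push_cast
      ring
  have hx : ∀ c ∈ V, ∀ i ∉ V, (Pi.single c 1 : Fin N → ℝ) i = 0 := fun c hc i hi =>
    by
    rw [Pi.single_apply, if_neg]
    rintro rfl
    exact hi hc
  have h1 := key (Pi.single a 1) (Pi.single b 1)
  rw [h0 _ (hx b hb), h0 _ fun i hi => by rw [hx a ha i hi, hx b hb i hi, add_zero],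
    h0 _ fun i hi => by rw [hx a ha i hi, hx b hb i hi, sub_zero], smul_zero,
    sub_zero, sub_zero] at h1
  have h2 := (smul_eq_zero.1 h1.symm).resolve_left two_ne_zero
  simp only [add_smul, Finset.sum_add_distrib] at h2
  simpa [Pi.single_apply, apply_ite Complex.ofReal, ite_smul, ite_mul] using h2

/-- Complex parameters separate the conjugated middle slot from the two outer slots, so that
symmetrization only takes place between the latter. -/
theorem half_polarization (V : Set (Fin N)) (m : Fin N → Fin N → Fin N → A)
    (h : ∀ z : Fin N → ℂ, (∀ i ∉ V, z i = 0) → ∑ i, ‖z i‖ ^ 2 = 1 →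
      ∑ p, ∑ q, ∑ r, (z p * star (z q) * z r) • m p q r = 0) {a b c : Fin N} (ha : a ∈ V)
    (hb : b ∈ V) (hc : c ∈ V) : m a b c + m c b a = 0 := by
  set F : (Fin N → ℂ) → A := fun z => ∑ p, ∑ q, ∑ r, (z p * star (z q) * z r) • m p q r with hF
  have h0 : ∀ z : Fin N → ℂ, (∀ i ∉ V, z i = 0) → F z = 0 := fun z hz => by
    by_cases hne : z = 0
    · simp [hF, hne]
    · refine eq_zero_of_homogeneous_of_sphere V 3 F (fun s t => ?_) h z hz hne
      simp only [hF, Finset.smul_sum, smul_smul]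
      refine Finset.sum_congr rfl fun p _ => Finset.sum_congr rfl fun q _ =>
        Finset.sum_congr rfl fun r _ => ?_
      congr 1
      simp
      ring
  set G : (Fin N → ℂ) → (Fin N → ℂ) → A :=
    fun x y => ∑ p, ∑ q, ∑ r, (x p * star (y q) * x r) • m p q r with hG
  -- This is the sum of `ω F(x + ω y)` over the fourth roots of unity `ω`: it retains exactly the
  -- terms of weight `conj ω`, those where `y` occupies the middle slot only.
  have key : ∀ x y : Fin N → ℂ, (4 : ℂ) • G x y =
      F (fun i => x i + y i) - F (fun i => x i - y i) +
      Complex.I • F (fun i => x i + Complex.I * y i) -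
      Complex.I • F (fun i => x i - Complex.I * y i) := fun x y => by
    simp only [hF, hG, Finset.smul_sum, smul_smul, ← Finset.sum_sub_distrib, ← sub_smul,
      ← Finset.sum_add_distrib, ← add_smul]
    refine Finset.sum_congr rfl fun p _ => Finset.sum_congr rfl fun q _ =>
      Finset.sum_congr rfl fun r _ => ?_
    congr 1
    simp only [star_add, star_sub, star_mul', Complex.star_def, Complex.conj_I]
    have hI := Complex.I_mul_I
    linear_combination (2 * (x p * (starRingEnd ℂ) (y q) * x r)
      - 2 * (x p * (starRingEnd ℂ) (x q) * y r + y p * (starRingEnd ℂ) (x q) * x r)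
      + 2 * (Complex.I * Complex.I - 1) * (y p * (starRingEnd ℂ) (y q) * y r)) * hI
  have hG0 : ∀ x y : Fin N → ℂ, (∀ i ∉ V, x i = 0) → (∀ i ∉ V, y i = 0) → G x y = 0 :=
    fun x y hx hy => by
      have h1 := key x y
      rw [h0 _ fun i hi => by rw [hx i hi, hy i hi, add_zero],
        h0 _ fun i hi => by rw [hx i hi, hy i hi, sub_zero],
        h0 _ fun i hi => by rw [hx i hi, hy i hi, mul_zero, add_zero],
        h0 _ fun i hi => by rw [hx i hi, hy i hi, mul_zero, sub_zero]] at h1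
      simp only [smul_zero, sub_zero, add_zero] at h1
      exact (smul_eq_zero.1 h1).resolve_left (by norm_num)
  have hx : ∀ c ∈ V, ∀ i ∉ V, (Pi.single c 1 : Fin N → ℂ) i = 0 := fun c hc i hi =>
    by
    rw [Pi.single_apply, if_neg]
    rintro rfl
    exact hi hc
  -- `G` is quadratic in its first variable and is polarized there.
  have key2 : ∀ x y w : Fin N → ℂ, G (fun i => x i + w i) y - G x y - G w y =
      ∑ p, ∑ q, ∑ r, (x p * star (y q) * w r + w p * star (y q) * x r) • m p q r := fun x y w => by
    simp only [hG, ← Finset.sum_sub_distrib, ← sub_smul]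
    refine Finset.sum_congr rfl fun p _ => Finset.sum_congr rfl fun q _ =>
      Finset.sum_congr rfl fun r _ => ?_
    congr 1
    ring
  have h2 := key2 (Pi.single a 1) (Pi.single b 1) (Pi.single c 1)
  rw [hG0 _ _ (hx a ha) (hx b hb), hG0 _ _ (hx c hc) (hx b hb),
    hG0 _ _ (fun i hi => by rw [hx a ha i hi, hx c hc i hi, add_zero]) (hx b hb),
    sub_zero, sub_zero] at h2
  simp only [add_smul, Finset.sum_add_distrib] at h2
  simpa [Pi.single_apply, apply_ite (starRingEnd ℂ), ite_smul, ite_mul] using h2.symm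

end Polarization

/-! ## Matrix models -/

section Models

variable {N : ℕ}

open scoped Matrix.Norms.L2Operator

/-- Self-adjoint unitary matrices which commute, up to the signs `η`, for the indices in `V`. -/
structure IsSignModel (η : Fin N → Fin N → ℂ) (V : Set (Fin N))
    (g : Fin N → Matrix (Fin 2) (Fin 2) ℂ) : Prop where
  star (p : Fin N) : star (g p) = g p
  sq (p : Fin N) : g p * g p = 1
  comm (p q : Fin N) : p ∈ V → q ∈ V → g p * g q = η p q • (g q * g p)

theorem isSignModel_one (V : Set (Fin N)) : IsSignModel (fun _ _ => 1) V fun _ => 1 :=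
  ⟨fun _ => star_one _, fun _ => one_mul _, fun _ _ _ _ => by rw [one_smul]⟩

/-- Any three indices admit a model of the signs. -/
def HasSignModels (η : Fin N → Fin N → ℂ) : Prop := ∀ a b c, ∃ g, IsSignModel η {a, b, c} g

theorem hasSignModels_one : HasSignModels fun _ _ : Fin N => (1 : ℂ) := fun _ _ _ =>
  ⟨_, isSignModel_one _⟩

/-- The three Pauli matrices anticommute pairwise. Three are enough because each relation to be
derived involves at most three columns, and the model may depend on them. -/
theorem hasSignModels_twistSign : HasSignModels (twistSign (N := N)) := fun a b c => by
  refine ⟨fun p => if p = a then !![0, 1; 1, 0] else if p = b then !![0, -Complex.I; Complex.I, 0]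
    else !![1, 0; 0, -1], fun p => ?_, fun p => ?_, fun p q hp hq => ?_⟩
  · split_ifs <;> (ext i j; fin_cases i <;> fin_cases j <;> simp [Matrix.star_apply])
  · split_ifs <;> (ext i j; fin_cases i <;> fin_cases j <;> simp)
  · by_cases hpq : p = q
    · subst hpq; simp [twistSign]
    · rw [twistSign, if_neg hpq]
      by_cases h1 : p = a
      · subst h1
        by_cases h2 : q = b
        · subst h2
          ext i j; fin_cases i <;> fin_cases j <;> simp [Ne.symm hpq]
        · ext i j; fin_cases i <;> fin_cases j <;> simp [Ne.symm hpq, h2]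
      by_cases h2 : p = b
      · subst h2
        by_cases h3 : q = a
        · subst h3
          ext i j; fin_cases i <;> fin_cases j <;> simp [hpq]
        · ext i j; fin_cases i <;> fin_cases j <;> simp [h1, h3, Ne.symm hpq]
      · by_cases h3 : q = a
        · subst h3
          ext i j; fin_cases i <;> fin_cases j <;> simp [h1, h2]
        by_cases h4 : q = b
        · subst h4
          ext i j; fin_cases i <;> fin_cases j <;> simp [h1, h2, h3]
        -- Neither index is `a` or `b`, so both equal `c`, against `hpq`.
        · simp only [Set.mem_insert_iff, Set.mem_singleton_iff, h1, h2, h3, h4, false_or] at hp hq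
          exact absurd (hp.trans hq.symm) hpq

variable {η : Fin N → Fin N → ℂ} {V : Set (Fin N)} {g : Fin N → Matrix (Fin 2) (Fin 2) ℂ}

theorem IsSignModel.mono (hg : IsSignModel η V g) {W : Set (Fin N)} (h : W ⊆ V) :
    IsSignModel η W g :=
  ⟨hg.star, hg.sq, fun p q hp hq => hg.comm p q (h hp) (h hq)⟩

/-- The real model: `x_p = t_p g_p`. -/
def realModel (g : Fin N → Matrix (Fin 2) (Fin 2) ℂ) (t : Fin N → ℝ) (p : Fin N) :
    Matrix (Fin 2) (Fin 2) ℂ := (t p : ℂ) • g p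

/-- The complex model: antidiagonal matrices with entries `z_p g_p` and `conj z_p g_p`. -/
def complexModel (g : Fin N → Matrix (Fin 2) (Fin 2) ℂ) (z : Fin N → ℂ) (p : Fin N) :
    Matrix (Fin 2 ⊕ Fin 2) (Fin 2 ⊕ Fin 2) ℂ :=
  Matrix.fromBlocks 0 (z p • g p) (star (z p) • g p) 0

theorem IsSignModel.star_realModel (hg : IsSignModel η V g) (t : Fin N → ℝ) (p : Fin N) :
    Star.star (realModel g t p) = realModel g t p := by
  rw [realModel, star_smul, hg.star, Complex.star_def, Complex.conj_ofReal]

theorem IsSignModel.onSphere_realModel (hg : IsSignModel η V g) {t : Fin N → ℝ}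
    (ht : ∑ i, ‖t i‖ ^ 2 = 1) : OnSphere (realModel g t) := by
  unfold OnSphere realModel
  simp only [smul_mul_smul_comm, hg.sq, ← Finset.sum_smul]
  have : ∑ i, (t i : ℂ) * t i = 1 := by
    rw [← Complex.ofReal_one, ← ht]
    simp [pow_two]
  rw [this, one_smul]

theorem IsSignModel.signCommute_realModel (hg : IsSignModel η V g) {t : Fin N → ℝ}
    (ht : ∀ i ∉ V, t i = 0) : SignCommute η (realModel g t) := by
  intro i j
  unfold realModel
  by_cases hi : i ∈ V
  · by_cases hj : j ∈ V
    · rw [smul_mul_smul_comm, smul_mul_smul_comm, hg.comm i j hi hj, smul_smul, smul_smul]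
      congr 1
      ring
    · simp [ht j hj]
  · simp [ht i hi]

/-- Pigeonhole. It makes the models with two nonzero coordinates available on the polygonal spheres.
-/
theorem tripleZero_of_support {D : Type} [Ring D] {a b : Fin N} {x : Fin N → D}
    (hx : ∀ i ∉ ({a, b} : Set (Fin N)), x i = 0) : TripleZero x := by
  intro i j k hij hik hjk
  have h : i ∉ ({a, b} : Set (Fin N)) ∨ j ∉ ({a, b} : Set (Fin N)) ∨
      k ∉ ({a, b} : Set (Fin N)) := by
    by_contra! h
    simp only [Set.mem_insert_iff, Set.mem_singleton_iff] at h
    grind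
  rcases h with h | h | h <;> simp [hx _ h]

theorem IsSignModel.star_complexModel (hg : IsSignModel η V g) (z : Fin N → ℂ) (p : Fin N) :
    Star.star (complexModel g z p) = complexModel g z p := by
  have := hg.star p
  rw [Matrix.star_eq_conjTranspose] at this
  rw [complexModel, Matrix.star_eq_conjTranspose, Matrix.fromBlocks_conjTranspose,
    Matrix.conjTranspose_smul, Matrix.conjTranspose_smul, this, star_star]
  simp

theorem complexModel_mul (g : Fin N → Matrix (Fin 2) (Fin 2) ℂ) (z : Fin N → ℂ) (p q : Fin N) :
    complexModel g z p * complexModel g z q =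
      Matrix.fromBlocks ((z p * star (z q)) • (g p * g q)) 0 0 ((star (z p) * z q) • (g p * g q)) := by
  simp [complexModel, Matrix.fromBlocks_multiply, smul_smul, mul_comm]

theorem complexModel_mul_mul (g : Fin N → Matrix (Fin 2) (Fin 2) ℂ) (z : Fin N → ℂ)
    (p q r : Fin N) : complexModel g z p * complexModel g z q * complexModel g z r =
      Matrix.fromBlocks 0 ((z p * star (z q) * z r) • (g p * g q * g r))
        ((star (z p) * z q * star (z r)) • (g p * g q * g r)) 0 := by
  rw [complexModel_mul, complexModel, Matrix.fromBlocks_multiply]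
  simp only [smul_mul_smul_comm, Matrix.zero_mul, Matrix.mul_zero, add_zero, zero_add]

theorem IsSignModel.triple (hg : IsSignModel η V g) {p q r : Fin N}
    (hp : p ∈ V) (hq : q ∈ V) (hr : r ∈ V) :
    g p * g q * g r = tripleSign η p q r • (g r * g q * g p) := by
  rw [hg.comm p q hp hq, smul_mul_assoc, mul_assoc, hg.comm p r hp hr, mul_smul_comm, ← mul_assoc,
    hg.comm q r hq hr, smul_mul_assoc, smul_smul, smul_smul, tripleSign]
  congr 1
  ring

theorem IsSignModel.onSphere_complexModel (hg : IsSignModel η V g) {z : Fin N → ℂ}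
    (hz : ∑ i, ‖z i‖ ^ 2 = 1) : OnSphere (complexModel g z) := by
  unfold OnSphere
  have h : ∀ i, complexModel g z i * complexModel g z i = ((‖z i‖ ^ 2 : ℝ) : ℂ) • 1 := fun i => by
    have h1 : z i * Star.star (z i) = ((‖z i‖ ^ 2 : ℝ) : ℂ) := by
      rw [Complex.star_def, Complex.mul_conj, Complex.normSq_eq_norm_sq]
    rw [complexModel_mul, hg.sq, mul_comm (Star.star (z i)), h1, ← Matrix.fromBlocks_one,
      Matrix.fromBlocks_smul]
    simp
  simp only [h, ← Finset.sum_smul, ← Complex.ofReal_sum, hz]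
  simp

theorem IsSignModel.signHalfCommute_complexModel (hg : IsSignModel η V g)
    {z : Fin N → ℂ} (hz : ∀ i ∉ V, z i = 0) : SignHalfCommute η (complexModel g z) := by
  intro i j k
  rw [complexModel_mul_mul, complexModel_mul_mul, Matrix.fromBlocks_smul]
  by_cases hi : i ∈ V
  · by_cases hj : j ∈ V
    · by_cases hk : k ∈ V
      · rw [hg.triple hi hj hk]
        simp only [smul_smul, smul_zero]
        congr 2 <;> ring
      · simp [hz k hk]
    · simp [hz j hj]
  · simp [hz i hi]

theorem IsSignModel.isUnit (hg : IsSignModel η V g) (p : Fin N) : IsUnit (g p) :=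
  IsUnit.of_mul_eq_one _ (hg.sq p)

theorem eq_zero_of_entries_smul {A : Type} [AddCommGroup A] [Module ℂ A]
    {M : Matrix (Fin 2) (Fin 2) ℂ} (hM : IsUnit M) {m : A} (h : ∀ s t, M s t • m = 0) : m = 0 := by
  by_contra hm
  refine hM.ne_zero (Matrix.ext fun s t => ?_)
  exact (smul_eq_zero.1 (h s t)).resolve_right hm

end Models

/-! ## Relations forced by an affine action -/

section Actions

variable {N : ℕ} {H : NCSpace (Fin N × Fin N)} {X : NCSpace (Fin N)}

open scoped Matrix.Norms.L2Operator

theorem tmul_sub_smul {A B : Type} [CStarAlgebra A] [CStarAlgebra B] (a a' : A) (b : B) (c : ℂ) :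
    SpatialTensor.tmul (a - c • a') b =
      SpatialTensor.tmul a b - c • SpatialTensor.tmul a' b := by
  rw [SpatialTensor.tmul_eq, TensorProduct.sub_tmul, map_sub, ← TensorProduct.smul_tmul', map_smul,
    SpatialTensor.tmul_eq, SpatialTensor.tmul_eq]

/-- Apply `Φ` to both sides of the relation, expand, and slice by a coefficient of `ρ`. The scalar
`c` may be 0, which covers relations of the form `x_i x_j = 0`. -/
theorem quadratic_slice {Φ : X.Alg →⋆ₐ[ℂ] SpatialTensor H.Alg X.Alg}
    (hΦ : ∀ i, Φ (X.coord i) = ∑ j, SpatialTensor.tmul (H.coord (i, j)) (X.coord j))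
    {i j : Fin N} {c : ℂ} (hrel : X.coord i * X.coord j = c • (X.coord j * X.coord i))
    {n : Type} [Fintype n] [DecidableEq n] (ρ : X.Alg →⋆ₐ[ℂ] Matrix n n ℂ) (s t : n) :
    ∑ p, ∑ q, (ρ (X.coord p) * ρ (X.coord q)) s t •
      (H.coord (i, p) * H.coord (j, q) - c • (H.coord (j, p) * H.coord (i, q))) = 0 := by
  have h0 : ∀ i j, Φ (X.coord i * X.coord j) = ∑ k : Fin N × Fin N,
      SpatialTensor.tmul (H.coord (i, k.1) * H.coord (j, k.2)) (X.coord k.1 * X.coord k.2) :=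
    fun i j => by
      rw [map_mul, hΦ, hΦ, Finset.sum_mul_sum, Fintype.sum_prod_type]
      simp only [SpatialTensor.tmul_mul_tmul]
  have h1 : ∑ k : Fin N × Fin N, SpatialTensor.tmul (H.coord (i, k.1) * H.coord (j, k.2) -
      c • (H.coord (j, k.1) * H.coord (i, k.2))) (X.coord k.1 * X.coord k.2) = 0 := by
    simp only [tmul_sub_smul, Finset.sum_sub_distrib, ← Finset.smul_sum]
    rw [← h0, ← h0, hrel, map_smul, sub_self]
  have h2 := SpatialTensor.sum_matrix_smul_eq_zero _ _ _ h1 ρ s t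
  rw [Fintype.sum_prod_type] at h2
  simpa only [map_mul] using h2

theorem cubic_slice {Φ : X.Alg →⋆ₐ[ℂ] SpatialTensor H.Alg X.Alg}
    (hΦ : ∀ i, Φ (X.coord i) = ∑ j, SpatialTensor.tmul (H.coord (i, j)) (X.coord j))
    {i j k : Fin N} {c : ℂ}
    (hrel : X.coord i * X.coord j * X.coord k = c • (X.coord k * X.coord j * X.coord i))
    {n : Type} [Fintype n] [DecidableEq n] (ρ : X.Alg →⋆ₐ[ℂ] Matrix n n ℂ) (s t : n) :
    ∑ p, ∑ q, ∑ r, (ρ (X.coord p) * ρ (X.coord q) * ρ (X.coord r)) s t •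
      (H.coord (i, p) * H.coord (j, q) * H.coord (k, r) -
        c • (H.coord (k, p) * H.coord (j, q) * H.coord (i, r))) = 0 := by
  have h0 : ∀ i j k, Φ (X.coord i * X.coord j * X.coord k) = ∑ l : Fin N × Fin N × Fin N,
      SpatialTensor.tmul (H.coord (i, l.1) * H.coord (j, l.2.1) * H.coord (k, l.2.2))
        (X.coord l.1 * X.coord l.2.1 * X.coord l.2.2) :=
    fun i j k => by
      rw [map_mul, map_mul, hΦ, hΦ, hΦ, Finset.sum_mul_sum, Finset.sum_mul, Fintype.sum_prod_type]
      refine Finset.sum_congr rfl fun p _ => ?_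
      rw [Finset.sum_mul, Fintype.sum_prod_type]
      refine Finset.sum_congr rfl fun q _ => ?_
      rw [Finset.mul_sum]
      simp only [SpatialTensor.tmul_mul_tmul]
  have h1 : ∑ l : Fin N × Fin N × Fin N, SpatialTensor.tmul
      (H.coord (i, l.1) * H.coord (j, l.2.1) * H.coord (k, l.2.2) -
        c • (H.coord (k, l.1) * H.coord (j, l.2.1) * H.coord (i, l.2.2)))
      (X.coord l.1 * X.coord l.2.1 * X.coord l.2.2) = 0 := by
    simp only [tmul_sub_smul, Finset.sum_sub_distrib, ← Finset.smul_sum]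
    rw [← h0, ← h0, hrel, map_smul, sub_self]
  have h2 := SpatialTensor.sum_matrix_smul_eq_zero _ _ _ h1 ρ s t
  simp only [Fintype.sum_prod_type] at h2
  simpa only [map_mul] using h2

variable {R : ∀ (D : Type) [CStarAlgebra D], (Fin N → D) → Prop} {η : Fin N → Fin N → ℂ}
  {V : Set (Fin N)} {g : Fin N → Matrix (Fin 2) (Fin 2) ℂ}

/-- The quadratic relations forced by an action on a space with real models. -/
theorem quadratic_relation (hX : IsUniversalFor X fun D _ x => OnSphere x ∧ R D x)
    (hact : ActsAffinely H X) (hη : IsSignMatrix η) (hg : IsSignModel η V g)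
    (hR : ∀ t : Fin N → ℝ, (∀ i ∉ V, t i = 0) → R (Matrix (Fin 2) (Fin 2) ℂ) (realModel g t))
    {i j : Fin N} {c : ℂ} (hrel : X.coord i * X.coord j = c • (X.coord j * X.coord i))
    {a b : Fin N} (ha : a ∈ V) (hb : b ∈ V) :
    (H.coord (i, a) * H.coord (j, b) - c • (H.coord (j, a) * H.coord (i, b))) +
      η a b • (H.coord (i, b) * H.coord (j, a) - c • (H.coord (j, b) * H.coord (i, a))) = 0 := by
  obtain ⟨Φ, hΦ⟩ := hact
  -- Polarization gives the entries of `g_a g_b` and `g_b g_a = η g_a g_b` as coefficients. The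
  -- invertible matrix `g_a g_b` has a nonzero entry, which can be divided out.
  refine eq_zero_of_entries_smul ((hg.isUnit a).mul (hg.isUnit b)) fun s t => ?_
  have h1 := quadratic_polarization V (fun p q => (g p * g q) s t •
    (H.coord (i, p) * H.coord (j, q) - c • (H.coord (j, p) * H.coord (i, q))))
    (fun τ hτ hτ1 => by
      obtain ⟨ρ, hρ⟩ := hX.lift _ (realModel g τ) (hg.star_realModel τ)
        ⟨hg.onSphere_realModel hτ1, hR τ hτ⟩
      have := quadratic_slice hΦ hrel ρ s t
      simpa only [hρ, realModel, smul_mul_smul_comm, Matrix.smul_apply, smul_smul, smul_eq_mul]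
        using this) ha hb
  rw [hg.comm b a hb ha, hη.symm b a] at h1
  rw [smul_add, smul_smul, mul_comm _ (η a b)]
  simpa only [Matrix.smul_apply, smul_eq_mul] using h1

/-- The relations forced by the vanishing of a cubic monomial, on a space with real models. -/
theorem cubic_relation (hX : IsUniversalFor X fun D _ x => OnSphere x ∧ R D x)
    (hact : ActsAffinely H X) (hg : IsSignModel η V g)
    (hR : ∀ t : Fin N → ℝ, (∀ i ∉ V, t i = 0) → R (Matrix (Fin 2) (Fin 2) ℂ) (realModel g t))
    {i j k : Fin N} (hrel : X.coord i * X.coord j * X.coord k = 0)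
    {a b : Fin N} (ha : a ∈ V) (hb : b ∈ V) :
    H.coord (i, a) * H.coord (j, a) * H.coord (k, b) +
      η a b • (H.coord (i, a) * H.coord (j, b) * H.coord (k, a)) +
      H.coord (i, b) * H.coord (j, a) * H.coord (k, a) = 0 := by
  obtain ⟨Φ, hΦ⟩ := hact
  refine eq_zero_of_entries_smul (hg.isUnit b) fun s t => ?_
  have h1 := cubic_polarization V (fun p q r => (g p * g q * g r) s t •
    (H.coord (i, p) * H.coord (j, q) * H.coord (k, r)))
    (fun τ hτ hτ1 => by
      obtain ⟨ρ, hρ⟩ := hX.lift _ (realModel g τ) (hg.star_realModel τ)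
        ⟨hg.onSphere_realModel hτ1, hR τ hτ⟩
      -- The vanishing of the monomial is encoded as equality with 0 times the reversed monomial.
      have := cubic_slice (c := 0) hΦ (hrel.trans (zero_smul ℂ _).symm) ρ s t
      simpa only [hρ, realModel, smul_mul_smul_comm, Matrix.smul_apply, smul_smul, smul_eq_mul,
        zero_smul, sub_zero] using this) ha hb
  -- The three words in `g_a, g_a, g_b` reduce to `g_b`, `η g_b`, `g_b`.
  rw [hg.comm a b ha hb, smul_mul_assoc, mul_assoc (g b), hg.sq a, one_mul, mul_one] at h1
  rw [smul_add, smul_add, smul_smul, mul_comm _ (η a b)]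
  simpa only [Matrix.smul_apply, smul_eq_mul] using h1

/-- The cubic relations forced by an action on a space with complex models. -/
theorem half_relation (hX : IsUniversalFor X fun D _ x => OnSphere x ∧ R D x)
    (hact : ActsAffinely H X) (hη : IsSignMatrix η) (hg : IsSignModel η V g)
    (hR : ∀ z : Fin N → ℂ, (∀ i ∉ V, z i = 0) →
      R (Matrix (Fin 2 ⊕ Fin 2) (Fin 2 ⊕ Fin 2) ℂ) (complexModel g z))
    {i j k : Fin N} {e : ℂ}
    (hrel : X.coord i * X.coord j * X.coord k = e • (X.coord k * X.coord j * X.coord i))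
    {a b c : Fin N} (ha : a ∈ V) (hb : b ∈ V) (hc : c ∈ V) :
    (H.coord (i, a) * H.coord (j, b) * H.coord (k, c) -
        e • (H.coord (k, a) * H.coord (j, b) * H.coord (i, c))) +
      tripleSign η a b c • (H.coord (i, c) * H.coord (j, b) * H.coord (k, a) -
        e • (H.coord (k, c) * H.coord (j, b) * H.coord (i, a))) = 0 := by
  obtain ⟨Φ, hΦ⟩ := hact
  refine eq_zero_of_entries_smul (((hg.isUnit a).mul (hg.isUnit b)).mul (hg.isUnit c))
    fun s t => ?_
  have h1 := half_polarization V (fun p q r => (g p * g q * g r) s t •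
    (H.coord (i, p) * H.coord (j, q) * H.coord (k, r) -
        e • (H.coord (k, p) * H.coord (j, q) * H.coord (i, r))))
    (fun z hz hz1 => by
      obtain ⟨ρ, hρ⟩ := hX.lift _ (complexModel g z) (hg.star_complexModel z)
        ⟨hg.onSphere_complexModel hz1, hR z hz⟩
      -- The upper right block of a product of three models carries `z_p conj(z_q) z_r`, the form
      -- required by `half_polarization`.
      have := cubic_slice hΦ hrel ρ (Sum.inl s) (Sum.inr t)
      simpa only [hρ, complexModel_mul_mul, Matrix.fromBlocks_apply₁₂, Matrix.smul_apply,
        smul_smul, smul_eq_mul] using this) ha hb hc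
  rw [hg.triple hc hb ha, hη.triple_reverse] at h1
  rw [smul_add, smul_smul, mul_comm _ (tripleSign η a b c)]
  simpa only [Matrix.smul_apply, smul_eq_mul] using h1

end Actions

/-! ## Determination of the quantum isometry groups -/

section Antipode

variable {N : ℕ} {H : NCSpace (Fin N × Fin N)}

theorem IsQuantumSubgroup.isOrthogonal (hH : IsQuantumSubgroup H) : IsOrthogonal H.coord :=
  ⟨hH.mul_transpose, hH.transpose_mul⟩

/-- Applying the antipode to a relation between the coordinates. -/
theorem IsQuantumSubgroup.eval_antipode (hH : IsQuantumSubgroup H) {f : NCPoly (Fin N × Fin N)}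
    (hf : NCPoly.eval H.coord f = 0) :
    NCPoly.eval (fun p : Fin N × Fin N => MulOpposite.op (H.coord (p.2, p.1))) f = 0 := by
  obtain ⟨S, hS⟩ := hH.antipode
  -- The antipode is only defined on polynomial functions, so the relation is first moved to that
  -- subalgebra.
  have h1 : NCPoly.eval H.polyCoord f = 0 := by
    apply Subtype.ext
    exact (NCPoly.map_eval H.poly.subtype H.polyCoord f).trans hf
  have h2 := NCPoly.map_eval S H.polyCoord f
  rw [h1, map_zero] at h2
  rw [h2]
  congr 2
  funext p
  exact (hS p.1 p.2).symm

theorem IsQuantumSubgroup.antipode_mul (hH : IsQuantumSubgroup H) {i j a b : Fin N}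
    (h : H.coord (i, a) * H.coord (j, b) = 0) : H.coord (b, j) * H.coord (a, i) = 0 := by
  have := hH.eval_antipode (f := NCPoly.X (i, a) * NCPoly.X (j, b)) (by simpa using h)
  simpa [← MulOpposite.op_mul] using this

theorem IsQuantumSubgroup.antipode_quadratic (hH : IsQuantumSubgroup H) {i j a b : Fin N} {e h : ℂ}
    (hr : (H.coord (i, a) * H.coord (j, b) - e • (H.coord (j, a) * H.coord (i, b))) +
      h • (H.coord (i, b) * H.coord (j, a) - e • (H.coord (j, b) * H.coord (i, a))) = 0) :
    (H.coord (b, j) * H.coord (a, i) - e • (H.coord (b, i) * H.coord (a, j))) +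
      h • (H.coord (a, j) * H.coord (b, i) - e • (H.coord (a, i) * H.coord (b, j))) = 0 := by
  have := hH.eval_antipode (f := (NCPoly.X (i, a) * NCPoly.X (j, b) -
    e • (NCPoly.X (j, a) * NCPoly.X (i, b))) + h • (NCPoly.X (i, b) * NCPoly.X (j, a) -
    e • (NCPoly.X (j, b) * NCPoly.X (i, a)))) (by simpa only [map_add, map_sub, map_smul, map_mul,
      NCPoly.eval_X] using hr)
  simp only [map_add, map_sub, map_smul, map_mul, NCPoly.eval_X] at this
  exact MulOpposite.op_injective this

theorem IsQuantumSubgroup.antipode_cubic (hH : IsQuantumSubgroup H) {i j k a b c : Fin N} {e h : ℂ}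
    (hr : (H.coord (i, a) * H.coord (j, b) * H.coord (k, c) -
        e • (H.coord (k, a) * H.coord (j, b) * H.coord (i, c))) +
      h • (H.coord (i, c) * H.coord (j, b) * H.coord (k, a) -
        e • (H.coord (k, c) * H.coord (j, b) * H.coord (i, a))) = 0) :
    (H.coord (c, k) * H.coord (b, j) * H.coord (a, i) -
        e • (H.coord (c, i) * H.coord (b, j) * H.coord (a, k))) +
      h • (H.coord (a, k) * H.coord (b, j) * H.coord (c, i) -
        e • (H.coord (a, i) * H.coord (b, j) * H.coord (c, k))) = 0 := by
  have := hH.eval_antipode (f := (NCPoly.X (i, a) * NCPoly.X (j, b) * NCPoly.X (k, c) -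
    e • (NCPoly.X (k, a) * NCPoly.X (j, b) * NCPoly.X (i, c))) +
    h • (NCPoly.X (i, c) * NCPoly.X (j, b) * NCPoly.X (k, a) -
    e • (NCPoly.X (k, c) * NCPoly.X (j, b) * NCPoly.X (i, a)))) (by
      simpa only [map_add, map_sub, map_smul, map_mul, NCPoly.eval_X] using hr)
  simp only [map_add, map_sub, map_smul, map_mul, NCPoly.eval_X] at this
  have := congrArg MulOpposite.unop this
  simpa only [MulOpposite.unop_add, MulOpposite.unop_sub, MulOpposite.unop_smul,
    MulOpposite.unop_mul, MulOpposite.unop_op, MulOpposite.unop_zero, mul_assoc] using this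

/-- Here `x` is a monomial in the entries, `w` its reversal, and `y`, `z` are the monomials with
mixed rows and columns. The antipode exchanges the row sign `e` and the column sign `h`, so the
mixed terms cancel in the sum of the two relations. -/
theorem eq_smul_of_antipode_pair {A : Type} [AddCommGroup A] [Module ℂ A] {x y z w : A} {e h : ℂ}
    (h1 : (x - e • z) + h • (y - e • w) = 0) (h2 : (x - h • y) + e • (z - h • w) = 0) :
    x = (e * h) • w := by
  have h3 : (2 : ℂ) • (x - (e * h) • w) = 0 := by
    rw [← add_zero (0 : A)]
    nth_rw 1 [← h1]
    rw [← h2]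
    module
  exact sub_eq_zero.1 ((smul_eq_zero.1 h3).resolve_left two_ne_zero)

theorem IsQuantumSubgroup.entrySignCommute (hH : IsQuantumSubgroup H) {η : Fin N → Fin N → ℂ}
    (hη : IsSignMatrix η) (h : ∀ i j a b,
      (H.coord (i, a) * H.coord (j, b) - η i j • (H.coord (j, a) * H.coord (i, b))) +
      η a b • (H.coord (i, b) * H.coord (j, a) - η i j • (H.coord (j, b) * H.coord (i, a))) = 0) :
    EntrySignCommute η H.coord := by
  intro i j a b
  refine eq_smul_of_antipode_pair (h i j a b) ?_
  have := hH.antipode_quadratic (h b a j i)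
  rwa [hη.symm b a, hη.symm j i] at this

theorem IsQuantumSubgroup.half_of_relation (hH : IsQuantumSubgroup H) {η : Fin N → Fin N → ℂ}
    (hη : IsSignMatrix η) {i j k a b c : Fin N}
    (h : (H.coord (i, a) * H.coord (j, b) * H.coord (k, c) -
        tripleSign η i j k • (H.coord (k, a) * H.coord (j, b) * H.coord (i, c))) +
      tripleSign η a b c • (H.coord (i, c) * H.coord (j, b) * H.coord (k, a) -
        tripleSign η i j k • (H.coord (k, c) * H.coord (j, b) * H.coord (i, a))) = 0)
    (h' : (H.coord (c, k) * H.coord (b, j) * H.coord (a, i) -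
        tripleSign η c b a • (H.coord (a, k) * H.coord (b, j) * H.coord (c, i))) +
      tripleSign η k j i • (H.coord (c, i) * H.coord (b, j) * H.coord (a, k) -
        tripleSign η c b a • (H.coord (a, i) * H.coord (b, j) * H.coord (c, k))) = 0) :
    H.coord (i, a) * H.coord (j, b) * H.coord (k, c) =
      (tripleSign η i j k * tripleSign η a b c) •
        (H.coord (k, c) * H.coord (j, b) * H.coord (i, a)) := by
  refine eq_smul_of_antipode_pair h ?_
  have := hH.antipode_cubic h'
  rwa [hη.triple_reverse a b c, hη.triple_reverse i j k] at this

theorem IsQuantumSubgroup.isCubic (hH : IsQuantumSubgroup H)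
    (h : ∀ i j a, i ≠ j → H.coord (i, a) * H.coord (j, a) = 0) : IsCubic H.coord :=
  ⟨h, fun i _ _ hab => hH.antipode_mul (h _ _ i (Ne.symm hab))⟩

end Antipode

/-! ### Sufficient conditions for a matrix to be cubic. -/

section CubicCriterion

variable {N : ℕ} {D : Type} [CStarAlgebra D] {u : Fin N × Fin N → D}

theorem exists_third_index (hN : 3 ≤ N) (i j : Fin N) : ∃ k : Fin N, k ≠ i ∧ k ≠ j := by
  have h : ({i, j} : Finset (Fin N)).card < (Finset.univ : Finset (Fin N)).card := by
    rw [Finset.card_univ, Fintype.card_fin]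
    exact Finset.card_le_two.trans_lt hN
  obtain ⟨k, -, hk⟩ := Finset.exists_mem_notMem_of_card_lt_card h
  simp only [Finset.mem_insert, Finset.mem_singleton, not_or] at hk
  exact ⟨k, hk⟩

/-- By the C*-identity it suffices to kill `u_y u_x u_x u_y`. Multiplying it on the right by `1 = ∑
b, u_kb²` reduces this to products with the entries of an auxiliary row. -/
theorem mul_eq_zero_of_row (hs : ∀ a, star (u a) = u a) (ho : IsOrthogonal u) {x y : Fin N × Fin N}
    {k : Fin N} (h : ∀ b, u y * u x * u x * u y * u (k, b) = 0) : u x * u y = 0 := by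
  rw [← CStarRing.star_mul_self_eq_zero_iff, star_mul, hs, hs, ← mul_assoc,
    ← mul_one (u y * u x * u x * u y)]
  rw [← (ho.1 k k).trans (if_pos rfl), Finset.mul_sum]
  refine Finset.sum_eq_zero fun b _ => ?_
  rw [← mul_assoc, h, zero_mul]

/-- Up to scalars, `y'` moves to the far left and `y` moves right past both `x`, which exposes `x *
y * z`. -/
theorem mul_eq_zero_of_sign_right {x y y' z : D} {c d e : ℂ} (h1 : x * y' = c • (y' * x))
    (h2 : y * y' = d • (y' * y)) (h3 : y * x = e • (x * y)) (h0 : x * y * z = 0) :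
    y * x * (x * y' * z) = 0 := by
  have e1 (t : D) : x * (y' * t) = c • (y' * (x * t)) := by
    rw [← mul_assoc, h1, smul_mul_assoc, mul_assoc]
  have e2 (t : D) : y * (y' * t) = d • (y' * (y * t)) := by
    rw [← mul_assoc, h2, smul_mul_assoc, mul_assoc]
  have e3 (t : D) : y * (x * t) = e • (x * (y * t)) := by
    rw [← mul_assoc, h3, smul_mul_assoc, mul_assoc]
  rw [mul_assoc] at h0
  simp only [mul_assoc, e1, mul_smul_comm, e2, e3, h0, mul_zero, smul_zero]

theorem mul_eq_zero_of_sign_left {x y x' z : D} {c : ℂ} (h1 : x * x' = c • (x' * x))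
    (h0 : x * y * z = 0) : y * x * (x' * y * z) = 0 :=
  calc y * x * (x' * y * z) = y * ((x * x') * (y * z)) := by simp only [mul_assoc]
    _ = c • ((y * x') * (x * y * z)) := by
        rw [h1]; simp only [smul_mul_assoc, mul_smul_comm, mul_assoc]
    _ = 0 := by rw [h0, mul_zero, smul_zero]

/-- If `u` commutes up to signs and maps vectors with at most two nonzero coordinates to vectors of
the same kind, then it is cubic. -/
theorem EntrySignCommute.mul_eq_zero {η : Fin N → Fin N → ℂ} (hN : 3 ≤ N)
    (hs : ∀ a, star (u a) = u a) (ho : IsOrthogonal u) (hu : EntrySignCommute η u)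
    (h3 : ∀ i j k a b, i ≠ j → i ≠ k → j ≠ k → u (i, a) * u (j, a) * u (k, b) +
      η a b • (u (i, a) * u (j, b) * u (k, a)) + u (i, b) * u (j, a) * u (k, a) = 0)
    (h3' : ∀ i j k a, i ≠ j → i ≠ k → j ≠ k → u (i, a) * u (j, a) * u (k, a) = 0)
    (i j a : Fin N) (hij : i ≠ j) : u (i, a) * u (j, a) = 0 := by
  obtain ⟨k, hki, hkj⟩ := exists_third_index hN i j
  refine mul_eq_zero_of_row hs ho (k := k) fun b => ?_
  have h0 := h3' i j k a hij hki.symm hkj.symm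
  -- After this left multiplication, sign commutation exposes `u_ia u_ja u_ka = 0` in the last two
  -- terms, so the first term vanishes alone.
  have h1 := congrArg (fun t => u (j, a) * u (i, a) * t) (h3 i j k a b hij hki.symm hkj.symm)
  have h2 : u (j, a) * u (i, a) * (u (i, a) * u (j, b) * u (k, a)) = 0 :=
    mul_eq_zero_of_sign_right (hu i j a b) (hu j j a b) (hu j i a a) h0
  have h4 : u (j, a) * u (i, a) * (u (i, b) * u (j, a) * u (k, a)) = 0 :=
    mul_eq_zero_of_sign_left (hu i i a b) h0
  simp only [mul_add, mul_smul_comm, h2, h4, smul_zero, add_zero, mul_zero] at h1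
  simpa only [mul_assoc] using h1

/-- The counterpart of `EntrySignCommute.mul_eq_zero` for half-commutation: triples are reversed, in
rows spanning at most two indices, until the vanishing product `u_ja u_ia u_ka` appears. Only
columns with a repetition enter, as two-coordinate models say nothing about three distinct columns.
-/
theorem mul_eq_zero_of_half {u : Fin N × Fin N → D} (hN : 3 ≤ N)
    (hs : ∀ a, star (u a) = u a) (ho : IsOrthogonal u)
    (hu : ∀ i j a b c, (a = b ∨ a = c ∨ b = c) →
      u (i, a) * u (i, b) * u (j, c) = u (j, c) * u (i, b) * u (i, a))
    (h3 : ∀ i j k a b, i ≠ j → i ≠ k → j ≠ k →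
      u (i, a) * u (j, a) * u (k, b) + u (i, b) * u (j, a) * u (k, a) = 0)
    (i j a : Fin N) (hij : i ≠ j) : u (i, a) * u (j, a) = 0 := by
  obtain ⟨k, hki, hkj⟩ := exists_third_index hN i j
  refine mul_eq_zero_of_row hs ho (k := k) fun b => ?_
  have h0 : u (j, a) * u (i, a) * u (k, a) = 0 := by
    have := h3 j i k a a hij.symm hkj.symm hki.symm
    rw [← two_smul ℂ] at this
    exact (smul_eq_zero.1 this).resolve_left two_ne_zero
  have h1 := eq_neg_of_add_eq_zero_left (h3 i j k a b hij hki.symm hkj.symm)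
  calc u (j, a) * u (i, a) * u (i, a) * u (j, a) * u (k, b)
      = u (j, a) * u (i, a) * (u (i, a) * u (j, a) * u (k, b)) := by simp only [mul_assoc]
    _ = -((u (j, a) * u (i, a) * u (i, b)) * u (j, a) * u (k, a)) := by
        rw [h1, mul_neg]; simp only [mul_assoc]
    _ = -(u (i, b) * (u (i, a) * u (j, a) * u (j, a)) * u (k, a)) := by
        rw [← hu i j b a a (by simp)]; simp only [mul_assoc]
    _ = -(u (i, b) * u (j, a) * (u (j, a) * u (i, a) * u (k, a))) := by
        rw [← hu j i a a a (by simp)]; simp only [mul_assoc]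
    _ = 0 := by rw [h0, mul_zero, neg_zero]

end CubicCriterion

/-! ## The quantum isometry groups of the spheres -/

/-! ### Relations at the identity matrix, for the counit. -/

section Identity

variable {N : ℕ}

theorem EntrySignCommute.identity {η : Fin N → Fin N → ℂ} (hη : IsSignMatrix η) :
    EntrySignCommute η fun p : Fin N × Fin N => if p.1 = p.2 then (1 : ℂ) else 0 := by
  intro i j a b
  by_cases h : i = a
  · by_cases h' : j = b
    · subst h h'; simp [hη.sq]
    · simp [h']
  · simp [h]

theorem EntrySignHalfCommute.identity {η : Fin N → Fin N → ℂ} (hη : IsSignMatrix η) :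
    EntrySignHalfCommute η fun p : Fin N × Fin N => if p.1 = p.2 then (1 : ℂ) else 0 := by
  intro i j k a b c
  by_cases h : i = a
  · by_cases h' : j = b
    · by_cases h'' : k = c
      · subst h h' h''; simp [hη.triple_sq]
      · simp [h'']
    · simp [h']
  · simp [h]

theorem IsCubic.identity :
    IsCubic fun p : Fin N × Fin N => if p.1 = p.2 then (1 : ℂ) else 0 := by
  constructor
  · intro i j a h
    by_cases h' : i = a
    · subst h'; simp [h.symm]
    · simp [h']
  · intro i a b h
    by_cases h' : i = a
    · subst h'; simp [h]
    · simp [h']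

theorem IsInfCubic.identity :
    IsInfCubic fun p : Fin N × Fin N => if p.1 = p.2 then (1 : ℂ) else 0 := by
  constructor
  · intro i j k a b h
    by_cases h' : i = a
    · subst h'; simp [h.symm]
    · simp [h']
  · intro i j a b c h
    by_cases h' : i = a
    · subst h'; simp [h]
    · simp [h']

end Identity

/-! ### Transposition in the opposite algebra, for the antipode. -/

section Opposite

variable {N : ℕ} {D : Type} [CStarAlgebra D] {u : Fin N × Fin N → D}

theorem EntrySignCommute.op {η : Fin N → Fin N → ℂ} (hη : IsSignMatrix η)
    (hu : EntrySignCommute η u) :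
    EntrySignCommute η fun p => MulOpposite.op (u (p.2, p.1)) := by
  intro i j a b
  simp only [← MulOpposite.op_mul, ← MulOpposite.op_smul]
  rw [hu b a j i, hη.symm b a, hη.symm j i, mul_comm]

theorem EntrySignHalfCommute.op {η : Fin N → Fin N → ℂ} (hη : IsSignMatrix η)
    (hu : EntrySignHalfCommute η u) :
    EntrySignHalfCommute η fun p => MulOpposite.op (u (p.2, p.1)) := by
  intro i j k a b c
  simp only [← MulOpposite.op_mul, ← MulOpposite.op_smul, ← mul_assoc]
  rw [hu c b a k j i, hη.triple_reverse a b c, hη.triple_reverse i j k,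
    mul_comm (tripleSign η a b c)]

theorem IsCubic.op (hu : IsCubic u) : IsCubic fun p => MulOpposite.op (u (p.2, p.1)) :=
  ⟨fun i j a h => by
    simp only [← MulOpposite.op_mul]
    rw [hu.2 a j i h.symm, MulOpposite.op_zero],
  fun i a b h => by
    simp only [← MulOpposite.op_mul]
    rw [hu.1 b a i h.symm, MulOpposite.op_zero]⟩

theorem IsInfCubic.op (hu : IsInfCubic u) : IsInfCubic fun p => MulOpposite.op (u (p.2, p.1)) :=
  ⟨fun i j k a b h => by
    simp only [← MulOpposite.op_mul, ← mul_assoc]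
    rw [hu.2 a b k j i h.symm, MulOpposite.op_zero],
  fun i j a b c h => by
    simp only [← MulOpposite.op_mul, ← mul_assoc]
    rw [hu.1 c b a i j h.symm, MulOpposite.op_zero]⟩

end Opposite

/-! ### Identification of the isometry groups. -/

section Isometries

variable {N : ℕ} {G : NCSpace (Fin N × Fin N)} {X : NCSpace (Fin N)}

open scoped Matrix.Norms.L2Operator

theorem IsUniversalFor.isQuantumIsometryGroup
    {Q : ∀ (D : Type) [CStarAlgebra D], (Fin N × Fin N → D) → Prop}
    (hG : IsUniversalFor G fun D _ u => IsOrthogonal u ∧ Q D u) (hsub : IsQuantumSubgroup G)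
    (hact : ActsAffinely G X)
    (huniv : ∀ H : NCSpace (Fin N × Fin N), IsQuantumSubgroup H → ActsAffinely H X →
      Q H.Alg H.coord) : IsQuantumIsometryGroup X G where
  isQuantumSubgroup := hsub
  actsAffinely := hact
  universal H hH hHX := by
    obtain ⟨r, hr⟩ := hG.lift H.Alg H.coord (fun p => hH.selfAdjoint p.1 p.2)
      ⟨hH.isOrthogonal, huniv H hH hHX⟩
    exact ⟨r, fun i j => hr (i, j)⟩

/-- The quantum isometry group of a sphere with coordinates commuting up to signs. -/
theorem isQuantumIsometryGroup_of_signCommute {η : Fin N → Fin N → ℂ} (hη : IsSignMatrix η)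
    (hm : HasSignModels η)
    (hX : IsUniversalFor X fun _ _ x => OnSphere x ∧ SignCommute η x)
    (hG : IsUniversalFor G fun _ _ u => IsOrthogonal u ∧ EntrySignCommute η u) :
    IsQuantumIsometryGroup X G := by
  refine hG.isQuantumIsometryGroup (Q := fun _ _ u => EntrySignCommute η u)
    (hG.isQuantumSubgroup (Q := fun _ _ u => EntrySignCommute η u)
      (fun _ _ u w h hu hw => hu.mul hη hw h) (.identity hη) fun _ _ u hu => hu.op hη)
    (hG.actsAffinely hX fun _ _ u x _ h hu hx => ⟨hu.1.vec hx.1 h, hu.2.vec hη hx.2 h⟩)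
    fun H hH hact => hH.entrySignCommute hη fun i j a b => ?_
  -- Quadratic relations involve two columns only, so the third index is repeated.
  obtain ⟨g, hg⟩ := hm a b b
  exact quadratic_relation (R := fun _ _ x => SignCommute η x) hX hact hη hg
    (fun t ht => hg.signCommute_realModel ht) (hX.rel.2 i j) (by simp) (by simp)

/-- The quantum isometry group of a sphere with coordinates half-commuting up to signs. -/
theorem isQuantumIsometryGroup_of_signHalfCommute {η : Fin N → Fin N → ℂ} (hη : IsSignMatrix η)
    (hm : HasSignModels η)
    (hX : IsUniversalFor X fun _ _ x => OnSphere x ∧ SignHalfCommute η x)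
    (hG : IsUniversalFor G fun _ _ u => IsOrthogonal u ∧ EntrySignHalfCommute η u) :
    IsQuantumIsometryGroup X G := by
  refine hG.isQuantumIsometryGroup (Q := fun _ _ u => EntrySignHalfCommute η u)
    (hG.isQuantumSubgroup (Q := fun _ _ u => EntrySignHalfCommute η u)
      (fun _ _ u w h hu hw => hu.mul hη hw h) (.identity hη) fun _ _ u hu => hu.op hη)
    (hG.actsAffinely hX fun _ _ u x _ h hu hx => ⟨hu.1.vec hx.1 h, hu.2.vec hη hx.2 h⟩)
    fun H hH hact => ?_
  have key (i j k a b c : Fin N) := half_relation (R := fun _ _ x => SignHalfCommute η x) hX hact hη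
    (hm a b c).choose_spec (fun z hz => (hm a b c).choose_spec.signHalfCommute_complexModel hz)
    (hX.rel.2 i j k) (a := a) (b := b) (c := c) (by simp) (by simp) (by simp)
  -- The second relation has rows and columns exchanged and the order reversed; the antipode brings
  -- it back to the same entries.
  exact fun i j k a b c => hH.half_of_relation hη (key i j k a b c) (key c b a k j i)

theorem isQuantumIsometryGroup_freeSphere (N : ℕ) :
    IsQuantumIsometryGroup (freeSphere N) (freeOrthogonal N) := by
  have hG := isUniversalFor_quantumSubgroup (N := N) ∅ (fun _ _ _ => True) (by simp)
  have hX := isUniversalFor_ncSphere (N := N) ∅ (fun _ _ _ => True) (by simp)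
  exact hG.isQuantumIsometryGroup (Q := fun _ _ _ => True)
    (hG.isQuantumSubgroup (Q := fun _ _ _ => True) (fun _ _ _ _ _ _ _ => trivial) trivial
      fun _ _ _ _ => trivial)
    (hG.actsAffinely hX fun _ _ u x _ h hu hx => ⟨hu.1.vec hx.1 h, trivial⟩)
    fun _ _ _ => trivial

/-- The quantum isometry group of a union of coordinate circles, for coordinates commuting up to
signs. -/
theorem isQuantumIsometryGroup_of_tripleZero (hN : 3 ≤ N) {η : Fin N → Fin N → ℂ}
    (hη : IsSignMatrix η) (hm : HasSignModels η)
    (hoff : ∀ i j a b, i ≠ j → a ≠ b → η i j * η a b = 1)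
    (hX : IsUniversalFor X fun _ _ x => OnSphere x ∧ SignCommute η x ∧ TripleZero x) :
    IsQuantumIsometryGroup X (hyperoctahedral N) := by
  have hG := isUniversalFor_hyperoctahedral (N := N)
  refine hG.isQuantumIsometryGroup
    (Q := fun _ _ u => EntrySignCommute (fun _ _ => 1) u ∧ IsCubic u)
    (hG.isQuantumSubgroup (Q := fun _ _ u => EntrySignCommute (fun _ _ => 1) u ∧ IsCubic u)
      (fun _ _ u w h hu hw => ⟨hu.1.mul isSignMatrix_one hw.1 h, hu.2.mul hw.2 h⟩)
      ⟨.identity isSignMatrix_one, .identity⟩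
      fun _ _ u hu => ⟨hu.1.op isSignMatrix_one, hu.2.op⟩)
    (hG.actsAffinely hX fun _ _ u x _ h hu hx => ⟨hu.1.vec hx.1 h, ?_, ?_⟩)
    fun H hH hact => ?_
  · refine (EntrySignCommute.of_isCubic hη (fun i j a b hi ha => ?_) hu.2.1 hu.2.2).vec hη hx.2.1 h
    rw [hoff i j a b hi ha, one_mul]
  · refine hu.2.2.vec_tripleZero (fun i j k a b hik => ?_) hx.2.2 h
    rw [mul_assoc, hu.2.1.comm (j, b), ← mul_assoc, hu.2.2.1 i k a hik, zero_mul]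
  -- Parameters supported on `{a, b}` respect the extra relation `TripleZero`.
  · have hR (a b : Fin N) : ∃ g, IsSignModel η {a, b} g ∧ ∀ t : Fin N → ℝ,
        (∀ i ∉ ({a, b} : Set (Fin N)), t i = 0) →
        SignCommute η (realModel g t) ∧ TripleZero (realModel g t) := by
      obtain ⟨g, hg⟩ := hm a b b
      have hg' := hg.mono (W := {a, b}) (by simp)
      exact ⟨g, hg', fun t ht => ⟨hg'.signCommute_realModel ht,
        tripleZero_of_support (a := a) (b := b) fun i hi => by simp [realModel, ht i hi]⟩⟩
    have hu : EntrySignCommute η H.coord := hH.entrySignCommute hη fun i j a b => by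
      obtain ⟨g, hg, hgR⟩ := hR a b
      exact quadratic_relation (R := fun _ _ x => SignCommute η x ∧ TripleZero x) hX hact hη hg
        hgR (hX.rel.2.1 i j) (by simp) (by simp)
    have h3 (i j k a b : Fin N) (hij : i ≠ j) (hik : i ≠ k) (hjk : j ≠ k) :=
      cubic_relation (R := fun _ _ x => SignCommute η x ∧ TripleZero x) hX hact
        (hR a b).choose_spec.1 (hR a b).choose_spec.2
        (hX.rel.2.2 i j k hij hik hjk) (a := a) (b := b) (by simp) (by simp)
    have hc : IsCubic H.coord := hH.isCubic fun i j a hij =>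
      hu.mul_eq_zero (u := H.coord) hN (fun p => hH.selfAdjoint p.1 p.2) hH.isOrthogonal h3
        (fun i j k a hij hik hjk => by
          have := h3 i j k a a hij hik hjk
          -- For `b = a` the three terms of the cubic relation coincide.
          have h' : (3 : ℂ) • (H.coord (i, a) * H.coord (j, a) * H.coord (k, a)) = 0 := by
            rw [← this, hη.diag]
            module
          exact (smul_eq_zero.1 h').resolve_left (by norm_num)) i j a hij
    refine ⟨EntrySignCommute.of_isCubic isSignMatrix_one (fun i j a b hi ha => ?_) hu hc, hc⟩
    rw [hoff i j a b hi ha, one_mul]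

/-- Complex models on two coordinates give cubicity first. The relation `abc = 0` on columns then
follows from the image of `x_i x_j x_k = 0`, and the one on rows from the antipode. -/
theorem isQuantumIsometryGroup_polygonalHalfSphere_two (hN : 3 ≤ N) :
    IsQuantumIsometryGroup (polygonalHalfSphere N 2) (infHyperoctahedral N) := by
  have hG := isUniversalFor_quantumSubgroup (N := N) _ (fun _ _ u => IsInfCubic u)
    fun _ _ d => forall_mem_infHyperoctahedral d
  have hX := isUniversalFor_ncSphere (N := N) (halfCommutation N ∪ polygonal N 2)
    (fun _ _ x => SignHalfCommute (fun _ _ => 1) x ∧ TripleZero x) fun _ _ d => by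
      simp only [Set.mem_union, or_imp, forall_and]
      rw [forall_mem_halfCommutation, forall_mem_polygonal_two]
  refine hG.isQuantumIsometryGroup (Q := fun _ _ u => IsInfCubic u)
    (hG.isQuantumSubgroup (Q := fun _ _ u => IsInfCubic u)
      (fun _ _ u w h hu hw => hu.mul hw h) .identity fun _ _ u hu => hu.op)
    (hG.actsAffinely hX fun _ _ u x hs h hu hx => ⟨hu.1.vec hx.1 h,
      hu.2.vec_half hs hu.1 hx.2.2 hx.2.1 h, hu.2.vec_tripleZero hs hx.2.2 h⟩)
    fun H hH hact => ?_
  have hs (p : Fin N × Fin N) := hH.selfAdjoint p.1 p.2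
  have key {i j k : Fin N} {e : ℂ} (hrel : (polygonalHalfSphere N 2).coord i *
      (polygonalHalfSphere N 2).coord j * (polygonalHalfSphere N 2).coord k =
      e • ((polygonalHalfSphere N 2).coord k * (polygonalHalfSphere N 2).coord j *
        (polygonalHalfSphere N 2).coord i)) (p q : Fin N) {a b c : Fin N}
      (ha : a ∈ ({p, q} : Set (Fin N))) (hb : b ∈ ({p, q} : Set (Fin N)))
      (hc : c ∈ ({p, q} : Set (Fin N))) :=
    half_relation (R := fun _ _ x => SignHalfCommute (fun _ _ => 1) x ∧ TripleZero x) hX hact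
      isSignMatrix_one (isSignModel_one {p, q}) (fun z hz =>
        ⟨(isSignModel_one _).signHalfCommute_complexModel hz,
        tripleZero_of_support (a := p) (b := q) fun i hi => by simp [complexModel, hz i hi]⟩) hrel ha hb hc
  have hz {i j k : Fin N} (hij : i ≠ j) (hik : i ≠ k) (hjk : j ≠ k) (a b c : Fin N)
      (h : a = b ∨ a = c ∨ b = c) : H.coord (i, a) * H.coord (j, b) * H.coord (k, c) +
        H.coord (i, c) * H.coord (j, b) * H.coord (k, a) = 0 := by
    have h1 : ∃ p q, a ∈ ({p, q} : Set (Fin N)) ∧ b ∈ ({p, q} : Set (Fin N)) ∧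
        c ∈ ({p, q} : Set (Fin N)) := by
      rcases h with rfl | rfl | rfl
      exacts [⟨a, c, by simp⟩, ⟨a, b, by simp⟩, ⟨a, b, by simp⟩]
    obtain ⟨p, q, ha, hb, hc⟩ := h1
    simpa only [zero_smul, sub_zero, tripleSign_one, one_smul] using
      key ((hX.rel.2.2 i j k hij hik hjk).trans (zero_smul ℂ _).symm) p q ha hb hc
  -- The antipode exchanges rows and columns, so both must span at most two indices for the models
  -- to apply to the relation and to its transposed version.
  have hu (i j a b c : Fin N) (h : a = b ∨ a = c ∨ b = c) :
      H.coord (i, a) * H.coord (i, b) * H.coord (j, c) =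
        H.coord (j, c) * H.coord (i, b) * H.coord (i, a) := by
    have h1 : ∃ p q, a ∈ ({p, q} : Set (Fin N)) ∧ b ∈ ({p, q} : Set (Fin N)) ∧
        c ∈ ({p, q} : Set (Fin N)) := by
      rcases h with rfl | rfl | rfl
      exacts [⟨a, c, by simp⟩, ⟨a, b, by simp⟩, ⟨a, b, by simp⟩]
    obtain ⟨p, q, ha, hb, hc⟩ := h1
    have := hH.half_of_relation isSignMatrix_one (key (hX.rel.2.1 i i j) p q ha hb hc)
      (key (hX.rel.2.1 c b a) i j (by simp) (by simp) (by simp))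
    simpa only [tripleSign_one, one_mul, one_smul] using this
  have hc : IsCubic H.coord := hH.isCubic fun i j a hij =>
    mul_eq_zero_of_half (u := H.coord) hN hs hH.isOrthogonal hu
      (fun i j k a b hij hik hjk => hz hij hik hjk a a b (by simp)) i j a hij
  have hcol : ∀ i j k a b, i ≠ k → H.coord (i, a) * H.coord (j, b) * H.coord (k, a) = 0 := by
    intro i j k a b hik
    by_cases hij : i = j
    · subst hij
      by_cases hab : a = b
      · subst hab
        rw [mul_assoc, hc.1 i k a hik, mul_zero]
      · rw [hc.2 i a b hab, zero_mul]
    by_cases hjk : j = k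
    · subst hjk
      by_cases hab : a = b
      · subst hab
        rw [hc.1 i j a hik, zero_mul]
      · rw [mul_assoc, hc.2 j b a (Ne.symm hab), mul_zero]
    -- With equal outer columns the two terms of the symmetrized relation coincide. When two of the
    -- rows are equal, cubicity was enough.
    have := hz hij hik hjk a b a (by simp)
    rw [← two_smul ℂ] at this
    exact (smul_eq_zero.1 this).resolve_left two_ne_zero
  refine ⟨hcol, fun i j a b c hac => ?_⟩
  have := hH.eval_antipode (f := NCPoly.X (c, i) * NCPoly.X (b, j) * NCPoly.X (a, i))
    (by simpa using hcol c b a i j hac.symm)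
  simpa [← MulOpposite.op_mul, mul_assoc] using this

theorem isQuantumIsometryGroup_polygonalSphere_one (N : ℕ) :
    IsQuantumIsometryGroup (polygonalSphere N 1) (freeHyperoctahedral N) := by
  have hG : IsUniversalFor (freeHyperoctahedral N) _ :=
    isUniversalFor_quantumSubgroup (N := N) (cubicRelations N) (fun _ _ u => IsCubic u)
      fun _ _ d => forall_mem_cubicRelations d
  have hX := isUniversalFor_polygonalSphere_one (N := N)
  refine hG.isQuantumIsometryGroup (Q := fun _ _ u => IsCubic u)
    (hG.isQuantumSubgroup (Q := fun _ _ u => IsCubic u)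
      (fun _ _ u w h hu hw => hu.mul hw h) .identity fun _ _ u hu => hu.op)
    (hG.actsAffinely hX fun _ _ u x hs h hu hx => ⟨hu.1.vec hx.1 h, hu.2.vec_pairZero hx.2 h⟩)
    fun H hH hact => hH.isCubic fun i j a hij => ?_
  -- Parameters supported on a single coordinate suffice: with both columns equal to `a`, the
  -- relation reads `2 u_ia u_ja = 0`.
  have := quadratic_relation (R := fun _ _ x => PairZero x) hX hact isSignMatrix_one
    (isSignModel_one {a}) (fun t ht i j hij => by
      by_cases hi : i = a
      · simp [realModel, ht j (by simpa [← hi] using hij.symm)]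
      · simp [realModel, ht i (by simpa using hi)])
    ((hX.rel.2 i j hij).trans (zero_smul ℂ _).symm) (Set.mem_singleton a) (Set.mem_singleton a)
  simp only [zero_smul, sub_zero, one_smul] at this
  rw [← two_smul ℂ] at this
  exact (smul_eq_zero.1 this).resolve_left two_ne_zero

end Isometries

end

/-- The parameter `d` of the polygonal spheres forbids `d + 1` distinct nonzero coordinates, so the
values 1 and 2 stand for `S^{N-1,0}` and `S^{N-1,1}`. -/
theorem theorem5p6 (N : ℕ) (hN : 1 ≤ N) :
    (IsQuantumIsometryGroup (realSphere N) (orthogonal N) ∧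
      IsQuantumIsometryGroup (halfSphere N) (halfOrthogonal N) ∧
      IsQuantumIsometryGroup (freeSphere N) (freeOrthogonal N)) ∧
    ((3 ≤ N → IsQuantumIsometryGroup (polygonalSphere N 2) (hyperoctahedral N)) ∧
      (3 ≤ N → IsQuantumIsometryGroup (polygonalHalfSphere N 2) (infHyperoctahedral N)) ∧
      IsQuantumIsometryGroup (twistedHalfSphere N) (twistedHalfOrthogonal N)) ∧
    (IsQuantumIsometryGroup (polygonalSphere N 1) (freeHyperoctahedral N) ∧
      (3 ≤ N → IsQuantumIsometryGroup (polygonalTwistedSphere N 2) (hyperoctahedral N)) ∧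
      IsQuantumIsometryGroup (twistedSphere N) (twistedOrthogonal N)) := by
  refine ⟨⟨?_, ?_, isQuantumIsometryGroup_freeSphere N⟩,
    ⟨fun hN3 => ?_, fun hN3 => isQuantumIsometryGroup_polygonalHalfSphere_two hN3, ?_⟩,
    isQuantumIsometryGroup_polygonalSphere_one N, fun hN3 => ?_, ?_⟩
  · exact isQuantumIsometryGroup_of_signCommute isSignMatrix_one hasSignModels_one
      isUniversalFor_realSphere isUniversalFor_orthogonal
  · exact isQuantumIsometryGroup_of_signHalfCommute isSignMatrix_one hasSignModels_one
      (isUniversalFor_ncSphere _ _ fun D _ d => forall_mem_halfCommutation d)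
      (isUniversalFor_quantumSubgroup _ _ fun D _ d => forall_mem_halfOrthogonal d)
  · exact isQuantumIsometryGroup_of_tripleZero hN3 isSignMatrix_one hasSignModels_one
      (fun _ _ _ _ _ _ => one_mul _) isUniversalFor_polygonalSphere_two
  · exact isQuantumIsometryGroup_of_signHalfCommute isSignMatrix_twistSign hasSignModels_twistSign
      (isUniversalFor_ncSphere _ _ fun D _ d => forall_mem_twistedHalfCommutation d)
      (isUniversalFor_quantumSubgroup _ _ fun D _ d => forall_mem_twistedHalfOrthogonal d)
  · refine isQuantumIsometryGroup_of_tripleZero hN3 isSignMatrix_twistSign hasSignModels_twistSign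
      (fun i j a b hi ha => ?_) (isUniversalFor_ncSphere _ _ fun D _ d => ?_)
    · simp [twistSign, hi, ha]
    · simp only [Set.mem_union, or_imp, forall_and]
      rw [forall_mem_anticommutation, forall_mem_polygonal_two]
  · exact isQuantumIsometryGroup_of_signCommute isSignMatrix_twistSign hasSignModels_twistSign
      (isUniversalFor_ncSphere _ _ fun D _ d => forall_mem_anticommutation d)
      (isUniversalFor_quantumSubgroup _ _ fun D _ d => forall_mem_twistedOrthogonal d)
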